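/- Let $H=H(q,p)\colon\mathbb{R}^n\times\mathbb{R}^n\to\mathbb{R}$ be a Hamiltonian of class $C^2$ of classical type: $H(q,-p)=H(q,p)$, and there is a continuous function $\nu\colon\mathbb{R}^n\to\,]0,\infty[$ with $\frac{\partial^2H}{\partial p^2}(q,p)[\xi,\xi]\ge\nu(q)\|\xi\|^2$ for all $q,p,\xi$. Put $V(q)=H(q,0)$. Let $E\in\mathbb{R}$ and let $D\subset\mathbb{R}^n$ be a potential well for $H$ at the energy $E$, i.e. an open set with boundary of class $C^2$ such that $V<E$ on $D$, $V=E$ on $\partial D$ and $\nabla V\neq0$ on $\partial D$; assume that $\overline D$ is compact. For $q\in D$ let $U(q,\cdot)$ be the function that is homogeneous of degree $2$ and equal to $1$ exactly on $\{p: H(q,p)=E\}$, let $G(q,v)=\max_{p}(\langle v,p\rangle-U(q,p))$ be its Legendre transform, and let $F=\sqrt G$ be the Jacobi-Finsler metric on $D$. For $y\in D$ let $X_y$ be the set of all $\gamma\in W^{1,2}([0,1],\overline D)$ with $\gamma(0)=y$, $\gamma([0,1[)\subset D$ and $\gamma(1)\in\partial D$, and let $$\psi(y)=\inf_{\gamma\in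 X_y}\int_0^1G(\gamma(s),\dot\gamma(s))\,ds .$$ For a function $f$ that is $C^2$ near $y\in D$ and for $\xi\neq0$ let $H_f(y,\xi)[\xi,\xi]=\frac{d^2}{ds^2}(f\circ\eta)(0)$, where $\eta$ is the (constant speed) geodesic of $F$ in $D$ with $\eta(0)=y$ and $\dot\eta(0)=\xi$. (1) For every $\bar\delta>0$ there is $\hat\delta\in\,]0,\bar\delta]$ such that for every $y\in D$ with $0<\mathrm{dist}(y,\partial D)\le\hat\delta$ the function $\psi$ is of class $C^2$ near $y$ and $$H_\psi(y,\xi)[\xi,\xi]>0\qquad\text{for all }\xi\in\mathbb{R}^n\setminus\{0\}\text{ with }d\psi(y)[\xi]=0 .$$ (2) There is $c_0>0$ such that for every $c\in\,]0,c_0]$ the superlevel set $\Omega_c=\{y\in D:\psi(y)>c\}$ is open, $\overline{\Omega_c}\subset D$, and $\overline{\Omega_c}$ is strongly concave with respect to $F$: there is a function $\varphi$ of class $C^2$ near $\partial\Omega_c$ with $\varphi>0$ on $\Omega_c$, $\varphi=0$ and $d\varphi\neq0$ on $\partial\Omega_c$, such that $H_\varphi(q,v)[v,v]>0$ for all $q\in\partial\Omega_c$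 and all $v\neq0$ with $d\varphi(q)[v]=0$ (that is, $v\in T_q\partial\Omega_c$). -/

import Mathlib

open Set Filter Topology MeasureTheory

noncomputable section

/-- The Euclidean space `ℝⁿ`. -/
abbrev Eucl (n : ℕ) : Type := EuclideanSpace ℝ (Fin n)

/-- `H = H(q, p)` is a Hamiltonian function of classical type: it is of class `C²`, even in `p`, and
its second derivative in `p` is bounded below by `ν(q) ‖ξ‖²` with `ν` continuous and positive. -/
structure IsClassicalHamiltonian {n : ℕ} (H : Eucl n → Eucl n → ℝ) : Prop where
  contDiff : ContDiff ℝ 2 (fun x : Eucl n × Eucl n => H x.1 x.2)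
  even : ∀ q p, H q (-p) = H q p
  posDef : ∃ ν : Eucl n → ℝ, Continuous ν ∧ (∀ q, 0 < ν q) ∧
    ∀ q p ξ : Eucl n, ν q * ‖ξ‖ ^ 2 ≤ fderiv ℝ (fderiv ℝ (H q)) p ξ ξ

/-- The potential energy `V(q) = H(q, 0)`. -/
def potentialEnergy {n : ℕ} (H : Eucl n → Eucl n → ℝ) (q : Eucl n) : ℝ := H q 0

/-- The open set `D` has a boundary of class `C²`: locally it is a sublevel set of a `C²` function
with nonvanishing differential. -/
def HasC2Boundary {n : ℕ} (D : Set (Eucl n)) : Prop :=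
  ∀ Q ∈ frontier D, ∃ (W : Set (Eucl n)) (f : Eucl n → ℝ), IsOpen W ∧ Q ∈ W ∧
    ContDiffOn ℝ 2 f W ∧ fderiv ℝ f Q ≠ 0 ∧ D ∩ W = {x ∈ W | f x < 0}

/-- `D` is a potential well for `H` at the energy level `E`. -/
structure IsPotentialWell {n : ℕ} (H : Eucl n → Eucl n → ℝ) (E : ℝ) (D : Set (Eucl n)) :
    Prop where
  isOpen : IsOpen D
  boundary : HasC2Boundary D
  lt_on : ∀ q ∈ D, potentialEnergy H q < E
  eq_on : ∀ q ∈ frontier D, potentialEnergy H q = E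
  grad_ne_zero : ∀ q ∈ frontier D, fderiv ℝ (potentialEnergy H) q ≠ 0

/-- The function `U(q, p)` that is homogeneous of degree `2` in `p` and equal to `1` exactly on
`{H = E}`. For `q` with `H(q, 0) < E` it is the square of the Minkowski gauge of the convex body
`{p | H(q, p) ≤ E}`, whose boundary is `{p | H(q, p) = E}`. -/
def jacobiU {n : ℕ} (H : Eucl n → Eucl n → ℝ) (E : ℝ) (q p : Eucl n) : ℝ :=
  gauge {x : Eucl n | H q x ≤ E} p ^ 2

/-- The Legendre transform of `U` in `p`. -/
def jacobiG {n : ℕ} (H : Eucl n → Eucl n → ℝ) (E : ℝ) (q v : Eucl n) : ℝ :=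
  ⨆ p : Eucl n, (inner ℝ v p - jacobiU H E q p)

/-- The Jacobi-Finsler metric `F = √G`. -/
def jacobiF {n : ℕ} (H : Eucl n → Eucl n → ℝ) (E : ℝ) (q v : Eucl n) : ℝ :=
  Real.sqrt (jacobiG H E q v)

/-- `X_y`: the curves of class `W^{1,2}` on `[0, 1]` that start at `y`, stay in `D` on `[0, 1[` and
end on `∂D`. -/
structure IsAdmissibleCurve {n : ℕ} (D : Set (Eucl n)) (y : Eucl n) (γ : ℝ → Eucl n) : Prop where
  absCont : AbsolutelyContinuousOnInterval γ 0 1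
  deriv_memLp : MemLp (deriv γ) 2 (volume.restrict (Icc (0 : ℝ) 1))
  start : γ 0 = y
  inside : ∀ s ∈ Ico (0 : ℝ) 1, γ s ∈ D
  finish : γ 1 ∈ frontier D

/-- The energy functional `J(γ) = ∫₀¹ G(γ, γ')`. -/
def jacobiEnergy {n : ℕ} (H : Eucl n → Eucl n → ℝ) (E : ℝ) (γ : ℝ → Eucl n) : ℝ :=
  ∫ s in (0 : ℝ)..1, jacobiG H E (γ s) (deriv γ s)

/-- The distance-to-boundary energy `ψ(y) = inf_{γ ∈ X_y} J(γ)`. -/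
def psi {n : ℕ} (H : Eucl n → Eucl n → ℝ) (E : ℝ) (D : Set (Eucl n)) (y : Eucl n) : ℝ :=
  sInf (jacobiEnergy H E '' {γ | IsAdmissibleCurve D y γ})

/-- `η : ]-ε, ε[ → D` is a (constant speed) geodesic of the Finsler metric `F` on `D` with
`η(0) = y` and `η'(0) = ξ`: it is of class `C²` and satisfies the Euler-Lagrange equation
`d/ds (∂F²/∂v)(η, η') = (∂F²/∂q)(η, η')`. -/
structure IsFinslerGeodesic {n : ℕ} (F : Eucl n → Eucl n → ℝ) (D : Set (Eucl n))
    (y ξ : Eucl n) (ε : ℝ) (η : ℝ → Eucl n) : Prop where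
  contDiffOn : ContDiffOn ℝ 2 η (Ioo (-ε) ε)
  mapsTo : ∀ s ∈ Ioo (-ε) ε, η s ∈ D
  eulerLagrange : ∀ s ∈ Ioo (-ε) ε,
    HasDerivAt (fun r => fderiv ℝ (fun v => F (η r) v ^ 2) (deriv η r))
      (fderiv ℝ (fun q => F q (deriv η s) ^ 2) (η s)) s
  start : η 0 = y
  velocity : deriv η 0 = ξ

/-- `H_f(y, ξ)[ξ, ξ] = h`: there is a geodesic `η` with `η(0) = y`, `η'(0) = ξ`, and for every such
geodesic the second derivative of `f ∘ η` at `0` exists and is equal to `h`. -/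
def HasFinslerHessian {n : ℕ} (F : Eucl n → Eucl n → ℝ) (D : Set (Eucl n)) (f : Eucl n → ℝ)
    (y ξ : Eucl n) (h : ℝ) : Prop :=
  (∃ (ε : ℝ) (η : ℝ → Eucl n), 0 < ε ∧ IsFinslerGeodesic F D y ξ ε η) ∧
  ∀ (ε : ℝ) (η : ℝ → Eucl n), 0 < ε → IsFinslerGeodesic F D y ξ ε η →
    (∀ᶠ s in 𝓝 (0 : ℝ), DifferentiableAt ℝ (f ∘ η) s) ∧ HasDerivAt (deriv (f ∘ η)) h 0

/-- The closure of the open set `Ω` is strongly concave in `D` with respect to the Finsler metric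
`F`: there is a boundary defining function `φ`, of class `C²` near `∂Ω`, positive on `Ω`, zero with
nonvanishing differential on `∂Ω`, such that `H_φ(q, v)[v, v] > 0` for all `q ∈ ∂Ω` and all nonzero
`v ∈ T_q ∂Ω = ker dφ(q)`. -/
def IsStronglyConcave {n : ℕ} (F : Eucl n → Eucl n → ℝ) (D Ω : Set (Eucl n)) : Prop :=
  IsOpen Ω ∧ closure Ω ⊆ D ∧ ∃ φ : Eucl n → ℝ,
    (∀ q ∈ Ω, 0 < φ q) ∧
    ∀ q ∈ frontier Ω, ContDiffAt ℝ 2 φ q ∧ φ q = 0 ∧ fderiv ℝ φ q ≠ 0 ∧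
      ∀ v : Eucl n, v ≠ 0 → fderiv ℝ φ q v = 0 → ∃ h : ℝ, HasFinslerHessian F D φ q v h ∧ 0 < h

end

set_option linter.unusedSectionVars false

noncomputable section

section Flow

variable {E : Type*} [NormedAddCommGroup E] [NormedSpace ℝ E]

/-- Pointwise application of a continuous family of operators to a continuous family of vectors. -/
def pointwiseApply (K E : Type*) [TopologicalSpace K] [CompactSpace K] [NormedAddCommGroup E]
    [NormedSpace ℝ E] : C(K, E →L[ℝ] E) →L[ℝ] C(K, E) →L[ℝ] C(K, E) :=
  LinearMap.mkContinuous₂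
    (LinearMap.mk₂ ℝ (fun (A : C(K, E →L[ℝ] E)) (h : C(K, E)) => (⟨fun s => A s (h s), by fun_prop⟩ : C(K, E)))
      (fun _ _ _ => by ext; simp) (fun _ _ _ => by ext; simp) (fun _ _ _ => by ext; simp)
      (fun _ _ _ => by ext; simp)) 1 (fun A h => by
        rw [one_mul, ContinuousMap.norm_le _ (by positivity)]
        intro s
        exact (A s).le_of_opNorm_le_of_le (A.norm_coe_le_norm s) (h.norm_coe_le_norm s))

@[simp] theorem pointwiseApply_apply {K : Type*} [TopologicalSpace K] [CompactSpace K]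
    (A : C(K, E →L[ℝ] E)) (h : C(K, E)) (s : K) : pointwiseApply K E A h s = A s (h s) := rfl

/-- The superposition operator `u ↦ X ∘ u`. -/
def superposition (K : Type*) [TopologicalSpace K] (X : E → E) (hX : Continuous X) (u : C(K, E)) : C(K, E) :=
  ContinuousMap.comp ⟨X, hX⟩ u

@[simp] theorem superposition_apply {K : Type*} [TopologicalSpace K] (X : E → E) (hX : Continuous X)
    (u : C(K, E)) (s : K) : superposition K X hX u s = X (u s) := rfl

theorem hasFDerivAt_superposition {K : Type*} [TopologicalSpace K] [CompactSpace K] {X : E → E}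
    (hX : ContDiff ℝ 1 X) (hu : UniformContinuous (fderiv ℝ X)) (u : C(K, E)) :
    HasFDerivAt (superposition K X hX.continuous)
      (pointwiseApply K E (ContinuousMap.comp ⟨fderiv ℝ X, hu.continuous⟩ u)) u := by
  refine HasFDerivAt.of_isLittleO (Asymptotics.isLittleO_iff.2 fun c hc => ?_)
  obtain ⟨δ, hδ, H⟩ := Metric.uniformContinuous_iff.1 hu c hc
  filter_upwards [Metric.ball_mem_nhds u hδ] with v hv
  rw [ContinuousMap.norm_le _ (by positivity)]
  intro s
  have hvs : ‖v s - u s‖ ≤ ‖v - u‖ := (v - u).norm_coe_le_norm s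
  have hlt : ‖v - u‖ < δ := by simpa [dist_eq_norm] using hv
  have := (convex_ball (u s) δ).norm_image_sub_le_of_norm_fderiv_le' (𝕜 := ℝ) (f := X)
    (φ := fderiv ℝ X (u s)) (C := c) (x := u s) (y := v s)
    (fun x _ => hX.differentiable one_ne_zero x)
    (fun x hx => by simpa [dist_eq_norm] using (H hx).le) (Metric.mem_ball_self hδ)
    (by simpa [dist_eq_norm] using hvs.trans_lt hlt)
  calc _ ≤ c * ‖v s - u s‖ := by simpa using this
    _ ≤ _ := by gcongr

theorem contDiff_superposition {K : Type*} [TopologicalSpace K] [CompactSpace K] {X : E → E}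
    (hX : ContDiff ℝ 1 X) (hu : UniformContinuous (fderiv ℝ X)) :
    ContDiff ℝ 1 (superposition K X hX.continuous) :=
  contDiff_one_iff_hasFDerivAt.2 ⟨_, (pointwiseApply K E).continuous.comp
    (ContinuousMap.continuous_postcomp _), hasFDerivAt_superposition hX hu⟩

/-- The interval `[-1, 1]`. -/
abbrev SymmI : Type := Icc (-1 : ℝ) 1

theorem mem_symmI_zero : (0 : ℝ) ∈ Icc (-1 : ℝ) 1 := by simp

/-- Extension of a function on `[-1, 1]` to the real line. -/
def symmExt (u : C(SymmI, E)) : ℝ → E := IccExtend (by norm_num : (-1 : ℝ) ≤ 1) u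

theorem continuous_symmExt (u : C(SymmI, E)) : Continuous (symmExt u) := u.continuous.Icc_extend'

theorem symmExt_of_mem (u : C(SymmI, E)) {s : ℝ} (hs : s ∈ Icc (-1 : ℝ) 1) : symmExt u s = u ⟨s, hs⟩ :=
  IccExtend_of_mem _ _ hs

theorem norm_symmExt_le (u : C(SymmI, E)) (s : ℝ) : ‖symmExt u s‖ ≤ ‖u‖ := u.norm_coe_le_norm _

variable [CompleteSpace E]

/-- The primitive vanishing at `0`, as an operator on `C([-1, 1], E)`. -/
def symmPrimitive (E : Type*) [NormedAddCommGroup E] [NormedSpace ℝ E] [CompleteSpace E] :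
    C(SymmI, E) →L[ℝ] C(SymmI, E) :=
  LinearMap.mkContinuous
    { toFun := fun u => ⟨fun s => ∫ r in (0 : ℝ)..s, symmExt u r,
        ((intervalIntegral.continuous_primitive
          (fun a b => (continuous_symmExt u).intervalIntegrable a b) 0).comp continuous_subtype_val)⟩
      map_add' := fun u v => by
        ext s
        exact intervalIntegral.integral_add ((continuous_symmExt u).intervalIntegrable _ _)
          ((continuous_symmExt v).intervalIntegrable _ _)
      map_smul' := fun c u => by
        ext s
        exact intervalIntegral.integral_smul c (symmExt u) } 1 (fun u => by
    rw [one_mul, ContinuousMap.norm_le _ (norm_nonneg _)]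
    rintro ⟨s, hs⟩
    refine (intervalIntegral.norm_integral_le_of_norm_le_const
      (fun r _ => norm_symmExt_le u r)).trans ?_
    have : |s - 0| ≤ 1 := by rw [sub_zero]; exact abs_le.2 hs
    exact mul_le_of_le_one_right (norm_nonneg u) this)

theorem symmPrimitive_apply (u : C(SymmI, E)) (s : SymmI) :
    symmPrimitive E u s = ∫ r in (0 : ℝ)..s, symmExt u r := rfl

theorem norm_symmPrimitive_le : ‖symmPrimitive E‖ ≤ 1 :=
  LinearMap.mkContinuous_norm_le _ zero_le_one _

theorem hasDerivAt_symmPrimitive (u : C(SymmI, E)) {s : ℝ} (hs : s ∈ Ioo (-1 : ℝ) 1) :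
    HasDerivAt (symmExt (symmPrimitive E u)) (u ⟨s, Ioo_subset_Icc_self hs⟩) s := by
  have h1 : HasDerivAt (fun s => ∫ r in (0 : ℝ)..s, symmExt u r) (symmExt u s) s :=
    intervalIntegral.integral_hasDerivAt_right ((continuous_symmExt u).intervalIntegrable _ _)
      (continuous_symmExt u).stronglyMeasurable.stronglyMeasurableAtFilter
      (continuous_symmExt u).continuousAt
  rw [← symmExt_of_mem u (Ioo_subset_Icc_self hs)]
  refine h1.congr_of_eventuallyEq ?_
  filter_upwards [Ioo_mem_nhds hs.1 hs.2] with r hr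
  rw [symmExt_of_mem _ (Ioo_subset_Icc_self hr), symmPrimitive_apply]

end Flow

section FlowExistence

variable {E : Type*} [NormedAddCommGroup E] [NormedSpace ℝ E]

/-- Constant functions, as an operator into `C([-1, 1], E)`. -/
def constC (E : Type*) [NormedAddCommGroup E] [NormedSpace ℝ E] : E →L[ℝ] C(SymmI, E) :=
  LinearMap.mkContinuous
    { toFun := fun x => ContinuousMap.const _ x
      map_add' := fun _ _ => rfl
      map_smul' := fun _ _ => rfl } 1 (fun x => by
    rw [one_mul, ContinuousMap.norm_le _ (norm_nonneg _)]
    exact fun _ => le_rfl)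

@[simp] theorem constC_apply (x : E) (s : SymmI) : constC E x s = x := rfl

variable [CompleteSpace E]

/-- The integral operator whose fixed points are the time-rescaled integral curves of `X`. -/
def picardMap (X : E → E) (hX : Continuous X) (w : ℝ × E) (u : C(SymmI, E)) : C(SymmI, E) :=
  constC E w.2 + w.1 • symmPrimitive E (superposition SymmI X hX u)

theorem exists_fixedPoint_contDiffOn {X : E → E} (hX : ContDiff ℝ 1 X) (hc : HasCompactSupport X) :
    ∃ T : ℝ, 0 < T ∧ ∃ u : ℝ × E → C(SymmI, E), ContDiffOn ℝ 1 u (Ioo (-T) T ×ˢ univ) ∧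
      ∀ w : ℝ × E, w.1 ∈ Ioo (-T) T → u w = picardMap X hX.continuous w (u w) ∧
        ∀ v, v = picardMap X hX.continuous w v → v = u w := by
  obtain ⟨K, hK⟩ := hX.lipschitzWith_of_hasCompactSupport hc one_ne_zero
  have huc : UniformContinuous (fderiv ℝ X) :=
    (hc.fderiv ℝ).uniformContinuous_of_continuous (hX.continuous_fderiv one_ne_zero)
  have hKd : ∀ x, ‖fderiv ℝ X x‖ ≤ K := fun x => norm_fderiv_le_of_lipschitz ℝ hK
  have hlip : ∀ (t : ℝ) (x : E), LipschitzWith (‖t‖₊ * K) (picardMap X hX.continuous (t, x)) := by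
    intro t x
    refine LipschitzWith.of_dist_le_mul fun u v => ?_
    simp only [picardMap, dist_add_left]
    rw [dist_eq_norm, ← smul_sub, ← map_sub, norm_smul, NNReal.coe_mul, mul_assoc, coe_nnnorm]
    refine mul_le_mul_of_nonneg_left ?_ (norm_nonneg t)
    refine ((symmPrimitive E).le_of_opNorm_le norm_symmPrimitive_le _).trans ?_
    rw [one_mul, ContinuousMap.norm_le _ (by positivity)]
    intro s
    refine (show ‖X (u s) - X (v s)‖ ≤ _ from ?_)
    rw [← dist_eq_norm]
    exact (hK.dist_le_mul _ _).trans (by gcongr; exact ContinuousMap.dist_apply_le_dist s)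
  refine ⟨((K : ℝ) + 1)⁻¹, by positivity, ?_⟩
  set T : ℝ := ((K : ℝ) + 1)⁻¹ with hT
  have hTK : ∀ t ∈ Ioo (-T) T, |t| * K < 1 := by
    intro t ht
    have h1 : |t| < T := abs_lt.2 ht
    have h2 : T * ((K : ℝ) + 1) = 1 := inv_mul_cancel₀ (by positivity)
    have h3 : 0 ≤ (K : ℝ) := K.2
    nlinarith [abs_nonneg t]
  have hcon : ∀ t ∈ Ioo (-T) T, ∀ x, ContractingWith (‖t‖₊ * K) (picardMap X hX.continuous (t, x)) :=
    fun t ht x => ⟨by rw [← NNReal.coe_lt_coe]; simpa using hTK t ht, hlip t x⟩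
  classical
  have hex : ∀ w : ℝ × E, ∃ u : C(SymmI, E), w.1 ∈ Ioo (-T) T →
      u = picardMap X hX.continuous w u ∧ ∀ v, v = picardMap X hX.continuous w v → v = u := by
    rintro ⟨t, x⟩
    by_cases ht : t ∈ Ioo (-T) T
    · refine ⟨ContractingWith.fixedPoint _ (hcon t ht x), fun _ => ⟨?_, fun v hv => ?_⟩⟩
      · exact ((hcon t ht x).fixedPoint_isFixedPt).symm
      · exact (hcon t ht x).fixedPoint_unique hv.symm
    · exact ⟨0, fun h => absurd h ht⟩
  choose u hu using hex
  refine ⟨u, ?_, hu⟩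
  have hopen : IsOpen (Ioo (-T) T ×ˢ (univ : Set E)) := isOpen_Ioo.prod isOpen_univ
  rintro w₀ ⟨hw₀, -⟩
  refine ContDiffAt.contDiffWithinAt ?_
  set N := superposition SymmI X hX.continuous with hN
  have hNc : ContDiff ℝ 1 N := contDiff_superposition hX huc
  set R : (ℝ × E) × C(SymmI, E) → C(SymmI, E) := fun z => z.2 - picardMap X hX.continuous z.1 z.2 with hR
  have hRc : ContDiff ℝ 1 R := by
    refine contDiff_snd.sub (ContDiff.add ?_ ?_)
    · exact (constC E).contDiff.comp (contDiff_snd.comp contDiff_fst)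
    · exact (contDiff_fst.comp contDiff_fst).smul
        ((symmPrimitive E).contDiff.comp (hNc.comp contDiff_snd))
  set Ψ : (ℝ × E) × C(SymmI, E) → (ℝ × E) × C(SymmI, E) := fun z => (z.1, R z) with hΨ
  have hΨc : ContDiff ℝ 1 Ψ := contDiff_fst.prodMk hRc
  set z₀ : (ℝ × E) × C(SymmI, E) := (w₀, u w₀) with hz₀
  set R' := fderiv ℝ R z₀ with hR'
  have hRd : HasFDerivAt R R' z₀ := (hRc.differentiable one_ne_zero z₀).hasFDerivAt
  set Q : C(SymmI, E) →L[ℝ] C(SymmI, E) := w₀.1 • (symmPrimitive E).comp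
    (pointwiseApply SymmI E (ContinuousMap.comp ⟨fderiv ℝ X, huc.continuous⟩ (u w₀))) with hQ
  have hQn : ‖Q‖ < 1 := by
    refine lt_of_le_of_lt (ContinuousLinearMap.opNorm_le_bound _ (by positivity) fun h => ?_)
      (hTK _ hw₀)
    rw [hQ, _root_.smul_apply, norm_smul, Real.norm_eq_abs, mul_assoc]
    refine mul_le_mul_of_nonneg_left ?_ (abs_nonneg _)
    refine ((symmPrimitive E).le_of_opNorm_le norm_symmPrimitive_le _).trans ?_
    rw [one_mul, ContinuousMap.norm_le _ (by positivity)]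
    intro s
    exact ContinuousLinearMap.le_of_opNorm_le_of_le _ (hKd _) (h.norm_coe_le_norm s)
  have hpart : R'.comp (ContinuousLinearMap.inr ℝ _ _) = 1 - Q := by
    have h1 : HasFDerivAt (fun v => R (w₀, v)) (R'.comp (ContinuousLinearMap.inr ℝ _ _)) (u w₀) :=
      hRd.comp (u w₀) (hasFDerivAt_prodMk_right w₀ (u w₀))
    have h2 : HasFDerivAt (fun v => R (w₀, v)) (1 - Q) (u w₀) := by
      simp only [hR, picardMap]
      refine (hasFDerivAt_id (𝕜 := ℝ) (u w₀)).sub ?_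
      refine HasFDerivAt.const_add _ ?_
      exact (((symmPrimitive E).hasFDerivAt).comp _ (hasFDerivAt_superposition hX huc (u w₀))).const_smul w₀.1
    exact h1.unique h2
  let eu : (C(SymmI, E) →L[ℝ] C(SymmI, E))ˣ := Units.oneSub Q hQn
  let e' : C(SymmI, E) ≃L[ℝ] C(SymmI, E) := ContinuousLinearEquiv.unitsEquiv ℝ _ eu
  let e : ((ℝ × E) × C(SymmI, E)) ≃L[ℝ] (ℝ × E) × C(SymmI, E) :=
    (ContinuousLinearEquiv.refl ℝ (ℝ × E)).skewProd e' (R'.comp (ContinuousLinearMap.inl ℝ _ _))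
  have he : HasFDerivAt Ψ (e : (ℝ × E) × C(SymmI, E) →L[ℝ] (ℝ × E) × C(SymmI, E)) z₀ := by
    have h1 : HasFDerivAt Ψ ((ContinuousLinearMap.fst ℝ _ _).prod R') z₀ :=
      hasFDerivAt_fst.prodMk hRd
    convert h1 using 1
    refine ContinuousLinearMap.ext fun ⟨a, b⟩ => ?_
    have h2 : e' b = R' (0, b) := by
      have := congrArg (fun L => L b) hpart
      simpa [e', eu] using this.symm
    refine Prod.ext rfl ?_
    change e' b + R' (a, 0) = R' (a, b)
    rw [h2, ← map_add]
    simp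
  have hst := (hΨc.contDiffAt (x := z₀)).hasStrictFDerivAt' he one_ne_zero
  have hg := (hΨc.contDiffAt (x := z₀)).to_localInverse he one_ne_zero
  have hgr := hst.eventually_right_inverse
  have hΨz : Ψ z₀ = (w₀, 0) := by
    simp only [hΨ, hz₀, hR]
    rw [sub_eq_zero.2 (hu w₀ hw₀).1]
  rw [hΨz] at hg hgr
  have hι : ContDiff ℝ 1 (fun w : ℝ × E => (w, (0 : C(SymmI, E)))) := by fun_prop
  have hcont := (hg.comp w₀ (hι.contDiffAt (x := w₀))).snd
  refine hcont.congr_of_eventuallyEq ?_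
  filter_upwards [(hι.continuous.tendsto w₀).eventually hgr,
    (continuous_fst.isOpen_preimage _ isOpen_Ioo).mem_nhds (show w₀ ∈ Prod.fst ⁻¹' Ioo (-T) T from hw₀)]
    with w hw hwT
  have h1 := congrArg Prod.fst hw
  have h2 := congrArg Prod.snd hw
  simp only [hΨ, hR] at h1 h2
  rw [h1] at h2
  exact ((hu w hwT).2 _ (sub_eq_zero.1 h2)).symm

end FlowExistence

section FlowMap

variable {E : Type*} [NormedAddCommGroup E] [NormedSpace ℝ E]

/-- `Φ` is a `C¹` local flow of `X` on `]-T, T[ × B`, satisfying the variational equation. -/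
structure IsLocalFlow (X : E → E) (B : Set E) (T : ℝ) (Φ : ℝ × E → E) : Prop where
  contDiffOn : ContDiffOn ℝ 1 Φ (Ioo (-T) T ×ˢ B)
  zero : ∀ x ∈ B, Φ (0, x) = x
  deriv : ∀ t ∈ Ioo (-T) T, ∀ x ∈ B, HasDerivAt (fun s => Φ (s, x)) (X (Φ (t, x))) t
  variation : ∀ t ∈ Ioo (-T) T, ∀ x ∈ B, ∀ v,
    HasDerivAt (fun s => fderiv ℝ Φ (s, x) (0, v))
      (fderiv ℝ X (Φ (t, x)) (fderiv ℝ Φ (t, x) (0, v))) t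

variable [CompleteSpace E]

theorem hasDerivAt_of_eq_picard {t : ℝ} {x : E}
    {u v : C(SymmI, E)} (hu : v = constC E x + t • symmPrimitive E u) {s : ℝ}
    (hs : s ∈ Ioo (-1 : ℝ) 1) :
    HasDerivAt (symmExt v) (t • u ⟨s, Ioo_subset_Icc_self hs⟩) s := by
  have h1 := ((hasDerivAt_symmPrimitive u hs).const_smul t).const_add x
  refine h1.congr_of_eventuallyEq ?_
  filter_upwards [Ioo_mem_nhds hs.1 hs.2] with r hr
  change symmExt v r = x + t • symmExt (symmPrimitive E u) r
  rw [symmExt_of_mem _ (Ioo_subset_Icc_self hr), symmExt_of_mem _ (Ioo_subset_Icc_self hr), hu]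
  rfl

theorem exists_isLocalFlow_of_hasCompactSupport {X : E → E} (hX : ContDiff ℝ 1 X)
    (hc : HasCompactSupport X) :
    ∃ T : ℝ, 0 < T ∧ ∃ Φ : ℝ × E → E, IsLocalFlow X univ T Φ := by
  obtain ⟨T, hT, u, huc, hu⟩ := exists_fixedPoint_contDiffOn hX hc
  have huf : UniformContinuous (fderiv ℝ X) :=
    (hc.fderiv ℝ).uniformContinuous_of_continuous (hX.continuous_fderiv one_ne_zero)
  let one' : SymmI := ⟨1, by norm_num⟩
  let ev : SymmI → C(SymmI, E) →L[ℝ] E := fun s => ContinuousMap.evalCLM ℝ s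
  set Φ : ℝ × E → E := fun w => u w one' with hΦ
  have hΦc : ContDiffOn ℝ 1 Φ (Ioo (-T) T ×ˢ univ) := (ev one').contDiff.comp_contDiffOn huc
  have hopen : IsOpen (Ioo (-T) T ×ˢ (univ : Set E)) := isOpen_Ioo.prod isOpen_univ
  have hscale : ∀ t ∈ Ioo (-T) T, ∀ x, ∀ s : SymmI, u (t, x) s = Φ (t * s, x) := by
    intro t ht x s
    have hts : t * s ∈ Ioo (-T) T := by
      rw [mem_Ioo, ← abs_lt, abs_mul] at *
      have : |(s : ℝ)| ≤ 1 := abs_le.2 s.2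
      nlinarith [abs_nonneg t, abs_nonneg (s : ℝ)]
    have hmul : ∀ r : SymmI, (s : ℝ) * r ∈ Icc (-1 : ℝ) 1 := fun r => by
      rw [mem_Icc, ← abs_le, abs_mul]
      exact mul_le_one₀ (abs_le.2 s.2) (abs_nonneg _) (abs_le.2 r.2)
    let v : C(SymmI, E) := (u (t, x)).comp ⟨fun r => ⟨(s : ℝ) * r, hmul r⟩, by fun_prop⟩
    have hv : v = picardMap X hX.continuous (t * s, x) v := by
      ext r
      have h1 := congrArg (fun f => f ⟨(s : ℝ) * r, hmul r⟩) (hu (t, x) ht).1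
      change u (t, x) ⟨(s : ℝ) * r, hmul r⟩ = _
      refine h1.trans ?_
      change x + t • (∫ r' in (0 : ℝ)..(s * r), symmExt (superposition SymmI X hX.continuous (u (t, x))) r') =
        x + (t * s) • ∫ r' in (0 : ℝ)..r, symmExt (superposition SymmI X hX.continuous v) r'
      rw [mul_smul]
      congr 2
      have h2 : ∫ r' in (0 : ℝ)..r, symmExt (superposition SymmI X hX.continuous v) r' =
          ∫ r' in (0 : ℝ)..r, symmExt (superposition SymmI X hX.continuous (u (t, x))) (s * r') := by
        refine intervalIntegral.integral_congr fun r' hr' => ?_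
        have hr'' : r' ∈ Icc (-1 : ℝ) 1 :=
          (uIcc_subset_Icc mem_symmI_zero r.2) hr'
        change symmExt _ r' = symmExt _ (s * r')
        rw [symmExt_of_mem _ hr'', symmExt_of_mem _ (hmul ⟨r', hr''⟩)]
        rfl
      rw [h2, intervalIntegral.smul_integral_comp_mul_left]
      simp
    have h3 := (hu (t * s, x) hts).2 v hv
    have h4 := congrArg (fun f => f one') h3
    change u (t, x) ⟨(s : ℝ) * 1, _⟩ = _ at h4
    simpa using h4
  have hbig : ∀ t ∈ Ioo (-T) T, ∃ t₁, 0 < t₁ ∧ t₁ ∈ Ioo (-T) T ∧ t / t₁ ∈ Ioo (-1 : ℝ) 1 := by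
    intro t ht
    obtain ⟨t₁, h1, h2⟩ := exists_between (abs_lt.2 ht)
    have h0 : 0 < t₁ := (abs_nonneg t).trans_lt h1
    refine ⟨t₁, h0, ⟨by linarith, h2⟩, ?_⟩
    rw [mem_Ioo, ← abs_lt, abs_div, abs_of_pos h0, div_lt_one h0]
    exact h1
  have hev : ∀ t₁, 0 < t₁ → ∀ t, t / t₁ ∈ Ioo (-1 : ℝ) 1 → ∀ᶠ s in 𝓝 t, s / t₁ ∈ Ioo (-1 : ℝ) 1 :=
    fun t₁ h0 t ht => (continuous_id.div_const t₁).continuousAt.eventually (isOpen_Ioo.mem_nhds ht)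
  refine ⟨T, hT, Φ, hΦc, ?_, ?_, ?_⟩
  · intro x _
    have h0 : (0 : ℝ) ∈ Ioo (-T) T := ⟨by linarith, hT⟩
    have h1 := (hu (0, x) h0).1
    have h2 := congrArg (fun f => f one') h1
    simpa [picardMap] using h2
  · intro t ht x _
    obtain ⟨t₁, h0, h1, h2⟩ := hbig t ht
    have h3 := hasDerivAt_of_eq_picard (hu (t₁, x) h1).1 h2
    have h4 := h3.scomp t ((hasDerivAt_id t).div_const t₁)
    have h5 : (1 / t₁) • (t₁ • (superposition SymmI X hX.continuous (u (t₁, x)))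
        ⟨t / t₁, Ioo_subset_Icc_self h2⟩) = X (Φ (t, x)) := by
      rw [smul_smul, one_div_mul_cancel h0.ne', one_smul, superposition_apply, hscale t₁ h1]
      simp only []
      rw [mul_div_cancel₀ _ h0.ne']
    rw [← h5]
    refine h4.congr_of_eventuallyEq ?_
    filter_upwards [hev t₁ h0 t h2] with s hs
    change Φ (s, x) = symmExt (u (t₁, x)) (s / t₁)
    rw [symmExt_of_mem _ (Ioo_subset_Icc_self hs), hscale t₁ h1]
    simp only []
    rw [mul_div_cancel₀ _ h0.ne']
  · intro t ht x _ v
    obtain ⟨t₁, h0, h1, h2⟩ := hbig t ht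
    have hd : HasFDerivAt u (fderiv ℝ u (t₁, x)) (t₁, x) :=
      ((huc.contDiffAt (hopen.mem_nhds ⟨h1, mem_univ _⟩)).differentiableAt one_ne_zero).hasFDerivAt
    have hdx : HasFDerivAt (fun y => u (t₁, y))
        ((fderiv ℝ u (t₁, x)).comp (ContinuousLinearMap.inr ℝ ℝ E)) x :=
      hd.comp x (hasFDerivAt_prodMk_right t₁ x)
    set h : C(SymmI, E) := fderiv ℝ u (t₁, x) (0, v) with hh
    have hpt : ∀ s (hs : s / t₁ ∈ Ioo (-1 : ℝ) 1), fderiv ℝ Φ (s, x) (0, v) =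
        h ⟨s / t₁, Ioo_subset_Icc_self hs⟩ := by
      intro s hs
      have hsT : s ∈ Ioo (-T) T := by
        have := abs_lt.2 hs
        rw [abs_div, abs_of_pos h0, div_lt_one h0] at this
        rw [mem_Ioo, ← abs_lt]
        exact this.trans h1.2
      have e1 : HasFDerivAt (fun y => Φ (s, y))
          ((fderiv ℝ Φ (s, x)).comp (ContinuousLinearMap.inr ℝ ℝ E)) x :=
        (((hΦc.contDiffAt (hopen.mem_nhds ⟨hsT, mem_univ _⟩)).differentiableAt
          one_ne_zero).hasFDerivAt).comp x (hasFDerivAt_prodMk_right s x)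
      have e2 : HasFDerivAt (fun y => u (t₁, y) ⟨s / t₁, Ioo_subset_Icc_self hs⟩)
          ((ev ⟨s / t₁, Ioo_subset_Icc_self hs⟩).comp
            ((fderiv ℝ u (t₁, x)).comp (ContinuousLinearMap.inr ℝ ℝ E))) x :=
        (ev _).hasFDerivAt.comp x hdx
      have e3 : (fun y => u (t₁, y) ⟨s / t₁, Ioo_subset_Icc_self hs⟩) = fun y => Φ (s, y) := by
        funext y
        rw [hscale t₁ h1]
        simp only []
        rw [mul_div_cancel₀ _ h0.ne']
      rw [e3] at e2
      have e4 := congrArg (fun L => L v) (e1.unique e2)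
      simpa [ev] using e4
    have hvar : h = constC E v + t₁ • symmPrimitive E (pointwiseApply SymmI E
        (ContinuousMap.comp ⟨fderiv ℝ X, huf.continuous⟩ (u (t₁, x))) h) := by
      have e1 : HasFDerivAt (fun y => constC E y + t₁ • symmPrimitive E
          (superposition SymmI X hX.continuous (u (t₁, y))))
          (constC E + t₁ • (symmPrimitive E).comp ((pointwiseApply SymmI E
            (ContinuousMap.comp ⟨fderiv ℝ X, huf.continuous⟩ (u (t₁, x)))).comp
            ((fderiv ℝ u (t₁, x)).comp (ContinuousLinearMap.inr ℝ ℝ E)))) x := by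
        exact (constC E).hasFDerivAt.add (((symmPrimitive E).hasFDerivAt.comp x
          ((hasFDerivAt_superposition hX huf (u (t₁, x))).comp x hdx)).const_smul t₁)
      have e3 : (fun y => u (t₁, y)) = fun y => constC E y + t₁ • symmPrimitive E
          (superposition SymmI X hX.continuous (u (t₁, y))) :=
        funext fun y => (hu (t₁, y) h1).1
      rw [← e3] at e1
      have e4 := congrArg (fun L => L v) (hdx.unique e1)
      simpa [hh] using e4
    have h3 := hasDerivAt_of_eq_picard hvar h2
    have h4 := h3.scomp t ((hasDerivAt_id t).div_const t₁)
    have h5 : (1 / t₁) • (t₁ • (pointwiseApply SymmI E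
        (ContinuousMap.comp ⟨fderiv ℝ X, huf.continuous⟩ (u (t₁, x))) h)
        ⟨t / t₁, Ioo_subset_Icc_self h2⟩) =
        fderiv ℝ X (Φ (t, x)) (fderiv ℝ Φ (t, x) (0, v)) := by
      rw [smul_smul, one_div_mul_cancel h0.ne', one_smul, pointwiseApply_apply, hpt t h2]
      simp only [ContinuousMap.comp_apply, ContinuousMap.coe_mk]
      rw [hscale t₁ h1]
      simp only []
      rw [mul_div_cancel₀ _ h0.ne']
    rw [← h5]
    refine h4.congr_of_eventuallyEq ?_
    filter_upwards [hev t₁ h0 t h2] with s hs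
    change _ = symmExt h (s / t₁)
    rw [symmExt_of_mem _ (Ioo_subset_Icc_self hs), hpt s hs]

/-- Local flows of `C¹` vector fields exist on every ball, for a uniform time, and can be kept in
a prescribed neighbourhood of the ball. -/
theorem exists_isLocalFlow [FiniteDimensional ℝ E] {X : E → E} (hX : ContDiff ℝ 1 X) (r : ℝ) (hr : 0 < r) :
    ∃ T : ℝ, 0 < T ∧ ∃ Φ : ℝ × E → E, IsLocalFlow X (Metric.ball 0 r) T Φ := by
  let χ : ContDiffBump (0 : E) := ⟨r + 1, r + 2, by linarith, by linarith⟩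
  set Y : E → E := fun x => χ x • X x with hY
  have hYc : ContDiff ℝ 1 Y := χ.contDiff.smul hX
  have hYs : HasCompactSupport Y := χ.hasCompactSupport.smul_right
  obtain ⟨T, hT, Φ, hΦ⟩ := exists_isLocalFlow_of_hasCompactSupport hYc hYs
  obtain ⟨M, hM⟩ := hYs.exists_bound_of_continuous hYc.continuous
  have hM0 : 0 ≤ M := (norm_nonneg _).trans (hM 0)
  have hYX : ∀ x ∈ Metric.ball (0 : E) (r + 1), Y x = X x := fun x hx => by
    simp [hY, χ.one_of_mem_closedBall (Metric.ball_subset_closedBall hx)]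
  have hYX' : ∀ x ∈ Metric.ball (0 : E) (r + 1), fderiv ℝ Y x = fderiv ℝ X x := fun x hx =>
    Filter.EventuallyEq.fderiv_eq (by
      filter_upwards [Metric.isOpen_ball.mem_nhds hx] with y hy using hYX y hy)
  set T' := min T (M + 1)⁻¹ with hT'
  have hsub : Ioo (-T') T' ⊆ Ioo (-T) T := fun t ht => by
    rw [mem_Ioo, ← abs_lt] at *
    exact ht.trans_le (min_le_left _ _)
  have hstay : ∀ t ∈ Ioo (-T') T', ∀ x ∈ Metric.ball (0 : E) r, Φ (t, x) ∈ Metric.ball (0 : E) (r + 1) := by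
    intro t ht x hx
    have h0 : (0 : ℝ) ∈ Ioo (-T) T := ⟨by linarith, hT⟩
    have h1 := (convex_Ioo (-T) T).norm_image_sub_le_of_norm_hasDerivWithin_le
      (f := fun s => Φ (s, x)) (C := M) (x := 0) (y := t)
      (fun s hs => (hΦ.deriv s hs x (mem_univ _)).hasDerivWithinAt) (fun s _ => hM _) h0 (hsub ht)
    rw [hΦ.zero x (mem_univ _), sub_zero, Real.norm_eq_abs] at h1
    have h2 : |t| < (M + 1)⁻¹ := (abs_lt.2 ht).trans_le (min_le_right _ _)
    have h3 : (M + 1)⁻¹ * (M + 1) = 1 := inv_mul_cancel₀ (by positivity)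
    have h4 : M * |t| < 1 := by nlinarith [abs_nonneg t]
    rw [mem_ball_zero_iff] at hx ⊢
    calc ‖Φ (t, x)‖ = ‖(Φ (t, x) - x) + x‖ := by simp
      _ ≤ ‖Φ (t, x) - x‖ + ‖x‖ := norm_add_le _ _
      _ < r + 1 := by linarith
  refine ⟨T', lt_min hT (by positivity), Φ, ?_, fun x _ => hΦ.zero x (mem_univ _), ?_, ?_⟩
  · exact hΦ.contDiffOn.mono (prod_mono hsub (subset_univ _))
  · intro t ht x hx
    rw [← hYX _ (hstay t ht x hx)]
    exact hΦ.deriv t (hsub ht) x (mem_univ _)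
  · intro t ht x hx v
    rw [← hYX' _ (hstay t ht x hx)]
    exact hΦ.variation t (hsub ht) x (mem_univ _) v

end FlowMap

section Hamiltonian

variable {n : ℕ} {H : Eucl n → Eucl n → ℝ}

/-- The Hamiltonian as a function on phase space. -/
def ham (H : Eucl n → Eucl n → ℝ) (x : Eucl n × Eucl n) : ℝ := H x.1 x.2

/-- The partial gradient `∂H/∂p`. -/
def gradP (H : Eucl n → Eucl n → ℝ) (x : Eucl n × Eucl n) : Eucl n :=
  (InnerProductSpace.toDual ℝ (Eucl n)).symm
    ((fderiv ℝ (ham H) x).comp (ContinuousLinearMap.inr ℝ (Eucl n) (Eucl n)))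

/-- The partial gradient `∂H/∂q`. -/
def gradQ (H : Eucl n → Eucl n → ℝ) (x : Eucl n × Eucl n) : Eucl n :=
  (InnerProductSpace.toDual ℝ (Eucl n)).symm
    ((fderiv ℝ (ham H) x).comp (ContinuousLinearMap.inl ℝ (Eucl n) (Eucl n)))

theorem inner_gradP (x : Eucl n × Eucl n) (v : Eucl n) :
    inner ℝ (gradP H x) v = fderiv ℝ (ham H) x (0, v) := by
  simp [gradP]

theorem inner_gradQ (x : Eucl n × Eucl n) (v : Eucl n) :
    inner ℝ (gradQ H x) v = fderiv ℝ (ham H) x (v, 0) := by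
  simp [gradQ]

theorem fderiv_ham_apply (x a : Eucl n × Eucl n) :
    fderiv ℝ (ham H) x a = inner ℝ (gradQ H x) a.1 + inner ℝ (gradP H x) a.2 := by
  rw [inner_gradP, inner_gradQ, ← map_add]
  simp

namespace IsClassicalHamiltonian

variable (hH : IsClassicalHamiltonian H)

include hH

theorem contDiff_ham : ContDiff ℝ 2 (ham H) := hH.contDiff

theorem contDiff_fderiv_ham : ContDiff ℝ 1 (fderiv ℝ (ham H)) :=
  hH.contDiff_ham.fderiv_right (by norm_num [one_add_one_eq_two])

theorem contDiff_gradP : ContDiff ℝ 1 (gradP H) :=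
  (InnerProductSpace.toDual ℝ (Eucl n)).symm.contDiff.comp
    (hH.contDiff_fderiv_ham.clm_comp contDiff_const)

theorem contDiff_gradQ : ContDiff ℝ 1 (gradQ H) :=
  (InnerProductSpace.toDual ℝ (Eucl n)).symm.contDiff.comp
    (hH.contDiff_fderiv_ham.clm_comp contDiff_const)

theorem hasFDerivAt_ham (x : Eucl n × Eucl n) : HasFDerivAt (ham H) (fderiv ℝ (ham H) x) x :=
  (hH.contDiff_ham.differentiable (by norm_num) x).hasFDerivAt

theorem hasFDerivAt_gradP (x : Eucl n × Eucl n) : HasFDerivAt (gradP H) (fderiv ℝ (gradP H) x) x :=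
  (hH.contDiff_gradP.differentiable (by norm_num) x).hasFDerivAt

theorem hasFDerivAt_right (q p : Eucl n) : HasFDerivAt (H q) (innerSL ℝ (gradP H (q, p))) p := by
  refine HasFDerivAt.congr_fderiv
    ((hH.hasFDerivAt_ham (q, p)).comp p (hasFDerivAt_prodMk_right q p)) ?_
  ext v
  simp [inner_gradP]

theorem hasFDerivAt_potentialEnergy (q : Eucl n) :
    HasFDerivAt (potentialEnergy H) (innerSL ℝ (gradQ H (q, 0))) q := by
  have h := HasFDerivAt.comp (g := ham H) (f := fun e => (e, (0 : Eucl n))) q (hH.hasFDerivAt_ham (q, 0))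
    (hasFDerivAt_prodMk_left q (0 : Eucl n))
  refine HasFDerivAt.congr_fderiv (f := potentialEnergy H) h ?_
  ext v
  simp [inner_gradQ]

theorem contDiff_potentialEnergy : ContDiff ℝ 2 (potentialEnergy H) :=
  hH.contDiff_ham.comp (contDiff_id.prodMk contDiff_const)

theorem gradP_zero (q : Eucl n) : gradP H (q, 0) = 0 := by
  have h1 := hH.hasFDerivAt_right q 0
  have h2 : HasFDerivAt (fun p => H q (-p)) (-(innerSL ℝ (gradP H (q, 0)))) 0 := by
    have h3 : HasFDerivAt (H q) (innerSL ℝ (gradP H (q, 0))) (-0) := by simpa using h1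
    refine HasFDerivAt.congr_fderiv
      (h3.comp (0 : Eucl n) (hasFDerivAt_id (𝕜 := ℝ) (0 : Eucl n)).neg) ?_
    ext v
    simp
  simp only [hH.even] at h2
  have h4 := h1.unique h2
  have h5 := congrArg (fun L => L (gradP H (q, 0))) h4
  simp only [innerSL_apply_apply, _root_.neg_apply] at h5
  have h6 : inner ℝ (gradP H (q, 0)) (gradP H (q, 0)) = (0 : ℝ) := by linarith
  exact inner_self_eq_zero.1 h6

theorem hasDerivAt_gradP_line (q p d : Eucl n) (s : ℝ) :
    HasDerivAt (fun s : ℝ => inner ℝ (gradP H (q, p + s • d)) d)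
      (inner ℝ (fderiv ℝ (gradP H) (q, p + s • d) (0, d)) d) s := by
  have h1 : HasDerivAt (fun s : ℝ => (q, p + s • d)) ((0 : Eucl n), d) s := by
    refine (hasDerivAt_const s q).prodMk ?_
    simpa using ((hasDerivAt_id s).smul_const d).const_add p
  have h2 := (hH.hasFDerivAt_gradP (q, p + s • d)).comp_hasDerivAt s h1
  simpa using h2.inner ℝ (hasDerivAt_const s d)

theorem hasDerivAt_line (q p d : Eucl n) (s : ℝ) :
    HasDerivAt (fun s : ℝ => H q (p + s • d)) (inner ℝ (gradP H (q, p + s • d)) d) s := by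
  have h1 : HasDerivAt (fun s : ℝ => p + s • d) d s := by
    simpa using ((hasDerivAt_id s).smul_const d).const_add p
  exact (hH.hasFDerivAt_right q (p + s • d)).comp_hasDerivAt s h1

theorem exists_convexity : ∃ ν : Eucl n → ℝ, Continuous ν ∧ (∀ q, 0 < ν q) ∧
    ∀ q p ξ : Eucl n, ν q * ‖ξ‖ ^ 2 ≤ inner ℝ (fderiv ℝ (gradP H) (q, p) (0, ξ)) ξ := by
  obtain ⟨ν, h1, h2, h3⟩ := hH.posDef
  refine ⟨ν, h1, h2, fun q p ξ => (h3 q p ξ).trans_eq ?_⟩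
  have e1 : fderiv ℝ (H q) = fun p => innerSL ℝ (gradP H (q, p)) :=
    funext fun p => (hH.hasFDerivAt_right q p).fderiv
  have e2 : HasFDerivAt (fun p => innerSL ℝ (gradP H (q, p)))
      ((innerSL ℝ).comp ((fderiv ℝ (gradP H) (q, p)).comp (ContinuousLinearMap.inr ℝ _ _))) p :=
    (innerSL ℝ).hasFDerivAt.comp p
      ((hH.hasFDerivAt_gradP (q, p)).comp p (hasFDerivAt_prodMk_right q p))
  rw [e1, e2.fderiv]
  simp

/-- The convexity modulus of the kinetic energy. -/
def modulus : Eucl n → ℝ := hH.exists_convexity.choose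

theorem continuous_modulus : Continuous hH.modulus := hH.exists_convexity.choose_spec.1

theorem modulus_pos (q : Eucl n) : 0 < hH.modulus q := hH.exists_convexity.choose_spec.2.1 q

theorem modulus_le (q p ξ : Eucl n) :
    hH.modulus q * ‖ξ‖ ^ 2 ≤ inner ℝ (fderiv ℝ (gradP H) (q, p) (0, ξ)) ξ :=
  hH.exists_convexity.choose_spec.2.2 q p ξ

theorem gradP_line_le (q p d : Eucl n) {s : ℝ} (hs : 0 ≤ s) :
    inner ℝ (gradP H (q, p)) d + hH.modulus q * ‖d‖ ^ 2 * s ≤ inner ℝ (gradP H (q, p + s • d)) d := by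
  have h := (convex_univ).mul_sub_le_image_sub_of_le_deriv
    (f := fun s : ℝ => inner ℝ (gradP H (q, p + s • d)) d) (C := hH.modulus q * ‖d‖ ^ 2)
    (fun s _ => (hH.hasDerivAt_gradP_line q p d s).continuousAt.continuousWithinAt)
    (fun s _ => (hH.hasDerivAt_gradP_line q p d s).differentiableAt.differentiableWithinAt)
    (fun s _ => by rw [(hH.hasDerivAt_gradP_line q p d s).deriv]; exact hH.modulus_le q _ d)
    0 (mem_univ _) s (mem_univ _) hs
  simp only [zero_smul, add_zero, sub_zero] at h
  linarith

theorem strong_convexity (q p p' : Eucl n) :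
    H q p + inner ℝ (gradP H (q, p)) (p' - p) + hH.modulus q / 2 * ‖p' - p‖ ^ 2 ≤ H q p' := by
  set d := p' - p with hd
  set k : ℝ → ℝ := fun s => H q (p + s • d) - s * inner ℝ (gradP H (q, p)) d -
    hH.modulus q * ‖d‖ ^ 2 * (s ^ 2 / 2) with hk
  have hkd : ∀ s, HasDerivAt k (inner ℝ (gradP H (q, p + s • d)) d - inner ℝ (gradP H (q, p)) d -
      hH.modulus q * ‖d‖ ^ 2 * s) s := by
    intro s
    have h1 := ((hasDerivAt_id s).mul_const (inner ℝ (gradP H (q, p)) d : ℝ))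
    have h2 := (((hasDerivAt_id s).pow 2).div_const 2).const_mul (hH.modulus q * ‖d‖ ^ 2)
    convert! ((hH.hasDerivAt_line q p d s).sub h1).sub h2 using 1
    simp
  have hmono : MonotoneOn k (Icc 0 1) := monotoneOn_of_deriv_nonneg (convex_Icc 0 1)
    (fun s _ => (hkd s).continuousAt.continuousWithinAt)
    (fun s _ => (hkd s).differentiableAt.differentiableWithinAt)
    (fun s hs => by
      rw [interior_Icc] at hs
      rw [(hkd s).deriv]
      linarith [hH.gradP_line_le q p d hs.1.le])
  have h := hmono (left_mem_Icc.2 zero_le_one) (right_mem_Icc.2 zero_le_one) zero_le_one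
  simp only [hk, zero_smul, add_zero, one_smul, one_mul, zero_mul] at h
  rw [show p + d = p' by simp [hd]] at h
  linarith

theorem inner_gradP_self_ge (q p : Eucl n) :
    hH.modulus q * ‖p‖ ^ 2 ≤ inner ℝ (gradP H (q, p)) p := by
  have h := hH.gradP_line_le q 0 p zero_le_one
  simpa [hH.gradP_zero] using h

theorem inner_gradP_self_pos (q : Eucl n) {p : Eucl n} (hp : p ≠ 0) :
    0 < inner ℝ (gradP H (q, p)) p :=
  lt_of_lt_of_le (mul_pos (hH.modulus_pos q) (pow_pos (norm_pos_iff.2 hp) 2))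
    (hH.inner_gradP_self_ge q p)

theorem kinetic_ge (q p : Eucl n) : hH.modulus q / 2 * ‖p‖ ^ 2 ≤ H q p - H q 0 := by
  have h := hH.strong_convexity q 0 p
  simp [hH.gradP_zero] at h
  linarith

theorem kinetic_le (q p : Eucl n) : H q p - H q 0 ≤ inner ℝ (gradP H (q, p)) p := by
  have h := hH.strong_convexity q p 0
  have h2 : 0 ≤ hH.modulus q / 2 * ‖(0 : Eucl n) - p‖ ^ 2 := by
    have := hH.modulus_pos q
    positivity
  simp only [zero_sub, inner_neg_right] at h h2
  linarith

theorem continuous_right (q : Eucl n) : Continuous (H q) :=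
  continuous_iff_continuousAt.2 fun p => (hH.hasFDerivAt_right q p).continuousAt

theorem isCompact_sublevel (q : Eucl n) (E : ℝ) : IsCompact {p | H q p ≤ E} := by
  refine Metric.isCompact_of_isClosed_isBounded
    (isClosed_le (hH.continuous_right q) continuous_const) ?_
  refine (Metric.isBounded_iff_subset_closedBall 0).2
    ⟨(2 / hH.modulus q * (E - H q 0)) + 1, fun p hp => ?_⟩
  rw [mem_closedBall_zero_iff]
  have h1 := hH.kinetic_ge q p
  have h2 := hH.modulus_pos q
  have h3 : ‖p‖ ^ 2 ≤ 2 / hH.modulus q * (E - H q 0) := by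
    rw [div_mul_eq_mul_div, le_div_iff₀ h2]
    have : H q p ≤ E := hp
    linarith
  nlinarith [sq_nonneg (‖p‖ - 1)]

end IsClassicalHamiltonian

/-- `(p, μ)` is the momentum on the energy surface with velocity `v = μ ∂H/∂p(q, p)`. -/
structure IsMomentum (H : Eucl n → Eucl n → ℝ) (E : ℝ) (q v p : Eucl n) (μ : ℝ) : Prop where
  energy : H q p = E
  velocity : v = μ • gradP H (q, p)
  pos : 0 < μ

theorem inner_le_gauge_mul {C : Set (Eucl n)} (hC : C ∈ 𝓝 0) {v : Eucl n} {a : ℝ}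
    (h : ∀ c ∈ C, inner ℝ v c ≤ a) (ha : 0 ≤ a) (π : Eucl n) : inner ℝ v π ≤ gauge C π * a := by
  refine le_of_forall_gt_imp_ge_of_dense fun r hr => ?_
  rcases ha.eq_or_lt with rfl | ha
  · obtain ⟨b, hb, -, c, hc, rfl⟩ := exists_lt_of_gauge_lt (absorbent_nhds_zero hC)
      (lt_add_one (gauge C π))
    simp only [mul_zero] at hr
    rw [inner_smul_right]
    nlinarith [h c hc]
  · have h1 : gauge C π < r / a := by rwa [lt_div_iff₀ ha]
    obtain ⟨b, hb, hbr, c, hc, rfl⟩ := exists_lt_of_gauge_lt (absorbent_nhds_zero hC) h1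
    rw [lt_div_iff₀ ha] at hbr
    rw [inner_smul_right]
    nlinarith [h c hc]

theorem jacobiG_eq_of_isMax {E : ℝ} {q v p : Eucl n} (hC : {x | H q x ≤ E} ∈ 𝓝 0)
    (hp : H q p ≤ E) (hmax : ∀ c, H q c ≤ E → inner ℝ v c ≤ inner ℝ v p) :
    jacobiG H E q v = inner ℝ v p ^ 2 / 4 := by
  set a : ℝ := inner ℝ v p with ha
  have ha0 : 0 ≤ a := by
    have h0 : (0 : Eucl n) ∈ {x | H q x ≤ E} := mem_of_mem_nhds hC
    simpa using hmax 0 h0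
  have hle : ∀ π, inner ℝ v π - jacobiU H E q π ≤ a ^ 2 / 4 := by
    intro π
    have h1 := inner_le_gauge_mul hC (fun c hc => hmax c hc) ha0 π
    have h2 : (0 : ℝ) ≤ (gauge {x | H q x ≤ E} π - a / 2) ^ 2 := sq_nonneg _
    simp only [jacobiU]
    nlinarith
  refine le_antisymm (ciSup_le hle) ?_
  refine le_trans ?_ (le_ciSup ⟨a ^ 2 / 4, forall_mem_range.2 hle⟩ ((a / 2) • p))
  have h1 : gauge {x | H q x ≤ E} ((a / 2) • p) ≤ a / 2 := by
    rw [gauge_smul_of_nonneg (by positivity), smul_eq_mul]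
    have := gauge_le_one_of_mem (s := {x | H q x ≤ E}) hp
    nlinarith
  have h0 := gauge_nonneg (s := {x | H q x ≤ E}) ((a / 2) • p)
  simp only [jacobiU, inner_smul_right, ← ha]
  nlinarith

namespace IsClassicalHamiltonian

variable (hH : IsClassicalHamiltonian H) {E : ℝ} {q v p : Eucl n} {μ : ℝ}

include hH

theorem sublevel_mem_nhds (hq : H q 0 < E) : {x | H q x ≤ E} ∈ 𝓝 0 :=
  mem_of_superset ((hH.continuous_right q).continuousAt.eventually_lt continuousAt_const hq)
    fun _ h => (show _ < E from h).le

theorem exists_isMax (hq : H q 0 < E) (v : Eucl n) :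
    ∃ p, H q p ≤ E ∧ ∀ c, H q c ≤ E → inner ℝ v c ≤ inner ℝ v p := by
  obtain ⟨p, hp, hmax⟩ := (hH.isCompact_sublevel q E).exists_isMaxOn ⟨0, hq.le⟩
    (f := fun c => inner ℝ v c) (by fun_prop)
  exact ⟨p, hp, fun c hc => hmax hc⟩

theorem jacobiG_nonneg (hq : H q 0 < E) (v : Eucl n) : 0 ≤ jacobiG H E q v := by
  obtain ⟨p, hp, hmax⟩ := hH.exists_isMax hq v
  rw [jacobiG_eq_of_isMax (hH.sublevel_mem_nhds hq) hp hmax]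
  positivity

theorem sq_inner_le_jacobiG (hq : H q 0 < E) {P : Eucl n} (hP : H q P ≤ E) (v : Eucl n) :
    inner ℝ P v ^ 2 / 4 ≤ jacobiG H E q v := by
  obtain ⟨p, hp, hmax⟩ := hH.exists_isMax hq v
  rw [jacobiG_eq_of_isMax (hH.sublevel_mem_nhds hq) hp hmax]
  have h1 := hmax P hP
  have h2 := hmax (-P) (by rwa [hH.even])
  rw [inner_neg_right] at h2
  rw [real_inner_comm]
  have : |inner ℝ v P| ≤ inner ℝ v p := abs_le.2 ⟨by linarith, h1⟩
  have := sq_le_sq' (abs_le.1 this).1 h1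
  linarith

theorem jacobiG_le (hq : H q 0 < E) {ρ : ℝ} (hρ : ∀ c, H q c ≤ E → ‖c‖ ≤ ρ) (v : Eucl n) :
    jacobiG H E q v ≤ ρ ^ 2 / 4 * ‖v‖ ^ 2 := by
  obtain ⟨p, hp, hmax⟩ := hH.exists_isMax hq v
  rw [jacobiG_eq_of_isMax (hH.sublevel_mem_nhds hq) hp hmax]
  have h1 := real_inner_le_norm v p
  have h2 : 0 ≤ inner ℝ v p := by simpa using hmax 0 hq.le
  have h3 : inner ℝ v p ≤ ‖v‖ * ρ := h1.trans (by gcongr; exact hρ p hp)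
  nlinarith [pow_le_pow_left₀ h2 h3 2]

theorem inner_le_of_isMomentum (hm : IsMomentum H E q v p μ) {c : Eucl n} (hc : H q c ≤ E) :
    inner ℝ v c ≤ inner ℝ v p := by
  have h := hH.strong_convexity q p c
  have h2 : 0 ≤ hH.modulus q / 2 * ‖c - p‖ ^ 2 := by
    have := hH.modulus_pos q
    positivity
  have h3 : inner ℝ (gradP H (q, p)) (c - p) ≤ (0 : ℝ) := by
    have := hm.energy
    linarith
  rw [inner_sub_right] at h3
  rw [hm.velocity, inner_smul_left, inner_smul_left]
  have := hm.pos
  simp only [conj_trivial]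
  nlinarith

theorem jacobiG_of_isMomentum (hq : H q 0 < E) (hm : IsMomentum H E q v p μ) :
    jacobiG H E q v = inner ℝ v p ^ 2 / 4 :=
  jacobiG_eq_of_isMax (hH.sublevel_mem_nhds hq) hm.energy.le
    fun _ hc => hH.inner_le_of_isMomentum hm hc

omit hH in
theorem ne_zero_of_energy (hq : H q 0 < E) (hp : H q p = E) : p ≠ 0 := by
  rintro rfl
  exact hq.ne hp

theorem exists_isMomentum (hq : H q 0 < E) (hv : v ≠ 0) : ∃ p μ, IsMomentum H E q v p μ := by
  obtain ⟨p, hp, hmax⟩ := hH.exists_isMax hq v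
  have hpE : H q p = E := by
    refine le_antisymm hp (not_lt.1 fun hlt => ?_)
    have h1 : Tendsto (fun s : ℝ => H q (p + s • v)) (𝓝[>] 0) (𝓝 (H q p)) := by
      have : Continuous (fun s : ℝ => H q (p + s • v)) :=
        (hH.continuous_right q).comp (by fun_prop)
      simpa using (this.tendsto 0).mono_left nhdsWithin_le_nhds
    obtain ⟨s, hs, hs0⟩ := ((h1.eventually_lt tendsto_const_nhds hlt).and self_mem_nhdsWithin).exists
    have h2 := hmax (p + s • v) hs.le
    rw [inner_add_right, inner_smul_right, real_inner_self_eq_norm_sq] at h2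
    have : 0 < s * ‖v‖ ^ 2 := mul_pos hs0 (pow_pos (norm_pos_iff.2 hv) 2)
    linarith
  have hp0 : p ≠ 0 := ne_zero_of_energy hq hpE
  have hext : IsLocalExtrOn (fun c => inner ℝ v c) {x | H q x = H q p} p :=
    Or.inr (IsMaxOn.localize fun c hc => hmax c (by rw [show H q c = H q p from hc, hpE]))
  have hst : HasStrictFDerivAt (H q) (innerSL ℝ (gradP H (q, p))) p := by
    have h1 : ContDiff ℝ 2 (H q) := hH.contDiff_ham.comp (contDiff_const.prodMk contDiff_id)
    exact h1.contDiffAt.hasStrictFDerivAt' (hH.hasFDerivAt_right q p) (by norm_num)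
  obtain ⟨a, b, hab, hsum⟩ := hext.exists_multipliers_of_hasStrictFDerivAt_1d hst
    (φ' := innerSL ℝ v) ((innerSL ℝ v).hasStrictFDerivAt)
  have hvec : a • gradP H (q, p) + b • v = 0 := by
    refine ext_inner_right ℝ fun w => ?_
    have := congrArg (fun L => L w) hsum
    simpa [inner_add_left, inner_smul_left] using this
  have hpos := hH.inner_gradP_self_pos q hp0
  have hg0 : gradP H (q, p) ≠ 0 := fun h => by simp [h] at hpos
  have hb : b ≠ 0 := by
    rintro rfl
    have ha : a = 0 := by simpa [hg0] using hvec
    exact hab (by simp [ha])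
  have hvel : v = (-a / b) • gradP H (q, p) := by
    have h1 : b • v = -(a • gradP H (q, p)) := eq_neg_of_add_eq_zero_right hvec
    rw [neg_div, neg_smul, div_eq_inv_mul, mul_smul, ← smul_neg, ← h1, smul_smul, inv_mul_cancel₀ hb,
      one_smul]
  refine ⟨p, -a / b, hpE, hvel, ?_⟩
  have h0 : 0 ≤ inner ℝ v p := by simpa using hmax 0 hq.le
  rw [hvel, inner_smul_left] at h0
  simp only [conj_trivial] at h0
  refine lt_of_le_of_ne (nonneg_of_mul_nonneg_left h0 hpos) fun h => hv ?_
  rw [hvel, ← h, zero_smul]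

end IsClassicalHamiltonian

end Hamiltonian

section Legendre

theorem exists_continuousLinearEquiv_of_injective {V : Type*} [NormedAddCommGroup V] [NormedSpace ℝ V]
    [FiniteDimensional ℝ V] (L : V →L[ℝ] V) (hL : ∀ x, L x = 0 → x = 0) :
    ∃ e : V ≃L[ℝ] V, (e : V →L[ℝ] V) = L :=
  ⟨(LinearEquiv.ofInjectiveEndo (L : V →ₗ[ℝ] V)
    (LinearMap.ker_eq_bot.1 (LinearMap.ker_eq_bot'.2 hL))).toContinuousLinearEquiv, by ext; rfl⟩

variable {n : ℕ} {H : Eucl n → Eucl n → ℝ} (hH : IsClassicalHamiltonian H) {E : ℝ}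
  {q v p : Eucl n} {μ : ℝ}

include hH

theorem IsClassicalHamiltonian.exists_localMomentum (hq : H q 0 < E) (hm : IsMomentum H E q v p μ) :
    ∃ (π : Eucl n × Eucl n → Eucl n) (m : Eucl n × Eucl n → ℝ), ContDiffAt ℝ 1 π (q, v) ∧
      ContDiffAt ℝ 1 m (q, v) ∧ π (q, v) = p ∧ m (q, v) = μ ∧
      ∀ᶠ x in 𝓝 (q, v), IsMomentum H E x.1 x.2 (π x) (m x) := by
  have hp0 := ne_zero_of_energy hq hm.energy
  set Λ : Eucl n × Eucl n × ℝ → Eucl n × Eucl n × ℝ := fun z =>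
    (z.1, z.2.2 • gradP H (z.1, z.2.1), ham H (z.1, z.2.1)) with hΛ
  have hι : ContDiff ℝ 2 (fun z : Eucl n × Eucl n × ℝ => (z.1, z.2.1)) := by fun_prop
  have hΛc : ContDiff ℝ 1 Λ := by
    refine contDiff_fst.prodMk (ContDiff.prodMk ?_ ?_)
    · exact (contDiff_snd.comp contDiff_snd).smul (hH.contDiff_gradP.comp (hι.of_le (by norm_num)))
    · exact (hH.contDiff_ham.comp hι).of_le (by norm_num)
  set z₀ : Eucl n × Eucl n × ℝ := (q, p, μ) with hz₀
  let ι : Eucl n × Eucl n × ℝ →L[ℝ] Eucl n × Eucl n :=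
    (ContinuousLinearMap.fst ℝ _ _).prod ((ContinuousLinearMap.fst ℝ _ _).comp
      (ContinuousLinearMap.snd ℝ _ _))
  let τ : Eucl n × Eucl n × ℝ →L[ℝ] ℝ := (ContinuousLinearMap.snd ℝ _ _).comp
      (ContinuousLinearMap.snd ℝ _ _)
  have hΛd : HasFDerivAt Λ ((ContinuousLinearMap.fst ℝ (Eucl n) (Eucl n × ℝ)).prod
      ((μ • ((fderiv ℝ (gradP H) (q, p)).comp ι) + τ.smulRight (gradP H (q, p))).prod
        ((fderiv ℝ (ham H) (q, p)).comp ι))) z₀ := by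
    refine hasFDerivAt_fst.prodMk (HasFDerivAt.prodMk ?_ ?_)
    · exact HasFDerivAt.smul (c := fun z : Eucl n × Eucl n × ℝ => z.2.2) (τ.hasFDerivAt)
        (HasFDerivAt.comp (g := gradP H) (f := ι) z₀ (hH.hasFDerivAt_gradP (q, p)) ι.hasFDerivAt)
    · exact HasFDerivAt.comp (g := ham H) (f := ι) z₀ (hH.hasFDerivAt_ham (q, p)) ι.hasFDerivAt
  have hinj : ∀ x, ((ContinuousLinearMap.fst ℝ (Eucl n) (Eucl n × ℝ)).prod
      ((μ • ((fderiv ℝ (gradP H) (q, p)).comp ι) + τ.smulRight (gradP H (q, p))).prod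
        ((fderiv ℝ (ham H) (q, p)).comp ι))) x = 0 → x = 0 := by
    rintro ⟨a, b, c⟩ hx
    simp only [ContinuousLinearMap.prod_apply, Prod.mk_eq_zero, _root_.add_apply, _root_.smul_apply,
      ContinuousLinearMap.comp_apply, ContinuousLinearMap.coe_fst', ContinuousLinearMap.coe_snd',
      ContinuousLinearMap.smulRight_apply, ι, τ] at hx
    obtain ⟨rfl, h2, h3⟩ := hx
    rw [← inner_gradP] at h3
    have h4 := congrArg (fun w => inner ℝ w b) h2
    simp only [inner_add_left, inner_smul_left, conj_trivial, h3, inner_zero_left, mul_zero,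
      add_zero] at h4
    have h5 := hH.modulus_le q p b
    have h6 : inner ℝ (fderiv ℝ (gradP H) (q, p) (0, b)) b = (0 : ℝ) := by
      rcases mul_eq_zero.1 h4 with h | h
      · exact absurd h hm.pos.ne'
      · exact h
    have h7 : b = 0 := by
      by_contra hb
      have := mul_pos (hH.modulus_pos q) (pow_pos (norm_pos_iff.2 hb) 2)
      linarith
    subst h7
    have h8 : c • gradP H (q, p) = 0 := by
      have : ((0 : Eucl n), (0 : Eucl n)) = 0 := rfl
      rw [this, map_zero, smul_zero, zero_add] at h2
      exact h2
    have h9 : gradP H (q, p) ≠ 0 := fun h => by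
      have := hH.inner_gradP_self_pos q hp0
      simp [h] at this
    simpa [h9] using h8
  obtain ⟨e, he⟩ := exists_continuousLinearEquiv_of_injective _ hinj
  rw [← he] at hΛd
  have hst := (hΛc.contDiffAt (x := z₀)).hasStrictFDerivAt' hΛd one_ne_zero
  have hg := (hΛc.contDiffAt (x := z₀)).to_localInverse hΛd one_ne_zero
  have hgr := hst.eventually_right_inverse
  have hgi := (hΛc.contDiffAt (x := z₀)).localInverse_apply_image hΛd one_ne_zero
  set g := (hΛc.contDiffAt (x := z₀)).localInverse hΛd one_ne_zero with hgdef
  have hΛz : Λ z₀ = (q, v, E) := by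
    simp only [hΛ, hz₀]
    rw [← hm.velocity, ham, hm.energy]
  rw [hΛz] at hg hgr hgi
  have hj : ContDiff ℝ 1 (fun x : Eucl n × Eucl n => (x.1, x.2, E)) := by fun_prop
  have hcont := hg.comp (q, v) (hj.contDiffAt (x := (q, v)))
  have hmc : ContDiffAt ℝ 1 (fun x : Eucl n × Eucl n => (g (x.1, x.2, E)).2.2) (q, v) := hcont.snd.snd
  have hm1 : (g (q, v, E)).2.2 = μ := by rw [hgi]
  refine ⟨fun x => (g (x.1, x.2, E)).2.1, fun x => (g (x.1, x.2, E)).2.2, hcont.snd.fst,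
    hmc, by simp only []; rw [hgi], hm1, ?_⟩
  have hpos : ∀ᶠ x : Eucl n × Eucl n in 𝓝 (q, v), 0 < (g (x.1, x.2, E)).2.2 :=
    hmc.continuousAt.eventually (lt_mem_nhds (by simp only []; rw [hm1]; exact hm.pos))
  filter_upwards [(hj.continuous.tendsto (q, v)).eventually hgr, hpos] with x hx hx0
  have h1 : Λ (g (x.1, x.2, E)) = (x.1, x.2, E) := hx
  simp only [hΛ, Prod.mk.injEq] at h1
  obtain ⟨h1, h2, h3⟩ := h1
  rw [h1] at h2 h3
  exact ⟨h3, h2.symm, hx0⟩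

theorem IsClassicalHamiltonian.jacobiF_sq (hq : H q 0 < E) (v : Eucl n) :
    jacobiF H E q v ^ 2 = jacobiG H E q v := Real.sq_sqrt (hH.jacobiG_nonneg hq v)

theorem IsClassicalHamiltonian.hasFDerivAt_jacobiF_sq (hq : H q 0 < E) (hm : IsMomentum H E q v p μ) :
    HasFDerivAt (fun x : Eucl n × Eucl n => jacobiF H E x.1 x.2 ^ 2)
      ((innerSL ℝ ((inner ℝ v p / 2 : ℝ) • p)).comp (ContinuousLinearMap.snd ℝ _ _) -
        (innerSL ℝ ((μ * (inner ℝ v p / 2) : ℝ) • gradQ H (q, p))).comp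
          (ContinuousLinearMap.fst ℝ _ _)) (q, v) := by
  obtain ⟨π, m, hπ, -, hπ0, -, hev⟩ := hH.exists_localMomentum hq hm
  have hπd : HasFDerivAt π (fderiv ℝ π (q, v)) (q, v) := (hπ.differentiableAt one_ne_zero).hasFDerivAt
  set L := fderiv ℝ π (q, v) with hL
  have hev2 : ∀ᶠ x : Eucl n × Eucl n in 𝓝 (q, v), H x.1 0 < E :=
    ((hH.contDiff_potentialEnergy.continuous.comp continuous_fst).continuousAt).eventually_lt
      continuousAt_const hq
  have hen : ∀ w : Eucl n × Eucl n, inner ℝ (gradQ H (q, p)) w.1 + inner ℝ (gradP H (q, p)) (L w) = (0 : ℝ) := by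
    have h1 : HasFDerivAt (fun x : Eucl n × Eucl n => ham H (x.1, π x))
        ((fderiv ℝ (ham H) (q, p)).comp ((ContinuousLinearMap.fst ℝ _ _).prod L)) (q, v) := by
      refine HasFDerivAt.comp (g := ham H) (f := fun x : Eucl n × Eucl n => (x.1, π x)) (q, v) ?_
        (hasFDerivAt_fst.prodMk hπd)
      simp only []
      rw [hπ0]
      exact hH.hasFDerivAt_ham (q, p)
    have h2 : HasFDerivAt (fun x : Eucl n × Eucl n => ham H (x.1, π x))
        (0 : Eucl n × Eucl n →L[ℝ] ℝ) (q, v) :=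
      (hasFDerivAt_const E (q, v)).congr_of_eventuallyEq (by
        filter_upwards [hev] with x hx using hx.energy)
    intro w
    have h3 := congrArg (fun L => L w) (h1.unique h2)
    simpa [fderiv_ham_apply] using h3
  have h1 : HasFDerivAt (fun x : Eucl n × Eucl n => (inner ℝ x.2 (π x) : ℝ))
      ((innerSL ℝ p).comp (ContinuousLinearMap.snd ℝ _ _) -
        (innerSL ℝ (μ • gradQ H (q, p))).comp (ContinuousLinearMap.fst ℝ _ _)) (q, v) := by
    refine HasFDerivAt.congr_fderiv (hasFDerivAt_snd.inner ℝ hπd) ?_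
    refine ContinuousLinearMap.ext fun w => ?_
    have h2 := hen w
    simp only [ContinuousLinearMap.comp_apply, ContinuousLinearMap.prod_apply,
      fderivInnerCLM_apply, ContinuousLinearMap.coe_snd', ContinuousLinearMap.coe_fst',
      _root_.sub_apply, innerSL_apply_apply, inner_smul_left, conj_trivial]
    rw [hπ0, real_inner_comm p w.2]
    nth_rewrite 1 [hm.velocity]
    rw [inner_smul_left]
    simp only [conj_trivial]
    linear_combination μ * h2
  have h2 : HasFDerivAt (fun x : Eucl n × Eucl n => (inner ℝ x.2 (π x) : ℝ) ^ 2 / 4)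
      ((innerSL ℝ ((inner ℝ v p / 2 : ℝ) • p)).comp (ContinuousLinearMap.snd ℝ _ _) -
        (innerSL ℝ ((μ * (inner ℝ v p / 2) : ℝ) • gradQ H (q, p))).comp
          (ContinuousLinearMap.fst ℝ _ _)) (q, v) := by
    have h3 := (h1.pow 2).mul_const (1 / 4 : ℝ)
    refine HasFDerivAt.congr_fderiv (h3.congr_of_eventuallyEq ?_) ?_
    · filter_upwards with x
      ring
    · refine ContinuousLinearMap.ext fun w => ?_
      simp only [ContinuousLinearMap.comp_apply, ContinuousLinearMap.coe_snd',
        ContinuousLinearMap.coe_fst', _root_.sub_apply, _root_.smul_apply, innerSL_apply_apply,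
        inner_smul_left, conj_trivial, hπ0, smul_eq_mul, nsmul_eq_mul]
      push_cast
      ring
  refine h2.congr_of_eventuallyEq ?_
  filter_upwards [hev, hev2] with x hx hx2
  rw [hH.jacobiF_sq hx2, hH.jacobiG_of_isMomentum hx2 hx]

theorem IsClassicalHamiltonian.fderiv_velocity (hq : H q 0 < E) (hm : IsMomentum H E q v p μ) :
    fderiv ℝ (fun v => jacobiF H E q v ^ 2) v = innerSL ℝ ((inner ℝ v p / 2 : ℝ) • p) := by
  have h := HasFDerivAt.comp (g := fun x : Eucl n × Eucl n => jacobiF H E x.1 x.2 ^ 2)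
    (f := fun v => (q, v)) v (hH.hasFDerivAt_jacobiF_sq hq hm) (hasFDerivAt_prodMk_right q v)
  refine HasFDerivAt.fderiv (HasFDerivAt.congr_fderiv h ?_)
  ext w
  simp

theorem IsClassicalHamiltonian.fderiv_position (hq : H q 0 < E) (hm : IsMomentum H E q v p μ) :
    fderiv ℝ (fun q => jacobiF H E q v ^ 2) q =
      innerSL ℝ (-((μ * (inner ℝ v p / 2) : ℝ) • gradQ H (q, p))) := by
  have h := HasFDerivAt.comp (g := fun x : Eucl n × Eucl n => jacobiF H E x.1 x.2 ^ 2)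
    (f := fun q => (q, v)) q (hH.hasFDerivAt_jacobiF_sq hq hm) (hasFDerivAt_prodMk_left q v)
  refine HasFDerivAt.fderiv (HasFDerivAt.congr_fderiv h ?_)
  ext w
  simp

end Legendre

section Geodesic

variable {n : ℕ} {H : Eucl n → Eucl n → ℝ} (hH : IsClassicalHamiltonian H) {E : ℝ}
  {D : Set (Eucl n)} (hD : ∀ q ∈ D, H q 0 < E) {y ξ p : Eucl n} {μ : ℝ}

include hH hD

theorem IsClassicalHamiltonian.geodesic_acceleration (hm : IsMomentum H E y ξ p μ) {ε : ℝ}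
    {η : ℝ → Eucl n} (hε : 0 < ε) (hη : IsFinslerGeodesic (jacobiF H E) D y ξ ε η) :
    ∃ c : ℝ, HasDerivAt (deriv η)
      (c • ξ + μ • fderiv ℝ (gradP H) (y, p) (ξ, -(μ • gradQ H (y, p)))) 0 := by
  have h0 : (0 : ℝ) ∈ Ioo (-ε) ε := ⟨by linarith, hε⟩
  have hyD : y ∈ D := hη.start ▸ hη.mapsTo 0 h0
  have hy := hD y hyD
  have hp0 := ne_zero_of_energy hy hm.energy
  have hgp := hH.inner_gradP_self_pos y hp0
  have hηd : ∀ s ∈ Ioo (-ε) ε, HasDerivAt η (deriv η s) s := fun s hs =>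
    ((hη.contDiffOn.contDiffAt (isOpen_Ioo.mem_nhds hs)).differentiableAt (by norm_num)).hasDerivAt
  have hηdd : HasDerivAt (deriv η) (deriv (deriv η) 0) 0 := by
    have h1 := (contDiffOn_succ_iff_deriv_of_isOpen (n := 1) isOpen_Ioo).1
      (by simpa [one_add_one_eq_two] using hη.contDiffOn)
    exact ((h1.2.2.contDiffAt (isOpen_Ioo.mem_nhds h0)).differentiableAt one_ne_zero).hasDerivAt
  obtain ⟨π, m, hπ, hmc, hπ0, hm0, hev⟩ := hH.exists_localMomentum hy hm
  have hxd : HasDerivAt (fun s => (η s, deriv η s)) (ξ, deriv (deriv η) 0) 0 := by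
    have := (hηd 0 h0).prodMk hηdd
    rwa [hη.velocity] at this
  have hx0 : (η 0, deriv η 0) = (y, ξ) := by rw [hη.start, hη.velocity]
  have hpd : HasDerivAt (fun s => π (η s, deriv η s))
      (fderiv ℝ π (y, ξ) (ξ, deriv (deriv η) 0)) 0 := by
    have h1 : HasFDerivAt π (fderiv ℝ π (y, ξ)) (η 0, deriv η 0) := by
      rw [hx0]; exact (hπ.differentiableAt one_ne_zero).hasFDerivAt
    exact h1.comp_hasDerivAt (f := fun s => (η s, deriv η s)) 0 hxd
  have hmd : HasDerivAt (fun s => m (η s, deriv η s))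
      (fderiv ℝ m (y, ξ) (ξ, deriv (deriv η) 0)) 0 := by
    have h1 : HasFDerivAt m (fderiv ℝ m (y, ξ)) (η 0, deriv η 0) := by
      rw [hx0]; exact (hmc.differentiableAt one_ne_zero).hasFDerivAt
    exact h1.comp_hasDerivAt (f := fun s => (η s, deriv η s)) 0 hxd
  set p' := fderiv ℝ π (y, ξ) (ξ, deriv (deriv η) 0) with hp'
  set μ' := fderiv ℝ m (y, ξ) (ξ, deriv (deriv η) 0) with hμ'
  have hevs : ∀ᶠ s in 𝓝 (0 : ℝ), s ∈ Ioo (-ε) ε ∧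
      IsMomentum H E (η s) (deriv η s) (π (η s, deriv η s)) (m (η s, deriv η s)) := by
    have h1 : Tendsto (fun s => (η s, deriv η s)) (𝓝 0) (𝓝 (y, ξ)) := by
      rw [← hx0]; exact hxd.continuousAt
    have h2 : ∀ᶠ s in 𝓝 (0 : ℝ), s ∈ Ioo (-ε) ε := Ioo_mem_nhds h0.1 h0.2
    exact h2.and (h1.eventually hev)
  have hpi0 : π (η 0, deriv η 0) = p := by rw [hx0, hπ0]
  have hmi0 : m (η 0, deriv η 0) = μ := by rw [hx0, hm0]
  -- conservation of energy
  have hen : inner ℝ (gradQ H (y, p)) ξ + inner ℝ (gradP H (y, p)) p' = (0 : ℝ) := by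
    have h1 : HasDerivAt (fun s => ham H (η s, π (η s, deriv η s)))
        (fderiv ℝ (ham H) (y, p) (ξ, p')) 0 := by
      have h2 : HasFDerivAt (ham H) (fderiv ℝ (ham H) (y, p)) (η 0, π (η 0, deriv η 0)) := by
        rw [hpi0, hη.start]; exact hH.hasFDerivAt_ham _
      have h3 := (hηd 0 h0).prodMk hpd
      rw [hη.velocity] at h3
      exact h2.comp_hasDerivAt (f := fun s => (η s, π (η s, deriv η s))) 0 h3
    have h2 : HasDerivAt (fun s => ham H (η s, π (η s, deriv η s))) 0 0 :=
      (hasDerivAt_const (0 : ℝ) E).congr_of_eventuallyEq (by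
        filter_upwards [hevs] with s hs using hs.2.energy)
    have h3 := h1.unique h2
    rwa [fderiv_ham_apply] at h3
  have hκd : HasDerivAt (fun s => (inner ℝ (deriv η s) (π (η s, deriv η s)) / 2 : ℝ))
      ((inner ℝ ξ p' + inner ℝ (deriv (deriv η) 0) p) / 2) 0 := by
    have := (hηdd.inner ℝ hpd).div_const 2
    rwa [hpi0, hη.velocity] at this
  set κ' : ℝ := (inner ℝ ξ p' + inner ℝ (deriv (deriv η) 0) p) / 2 with hκ'
  set κ : ℝ := inner ℝ ξ p / 2 with hκ
  have hκpos : 0 < κ := by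
    rw [hκ, hm.velocity, inner_smul_left]
    have := mul_pos hm.pos hgp
    simp only [conj_trivial]
    linarith
  have hEL : κ • p' + κ' • p = -((μ * κ) • gradQ H (y, p)) := by
    have h1 := hη.eulerLagrange 0 h0
    rw [hη.velocity, hη.start, hH.fderiv_position hy hm] at h1
    have h2 : HasDerivAt (fun s => innerSL ℝ ((inner ℝ (deriv η s) (π (η s, deriv η s)) / 2 : ℝ) •
        π (η s, deriv η s))) (innerSL ℝ (κ • p' + κ' • p)) 0 := by
      have h3 := hκd.smul hpd
      rw [hpi0, hη.velocity, ← hκ] at h3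
      exact (innerSL ℝ (E := Eucl n)).hasFDerivAt.comp_hasDerivAt (0 : ℝ) h3
    have h4 := h1.unique (h2.congr_of_eventuallyEq (by
      filter_upwards [hevs] with s hs
      exact hH.fderiv_velocity (hD _ (hη.mapsTo s hs.1)) hs.2))
    refine ext_inner_right ℝ fun w => ?_
    have h5 := congrArg (fun L => L w) h4
    simp only [innerSL_apply_apply] at h5
    exact h5.symm
  have hκ0 : κ' = 0 := by
    have h1 := congrArg (fun w => (inner ℝ (gradP H (y, p)) w : ℝ)) hEL
    simp only [inner_add_right, inner_smul_right, inner_neg_right] at h1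
    have h2 : inner ℝ (gradQ H (y, p)) ξ = μ * (inner ℝ (gradP H (y, p)) (gradQ H (y, p)) : ℝ) := by
      rw [hm.velocity, inner_smul_right, real_inner_comm]
    rw [h2] at hen
    have h3 : κ' * inner ℝ (gradP H (y, p)) p = 0 := by linear_combination h1 - κ * hen
    exact (mul_eq_zero.1 h3).resolve_right hgp.ne'
  have hp'' : p' = -(μ • gradQ H (y, p)) := by
    rw [hκ0, zero_smul, add_zero, mul_comm, mul_smul, ← smul_neg] at hEL
    exact smul_right_injective _ hκpos.ne' hEL
  have hvel : HasDerivAt (fun s => m (η s, deriv η s) • gradP H (η s, π (η s, deriv η s)))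
      (μ • fderiv ℝ (gradP H) (y, p) (ξ, p') + μ' • gradP H (y, p)) 0 := by
    have h2 : HasFDerivAt (gradP H) (fderiv ℝ (gradP H) (y, p)) (η 0, π (η 0, deriv η 0)) := by
      rw [hpi0, hη.start]; exact hH.hasFDerivAt_gradP _
    have h3 := (hηd 0 h0).prodMk hpd
    rw [hη.velocity] at h3
    have h4 := hmd.smul (h2.comp_hasDerivAt (f := fun s => (η s, π (η s, deriv η s))) 0 h3)
    simp only [Function.comp_apply] at h4
    rw [hpi0, hmi0, hη.start] at h4
    exact h4
  refine ⟨μ' / μ, ?_⟩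
  have h5 := hvel.congr_of_eventuallyEq (f₁ := deriv η) (by
    filter_upwards [hevs] with s hs using hs.2.velocity)
  rw [hp''] at h5
  refine h5.congr_deriv ?_
  rw [add_comm]
  congr 1
  nth_rewrite 1 [hm.velocity]
  rw [smul_smul, div_mul_cancel₀ _ hm.pos.ne']

theorem IsClassicalHamiltonian.hasDerivAt_deriv_comp_geodesic (hm : IsMomentum H E y ξ p μ)
    {f : Eucl n → ℝ} (hf : ContDiffAt ℝ 2 f y) (hfξ : fderiv ℝ f y ξ = 0) {ε : ℝ}
    {η : ℝ → Eucl n} (hε : 0 < ε) (hη : IsFinslerGeodesic (jacobiF H E) D y ξ ε η) :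
    (∀ᶠ s in 𝓝 (0 : ℝ), DifferentiableAt ℝ (f ∘ η) s) ∧ HasDerivAt (deriv (f ∘ η))
      (fderiv ℝ (fderiv ℝ f) y ξ ξ +
        μ * fderiv ℝ f y (fderiv ℝ (gradP H) (y, p) (ξ, -(μ • gradQ H (y, p))))) 0 := by
  obtain ⟨c, hc⟩ := hH.geodesic_acceleration hD hm hε hη
  have h0 : (0 : ℝ) ∈ Ioo (-ε) ε := ⟨by linarith, hε⟩
  have hηd : ∀ s ∈ Ioo (-ε) ε, HasDerivAt η (deriv η s) s := fun s hs =>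
    ((hη.contDiffOn.contDiffAt (isOpen_Ioo.mem_nhds hs)).differentiableAt (by norm_num)).hasDerivAt
  have hη0 := hηd 0 h0
  have hfev : ∀ᶠ s in 𝓝 (0 : ℝ), ContDiffAt ℝ 2 f (η s) := by
    refine hη0.continuousAt.eventually ?_
    rw [hη.start]
    exact hf.eventually (by simp)
  have hcomp : ∀ᶠ s in 𝓝 (0 : ℝ), HasDerivAt (f ∘ η) (fderiv ℝ f (η s) (deriv η s)) s := by
    filter_upwards [hfev, isOpen_Ioo.mem_nhds h0] with s hs hs2
    exact (hs.differentiableAt (by norm_num)).hasFDerivAt.comp_hasDerivAt s (hηd s hs2)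
  refine ⟨hcomp.mono fun s hs => hs.differentiableAt, ?_⟩
  have hfd : HasFDerivAt (fderiv ℝ f) (fderiv ℝ (fderiv ℝ f) y) (η 0) := by
    rw [hη.start]
    exact ((hf.fderiv_right (m := 1) (by norm_num [one_add_one_eq_two])).differentiableAt
      one_ne_zero).hasFDerivAt
  have h1 := (hfd.comp_hasDerivAt (0 : ℝ) hη0).clm_apply hc
  have h2 := h1.congr_of_eventuallyEq (f₁ := deriv (f ∘ η)) (by
    filter_upwards [hcomp] with s hs using hs.deriv)
  refine h2.congr_deriv ?_
  rw [Function.comp_apply, hη.start, hη.velocity, map_add, map_smul, map_smul, hfξ]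
  simp

theorem IsClassicalHamiltonian.exists_geodesic (hDo : IsOpen D) (hy : y ∈ D)
    (hm : IsMomentum H E y ξ p μ) :
    ∃ (ε : ℝ) (η : ℝ → Eucl n), 0 < ε ∧ IsFinslerGeodesic (jacobiF H E) D y ξ ε η := by
  have hp0 := ne_zero_of_energy (hD y hy) hm.energy
  set g : Eucl n × Eucl n → ℝ := fun x => inner ℝ (gradP H x) x.2 with hg
  have hgc : ContDiff ℝ 1 g := hH.contDiff_gradP.inner ℝ contDiff_snd
  have hg0 : 0 < g (y, p) := hH.inner_gradP_self_pos y hp0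
  set c : ℝ := μ * g (y, p) with hc
  have hcpos : 0 < c := mul_pos hm.pos hg0
  set U : Set (Eucl n × Eucl n) := {x | 0 < g x} ∩ Prod.fst ⁻¹' D with hU
  have hUo : IsOpen U := (isOpen_lt continuous_const hgc.continuous).inter
    (hDo.preimage continuous_fst)
  set X : Eucl n × Eucl n → Eucl n × Eucl n := fun x => (c / g x) • (gradP H x, -gradQ H x) with hX
  have hXc : ContDiffOn ℝ 1 X U := by
    refine (contDiffOn_const.div hgc.contDiffOn fun x hx => hx.1.ne').smul ?_
    exact (hH.contDiff_gradP.prodMk hH.contDiff_gradQ.neg).contDiffOn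
  have hx₀ : (y, p) ∈ U := ⟨hg0, hy⟩
  obtain ⟨α, hα0, δ, hδ, hα⟩ := (hXc.contDiffAt
    (hUo.mem_nhds hx₀)).exists_forall_mem_closedBall_exists_eq_forall_mem_Ioo_hasDerivAt₀ 0
  simp only [zero_sub, zero_add] at hα
  have hαU : ∀ᶠ s in 𝓝 (0 : ℝ), α s ∈ U := by
    refine (hα 0 ⟨by linarith, hδ⟩).continuousAt.eventually ?_
    rw [hα0]
    exact hUo.mem_nhds hx₀
  obtain ⟨ε, hε, hεs⟩ := Metric.eventually_nhds_iff_ball.1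
    (hαU.and (Ioo_mem_nhds (show -δ < 0 by linarith) hδ))
  rw [Real.ball_eq_Ioo, zero_sub, zero_add] at hεs
  have h0 : (0 : ℝ) ∈ Ioo (-ε) ε := ⟨by linarith, hε⟩
  have hd : ∀ s ∈ Ioo (-ε) ε, HasDerivAt α (X (α s)) s := fun s hs => hα s (hεs s hs).2
  have hqd : ∀ s ∈ Ioo (-ε) ε, HasDerivAt (fun s => (α s).1) ((c / g (α s)) • gradP H (α s)) s :=
    fun s hs => (hasFDerivAt_fst (p := α s)).comp_hasDerivAt (f := α) s (hd s hs)
  have hpd : ∀ s ∈ Ioo (-ε) ε, HasDerivAt (fun s => (α s).2) ((c / g (α s)) • -gradQ H (α s)) s :=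
    fun s hs => (hasFDerivAt_snd (p := α s)).comp_hasDerivAt (f := α) s (hd s hs)
  have hen : ∀ s ∈ Ioo (-ε) ε, ham H (α s) = E := by
    intro s hs
    have h1 : ∀ r ∈ Ioo (-ε) ε, HasDerivAt (fun r => ham H (α r)) 0 r := by
      intro r hr
      have h2 := (hH.hasFDerivAt_ham (α r)).comp_hasDerivAt r (hd r hr)
      refine h2.congr_deriv ?_
      rw [fderiv_ham_apply]
      simp only [hX, Prod.smul_mk, inner_smul_right, inner_neg_right]
      rw [real_inner_comm (gradQ H (α r))]
      ring
    have h3 := isOpen_Ioo.is_const_of_deriv_eq_zero isPreconnected_Ioo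
      (fun r hr => (h1 r hr).differentiableAt.differentiableWithinAt)
      (fun r hr => (h1 r hr).deriv) hs h0
    rw [h3, hα0]
    exact hm.energy
  have hder : ∀ s ∈ Ioo (-ε) ε, deriv (fun s => (α s).1) s = (c / g (α s)) • gradP H (α s) :=
    fun s hs => (hqd s hs).deriv
  have hmom : ∀ s ∈ Ioo (-ε) ε, IsMomentum H E (α s).1 (deriv (fun s => (α s).1) s) (α s).2
      (c / g (α s)) := fun s hs =>
    ⟨hen s hs, hder s hs, div_pos hcpos (hεs s hs).1.1⟩
  have hκ : ∀ s ∈ Ioo (-ε) ε, (inner ℝ (deriv (fun s => (α s).1) s) (α s).2 : ℝ) = c := by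
    intro s hs
    rw [hder s hs, inner_smul_left]
    exact div_mul_cancel₀ _ (hεs s hs).1.1.ne'
  have hαc : ContDiffOn ℝ 1 α (Ioo (-ε) ε) := by
    rw [show (1 : WithTop ℕ∞) = 0 + 1 by simp, contDiffOn_succ_iff_deriv_of_isOpen isOpen_Ioo]
    refine ⟨fun s hs => (hd s hs).differentiableAt.differentiableWithinAt, by simp, ?_⟩
    rw [contDiffOn_zero]
    refine ContinuousOn.congr ?_ fun s hs => (hd s hs).deriv
    exact hXc.continuousOn.comp (fun s hs => (hd s hs).continuousAt.continuousWithinAt)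
      fun s hs => (hεs s hs).1
  refine ⟨ε, fun s => (α s).1, hε, ?_, fun s hs => (hεs s hs).1.2, ?_, ?_, ?_⟩
  · have h1 : ContDiffOn ℝ 2 α (Ioo (-ε) ε) := by
      rw [show (2 : WithTop ℕ∞) = 1 + 1 by norm_num, contDiffOn_succ_iff_deriv_of_isOpen isOpen_Ioo]
      refine ⟨fun s hs => (hd s hs).differentiableAt.differentiableWithinAt, by simp, ?_⟩
      exact (hXc.comp hαc fun s hs => (hεs s hs).1).congr fun s hs => (hd s hs).deriv
    exact contDiff_fst.comp_contDiffOn h1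
  · intro s hs
    have h1 : HasDerivAt (fun r => innerSL ℝ ((c / 2) • (α r).2))
        (innerSL ℝ ((c / 2) • ((c / g (α s)) • -gradQ H (α s)))) s :=
      (innerSL ℝ (E := Eucl n)).hasFDerivAt.comp_hasDerivAt s ((hpd s hs).const_smul (c / 2))
    rw [hH.fderiv_position (hD _ (hεs s hs).1.2) (hmom s hs), hκ s hs]
    have h2 := h1.congr_of_eventuallyEq
      (f₁ := fun r => fderiv ℝ (fun v => jacobiF H E (α r).1 v ^ 2) (deriv (fun s => (α s).1) r)) (by
      filter_upwards [isOpen_Ioo.mem_nhds hs] with r hr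
      rw [hH.fderiv_velocity (hD _ (hεs r hr).1.2) (hmom r hr), hκ r hr])
    refine h2.congr_deriv ?_
    congr 1
    rw [smul_neg, smul_neg, smul_smul, mul_comm]
  · simp [hα0]
  · rw [hder 0 h0, hα0, hc, mul_div_cancel_right₀ _ hg0.ne', ← hm.velocity]

/-- The Finsler Hessian in directions tangent to the level sets. -/
theorem IsClassicalHamiltonian.hasFinslerHessian (hDo : IsOpen D) (hy : y ∈ D)
    (hm : IsMomentum H E y ξ p μ) {f : Eucl n → ℝ} (hf : ContDiffAt ℝ 2 f y)
    (hfξ : fderiv ℝ f y ξ = 0) :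
    HasFinslerHessian (jacobiF H E) D f y ξ (fderiv ℝ (fderiv ℝ f) y ξ ξ +
        μ * fderiv ℝ f y (fderiv ℝ (gradP H) (y, p) (ξ, -(μ • gradQ H (y, p))))) :=
  ⟨hH.exists_geodesic hD hDo hy hm, fun _ _ hε hη =>
    hH.hasDerivAt_deriv_comp_geodesic hD hm hf hfξ hε hη⟩

end Geodesic

section Boundary

theorem HasFDerivAt.eventually_add_smul_lt {V : Type*} [NormedAddCommGroup V] [NormedSpace ℝ V]
    {f : V → ℝ} {L : V →L[ℝ] ℝ} {x w : V} (hf : HasFDerivAt f L x) (hw : L w < 0) :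
    ∀ᶠ s : ℝ in 𝓝[>] 0, f (x + s • w) < f x := by
  have h1 : HasDerivAt (fun s : ℝ => f (x + s • w)) (L w) 0 := by
    have h2 : HasDerivAt (fun s : ℝ => x + s • w) w 0 := by
      simpa using ((hasDerivAt_id (0 : ℝ)).smul_const w).const_add x
    have h3 : HasFDerivAt f L (x + (0 : ℝ) • w) := by simpa using hf
    exact h3.comp_hasDerivAt (0 : ℝ) h2
  have h4 := h1.tendsto_slope_zero_right
  filter_upwards [h4.eventually (gt_mem_nhds hw), self_mem_nhdsWithin] with s hs hs0
  simp only [zero_add, zero_smul, add_zero, smul_eq_mul] at hs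
  have hs0 : 0 < s := hs0
  by_contra h
  have : 0 ≤ s⁻¹ * (f (x + s • w) - f x) := mul_nonneg (by positivity) (by linarith)
  linarith

variable {n : ℕ} {H : Eucl n → Eucl n → ℝ} {E : ℝ} {D : Set (Eucl n)}

theorem HasFDerivAt.mem_closure_sublevel {V : Type*} [NormedAddCommGroup V] [NormedSpace ℝ V]
    {f : V → ℝ} {L : V →L[ℝ] ℝ} {x w : V} (hf : HasFDerivAt f L x) (hw : L w < 0) {W : Set V}
    (hW : W ∈ 𝓝 x) : x ∈ closure {z ∈ W | f z < f x} := by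
  have h1 : Tendsto (fun s : ℝ => x + s • w) (𝓝[>] 0) (𝓝 x) := by
    have : Continuous fun s : ℝ => x + s • w := by fun_prop
    simpa using (this.tendsto 0).mono_left nhdsWithin_le_nhds
  refine mem_closure_of_tendsto h1 ?_
  filter_upwards [h1.eventually hW, hf.eventually_add_smul_lt hw] with s hs hs2 using ⟨hs, hs2⟩

variable (hH : IsClassicalHamiltonian H) (hD : IsPotentialWell H E D)

include hH hD

theorem IsPotentialWell.exists_common_direction {Q : Eucl n} (hQ : Q ∈ frontier D)
    {W : Set (Eucl n)} {f : Eucl n → ℝ} (hWo : IsOpen W) (hQW : Q ∈ W) (hf : ContDiffOn ℝ 2 f W)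
    (hfQ : fderiv ℝ f Q ≠ 0) (hDW : D ∩ W = {x ∈ W | f x < 0}) (hfQ0 : f Q = 0) :
    ∃ w, 0 < fderiv ℝ f Q w ∧ 0 < fderiv ℝ (potentialEnergy H) Q w := by
  have hfd : HasFDerivAt f (fderiv ℝ f Q) Q :=
    ((hf.contDiffAt (hWo.mem_nhds hQW)).differentiableAt (by norm_num)).hasFDerivAt
  have hVd : HasFDerivAt (potentialEnergy H) (fderiv ℝ (potentialEnergy H) Q) Q :=
    (hH.contDiff_potentialEnergy.differentiable (by norm_num) Q).hasFDerivAt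
  have hpos : ∀ L : Eucl n →L[ℝ] ℝ, L ≠ 0 → ∃ w, 0 < L w := by
    intro L hL
    obtain ⟨w, hw⟩ := DFunLike.ne_iff.1 hL
    rcases lt_or_gt_of_ne hw with h | h
    · exact ⟨-w, by simpa using h⟩
    · exact ⟨w, by simpa using h⟩
  obtain ⟨w₀, hw₀⟩ := hpos _ hfQ
  obtain ⟨u, hu⟩ := hpos _ (hD.grad_ne_zero Q hQ)
  have hV0 : 0 ≤ fderiv ℝ (potentialEnergy H) Q w₀ := by
    by_contra hneg
    push Not at hneg
    have h1 := hfd.eventually_add_smul_lt (w := -w₀) (by simpa using hw₀)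
    have h2 := hVd.neg.eventually_add_smul_lt (w := -w₀) (by simpa using hneg)
    have h3 : ∀ᶠ s : ℝ in 𝓝[>] 0, Q + s • (-w₀) ∈ W := by
      have : Continuous fun s : ℝ => Q + s • (-w₀) := by fun_prop
      have h4 := (this.tendsto 0).mono_left (nhdsWithin_le_nhds (s := Ioi 0))
      simp only [zero_smul, add_zero] at h4
      exact h4.eventually (hWo.mem_nhds hQW)
    obtain ⟨s, ⟨hs1, hs2⟩, hs3⟩ := ((h1.and h2).and h3).exists
    rw [hfQ0] at hs1
    have h5 : Q + s • (-w₀) ∈ D ∩ W := by rw [hDW]; exact ⟨hs3, hs1⟩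
    have h6 := hD.lt_on _ h5.1
    have h7 := hD.eq_on Q hQ
    simp only [Pi.neg_apply] at hs2
    linarith
  refine ⟨w₀ + (fderiv ℝ f Q w₀ / (2 * (|fderiv ℝ f Q u| + 1))) • u, ?_, ?_⟩
  · rw [map_add, map_smul, smul_eq_mul]
    have h1 : 0 < |fderiv ℝ f Q u| + 1 := by positivity
    have h2 : fderiv ℝ f Q w₀ / (2 * (|fderiv ℝ f Q u| + 1)) * fderiv ℝ f Q u ≥
        -(fderiv ℝ f Q w₀ / 2) := by
      have h3 : -(|fderiv ℝ f Q u| + 1) ≤ fderiv ℝ f Q u := by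
        linarith [neg_abs_le (fderiv ℝ f Q u)]
      have h4 : 0 ≤ fderiv ℝ f Q w₀ / (2 * (|fderiv ℝ f Q u| + 1)) := by positivity
      have h5 := mul_le_mul_of_nonneg_left h3 h4
      have h6 : fderiv ℝ f Q w₀ / (2 * (|fderiv ℝ f Q u| + 1)) * (|fderiv ℝ f Q u| + 1) =
        fderiv ℝ f Q w₀ / 2 := by field_simp
      linarith
    linarith
  · rw [map_add, map_smul, smul_eq_mul]
    have : 0 < fderiv ℝ f Q w₀ / (2 * (|fderiv ℝ f Q u| + 1)) * fderiv ℝ (potentialEnergy H) Q u := by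
      positivity
    linarith

theorem IsPotentialWell.exists_local_eq_sublevel {Q : Eucl n} (hQ : Q ∈ frontier D) :
    ∀ᶠ x in 𝓝 Q, (potentialEnergy H x < E ↔ x ∈ D) := by
  obtain ⟨W, f, hWo, hQW, hf, hfQ, hDW⟩ := hD.boundary Q hQ
  have hmemW : ∀ x ∈ W, (x ∈ D ↔ f x < 0) := fun x hx =>
    ⟨fun h => (show x ∈ {x ∈ W | f x < 0} from hDW ▸ ⟨h, hx⟩).2,
      fun h => (show x ∈ D ∩ W from hDW ▸ ⟨hx, h⟩).1⟩
  have hfr : frontier D = closure D \ D := hD.isOpen.frontier_eq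
  have hfc : ∀ x ∈ W, ContDiffAt ℝ 2 f x := fun x hx => hf.contDiffAt (hWo.mem_nhds hx)
  have hfQ0 : f Q = 0 := by
    rw [hfr] at hQ
    refine le_antisymm (not_lt.1 fun h => ?_) (not_lt.1 fun h => hQ.2 ((hmemW Q hQW).2 h))
    have h1 : ∀ᶠ x in 𝓝 Q, 0 < f x ∧ x ∈ W :=
      ((hfc Q hQW).continuousAt.eventually (lt_mem_nhds h)).and (hWo.mem_nhds hQW)
    obtain ⟨x, hx, hxD⟩ := mem_closure_iff_nhds.1 hQ.1 _ h1
    have := (hmemW x hx.2).1 hxD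
    linarith [hx.1]
  obtain ⟨w, hwf, hwV⟩ := hD.exists_common_direction hH hQ hWo hQW hf hfQ hDW hfQ0
  have hVc := hH.contDiff_potentialEnergy
  have hVd : ∀ x, HasFDerivAt (potentialEnergy H) (fderiv ℝ (potentialEnergy H) x) x := fun x =>
    (hVc.differentiable (by norm_num) x).hasFDerivAt
  have hev : ∀ᶠ x in 𝓝 Q, x ∈ W ∧ 0 < fderiv ℝ f x w ∧ 0 < fderiv ℝ (potentialEnergy H) x w := by
    refine (show ∀ᶠ x in 𝓝 Q, x ∈ W from hWo.mem_nhds hQW).and (Eventually.and ?_ ?_)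
    · have h1 : ContinuousAt (fun x => fderiv ℝ f x w) Q :=
        (((hfc Q hQW).fderiv_right (m := 1) (by norm_num [one_add_one_eq_two])).continuousAt).clm_apply
          continuousAt_const
      exact h1.eventually (lt_mem_nhds hwf)
    · have h1 : Continuous (fun x => fderiv ℝ (potentialEnergy H) x w) :=
        (hVc.continuous_fderiv (by norm_num)).clm_apply continuous_const
      exact h1.continuousAt.eventually (lt_mem_nhds hwV)
  obtain ⟨r, hr, hball⟩ := Metric.eventually_nhds_iff_ball.1 hev
  have hline : Continuous fun s : ℝ => Q + s • (-w) := by fun_prop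
  have hs0 : ∃ s : ℝ, 0 < s ∧ Q + s • (-w) ∈ Metric.ball Q r ∧ f (Q + s • (-w)) < 0 := by
    have hfd : HasFDerivAt f (fderiv ℝ f Q) Q := ((hfc Q hQW).differentiableAt (by norm_num)).hasFDerivAt
    have h1 := hfd.eventually_add_smul_lt (w := -w) (by simpa using hwf)
    have h4 := (hline.tendsto 0).mono_left (nhdsWithin_le_nhds (s := Ioi 0))
    simp only [zero_smul, add_zero] at h4
    obtain ⟨s, ⟨hs1, hs2⟩, hs3⟩ := ((h1.and (h4.eventually (Metric.ball_mem_nhds Q hr))).and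
      self_mem_nhdsWithin).exists
    exact ⟨s, hs3, hs2, by rwa [hfQ0] at hs1⟩
  obtain ⟨s₀, hs₀, hs₀b, hs₀f⟩ := hs0
  have hshift : Tendsto (fun x : Eucl n => x + s₀ • (-w)) (𝓝 Q) (𝓝 (Q + s₀ • (-w))) := by
    have : Continuous fun x : Eucl n => x + s₀ • (-w) := by fun_prop
    exact this.tendsto Q
  filter_upwards [Metric.ball_mem_nhds Q hr,
    hshift.eventually (Metric.isOpen_ball.mem_nhds hs₀b),
    hshift.eventually ((hfc _ (hball _ hs₀b).1).continuousAt.eventually (gt_mem_nhds hs₀f))]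
    with x hx hx2 hx3
  refine ⟨fun hV => (hmemW x (hball x hx).1).2 ?_, fun h => hD.lt_on x h⟩
  by_contra hfx
  push Not at hfx
  have hseg : ∀ s ∈ Icc (0 : ℝ) s₀, x + s • (-w) ∈ Metric.ball Q r := by
    intro s hs
    have h1 := (convex_ball Q r).add_smul_sub_mem hx hx2 (t := s / s₀)
      ⟨div_nonneg hs.1 hs₀.le, div_le_one_of_le₀ hs.2 hs₀.le⟩
    rwa [add_sub_cancel_left, smul_smul, div_mul_cancel₀ _ hs₀.ne'] at h1
  have hlx : Continuous fun s : ℝ => x + s • (-w) := by fun_prop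
  have hcont : ContinuousOn (fun s : ℝ => f (x + s • (-w))) (Icc 0 s₀) := fun s hs =>
    ((hfc _ (hball _ (hseg s hs)).1).continuousAt.comp (f := fun s : ℝ => x + s • (-w))
      hlx.continuousAt).continuousWithinAt
  obtain ⟨s, hs, hsf⟩ := intermediate_value_Icc' hs₀.le hcont
    (show (0 : ℝ) ∈ Icc (f (x + s₀ • (-w))) (f (x + (0 : ℝ) • (-w))) from
      ⟨hx3.le, by simpa using hfx⟩)
  have hsf : f (x + s • (-w)) = 0 := hsf
  have hx'b := hseg s hs
  have hx'fr : x + s • (-w) ∈ frontier D := by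
    rw [hfr]
    refine ⟨?_, fun h => ?_⟩
    · have hfd : HasFDerivAt f (fderiv ℝ f (x + s • (-w))) (x + s • (-w)) :=
        ((hfc _ (hball _ hx'b).1).differentiableAt (by norm_num)).hasFDerivAt
      have h1 := hfd.mem_closure_sublevel (w := -w) (by simpa using (hball _ hx'b).2.1)
        (hWo.mem_nhds (hball _ hx'b).1)
      refine closure_mono ?_ h1
      rintro z ⟨hz, hzf⟩
      rw [hsf] at hzf
      exact (hmemW z hz).2 hzf
    · have := (hmemW _ (hball _ hx'b).1).1 h
      linarith
  have hanti : AntitoneOn (fun s : ℝ => potentialEnergy H (x + s • (-w))) (Icc 0 s₀) := by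
    have hd : ∀ s : ℝ, HasDerivAt (fun s : ℝ => potentialEnergy H (x + s • (-w)))
        (fderiv ℝ (potentialEnergy H) (x + s • (-w)) (-w)) s := by
      intro s
      have h2 : HasDerivAt (fun s : ℝ => x + s • (-w)) (-w) s := by
        simpa using ((hasDerivAt_id s).smul_const (-w)).const_add x
      exact (hVd _).comp_hasDerivAt s h2
    refine antitoneOn_of_deriv_nonpos (convex_Icc 0 s₀)
      (fun s _ => (hd s).continuousAt.continuousWithinAt)
      (fun s _ => (hd s).differentiableAt.differentiableWithinAt) fun s hs => ?_
    rw [(hd s).deriv, map_neg]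
    linarith [(hball _ (hseg s (interior_subset hs))).2.2]
  have h1 := hanti (left_mem_Icc.2 hs₀.le) hs hs.1
  simp only [zero_smul, add_zero] at h1
  rw [hD.eq_on _ hx'fr] at h1
  linarith

omit hD in
theorem IsClassicalHamiltonian.fderiv_potentialEnergy (q : Eucl n) :
    fderiv ℝ (potentialEnergy H) q = innerSL ℝ (gradQ H (q, 0)) :=
  (hH.hasFDerivAt_potentialEnergy q).fderiv

theorem IsPotentialWell.gradQ_ne_zero {Q : Eucl n} (hQ : Q ∈ frontier D) : gradQ H (Q, 0) ≠ 0 := by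
  have h := hD.grad_ne_zero Q hQ
  rw [hH.fderiv_potentialEnergy] at h
  exact fun h0 => h (by rw [h0, map_zero])

/-- Near `∂D`, the well is the sublevel set of the potential energy and `∂D` is its level set. -/
theorem IsPotentialWell.exists_nhds_boundary : ∃ W : Set (Eucl n), IsOpen W ∧ frontier D ⊆ W ∧
    ∀ x ∈ W, (potentialEnergy H x < E ↔ x ∈ D) ∧ (potentialEnergy H x = E → x ∈ frontier D) := by
  have hgc : Continuous fun x => gradQ H (x, 0) :=
    hH.contDiff_gradQ.continuous.comp (by fun_prop)
  refine ⟨interior {x | potentialEnergy H x < E ↔ x ∈ D} ∩ {x | gradQ H (x, 0) ≠ 0},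
    isOpen_interior.inter (isOpen_ne_fun hgc continuous_const), fun Q hQ => ⟨?_, ?_⟩, ?_⟩
  · exact mem_interior_iff_mem_nhds.2 (hD.exists_local_eq_sublevel hH hQ)
  · exact hD.gradQ_ne_zero hH hQ
  · rintro x ⟨hx, hx2⟩
    have hint : ∀ z ∈ interior {x | potentialEnergy H x < E ↔ x ∈ D},
        (potentialEnergy H z < E ↔ z ∈ D) := fun z hz =>
      interior_subset (s := {x | potentialEnergy H x < E ↔ x ∈ D}) hz
    refine ⟨hint x hx, fun hxE => ?_⟩
    have hxD : x ∉ D := fun h => ((hint x hx).2 h).ne hxE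
    rw [hD.isOpen.frontier_eq]
    refine ⟨?_, hxD⟩
    have h1 := (hH.hasFDerivAt_potentialEnergy x).mem_closure_sublevel (w := -gradQ H (x, 0))
      (by
        have h0 : 0 < ‖gradQ H (x, 0)‖ := norm_pos_iff.2 hx2
        simp only [innerSL_apply_apply, inner_neg_right, real_inner_self_eq_norm_sq]
        nlinarith) (isOpen_interior.mem_nhds hx)
    refine closure_mono ?_ h1
    rintro z ⟨hz, hzf⟩
    rw [hxE] at hzf
    exact (hint z hz).1 hzf

end Boundary

section Characteristics

/-- The flow `t ↦ (q, p)(t, Q)` of Hamilton's equations starting at rest from `Q`, together with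
the action `z`. -/
structure IsBrakeFlow {n : ℕ} (H : Eucl n → Eucl n → ℝ) (r T : ℝ) (q p : ℝ × Eucl n → Eucl n)
    (z : ℝ × Eucl n → ℝ) : Prop where
  contDiffOn_q : ContDiffOn ℝ 1 q (Ioo (-T) T ×ˢ Metric.ball 0 r)
  contDiffOn_p : ContDiffOn ℝ 1 p (Ioo (-T) T ×ˢ Metric.ball 0 r)
  contDiffOn_z : ContDiffOn ℝ 1 z (Ioo (-T) T ×ˢ Metric.ball 0 r)
  q_zero : ∀ Q ∈ Metric.ball 0 r, q (0, Q) = Q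
  p_zero : ∀ Q ∈ Metric.ball 0 r, p (0, Q) = 0
  z_zero : ∀ Q ∈ Metric.ball 0 r, z (0, Q) = 0
  deriv_q : ∀ t ∈ Ioo (-T) T, ∀ Q ∈ Metric.ball 0 r,
    HasDerivAt (fun s => q (s, Q)) (gradP H (q (t, Q), p (t, Q))) t
  deriv_p : ∀ t ∈ Ioo (-T) T, ∀ Q ∈ Metric.ball 0 r,
    HasDerivAt (fun s => p (s, Q)) (-gradQ H (q (t, Q), p (t, Q))) t
  deriv_z : ∀ t ∈ Ioo (-T) T, ∀ Q ∈ Metric.ball 0 r,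
    HasDerivAt (fun s => z (s, Q)) (inner ℝ (gradP H (q (t, Q), p (t, Q))) (p (t, Q))) t
  energy : ∀ t ∈ Ioo (-T) T, ∀ Q ∈ Metric.ball 0 r, H (q (t, Q)) (p (t, Q)) = H Q 0
  action : ∀ t ∈ Ioo (-T) T, ∀ Q ∈ Metric.ball 0 r, ∀ w : ℝ × Eucl n, fderiv ℝ z (t, Q) w =
    inner ℝ (p (t, Q)) (fderiv ℝ q (t, Q) w) + t * inner ℝ (gradQ H (Q, 0)) w.2

variable {n : ℕ} {H : Eucl n → Eucl n → ℝ}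

/-- The Hamiltonian vector field, extended by the rate of change of the action. -/
def actionField (H : Eucl n → Eucl n → ℝ) (x : Eucl n × Eucl n × ℝ) : Eucl n × Eucl n × ℝ :=
  (gradP H (x.1, x.2.1), -gradQ H (x.1, x.2.1), inner ℝ (gradP H (x.1, x.2.1)) x.2.1)

/-- The projection to phase space. -/
def phaseCLM (n : ℕ) : Eucl n × Eucl n × ℝ →L[ℝ] Eucl n × Eucl n :=
  (ContinuousLinearMap.fst ℝ _ _).prod
    ((ContinuousLinearMap.fst ℝ _ _).comp (ContinuousLinearMap.snd ℝ _ _))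

@[simp] theorem phaseCLM_apply (x : Eucl n × Eucl n × ℝ) : phaseCLM n x = (x.1, x.2.1) := rfl

/-- The inclusion of initial positions. -/
def restCLM (n : ℕ) : Eucl n →L[ℝ] Eucl n × Eucl n × ℝ :=
  ContinuousLinearMap.inl ℝ (Eucl n) (Eucl n × ℝ)

@[simp] theorem restCLM_apply (x : Eucl n) : restCLM n x = (x, 0, 0) := rfl

/-- The restriction of a local flow to a linear family of initial points. -/
theorem IsLocalFlow.exists_comp_linear {E F : Type*} [NormedAddCommGroup E] [NormedSpace ℝ E]
    [NormedAddCommGroup F] [NormedSpace ℝ F] {X : E → E} {B : Set E} {T : ℝ} {Φ : ℝ × E → E}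
    (hΦ : IsLocalFlow X B T Φ) (hB : IsOpen B) {C : Set F} (L : F →L[ℝ] E) (hC : ∀ x ∈ C, L x ∈ B) :
    ∃ Ψ : ℝ × F → E, ContDiffOn ℝ 1 Ψ (Ioo (-T) T ×ˢ C) ∧ (∀ x ∈ C, Ψ (0, x) = L x) ∧
      (∀ t ∈ Ioo (-T) T, ∀ x ∈ C, DifferentiableAt ℝ Ψ (t, x)) ∧
      (∀ t ∈ Ioo (-T) T, ∀ x ∈ C, HasDerivAt (fun s => Ψ (s, x)) (X (Ψ (t, x))) t) ∧
      ∀ t ∈ Ioo (-T) T, ∀ x ∈ C, ∀ v, HasDerivAt (fun s => fderiv ℝ Ψ (s, x) (0, v))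
        (fderiv ℝ X (Ψ (t, x)) (fderiv ℝ Ψ (t, x) (0, v))) t := by
  have hopen : IsOpen (Ioo (-T) T ×ˢ B) := isOpen_Ioo.prod hB
  let ι : ℝ × F →L[ℝ] ℝ × E := (ContinuousLinearMap.id ℝ ℝ).prodMap L
  have hΨd : ∀ t ∈ Ioo (-T) T, ∀ x ∈ C,
      HasFDerivAt (fun w => Φ (ι w)) ((fderiv ℝ Φ (t, L x)).comp ι) (t, x) := fun t ht x hx =>
    HasFDerivAt.comp (g := Φ) (f := ι) (t, x)
      ((hΦ.contDiffOn.contDiffAt (hopen.mem_nhds ⟨ht, hC x hx⟩)).differentiableAt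
        one_ne_zero).hasFDerivAt ι.hasFDerivAt
  refine ⟨fun w => Φ (ι w), ?_, fun x hx => hΦ.zero _ (hC x hx),
    fun t ht x hx => (hΨd t ht x hx).differentiableAt, fun t ht x hx => hΦ.deriv t ht _ (hC x hx), ?_⟩
  · exact hΦ.contDiffOn.comp ι.contDiff.contDiffOn fun w hw => ⟨hw.1, hC _ hw.2⟩
  · intro t ht x hx v
    have h1 : ∀ s ∈ Ioo (-T) T, fderiv ℝ (fun w => Φ (ι w)) (s, x) (0, v) =
        fderiv ℝ Φ (s, L x) (0, L v) := fun s hs => by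
      rw [(hΨd s hs x hx).fderiv]
      rfl
    rw [h1 t ht]
    refine (hΦ.variation t ht _ (hC x hx) (L v)).congr_of_eventuallyEq ?_
    filter_upwards [Ioo_mem_nhds ht.1 ht.2] with r hr using h1 r hr

variable (hH : IsClassicalHamiltonian H)

include hH

theorem IsClassicalHamiltonian.contDiff_actionField : ContDiff ℝ 1 (actionField H) := by
  have h1 := hH.contDiff_gradP.comp (phaseCLM n).contDiff
  have h2 := hH.contDiff_gradQ.comp (phaseCLM n).contDiff
  exact h1.prodMk (h2.neg.prodMk (h1.inner ℝ (contDiff_fst.comp contDiff_snd)))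

theorem IsClassicalHamiltonian.fderiv_actionField (x w : Eucl n × Eucl n × ℝ) :
    fderiv ℝ (actionField H) x w = (fderiv ℝ (gradP H) (x.1, x.2.1) (w.1, w.2.1),
      -fderiv ℝ (gradQ H) (x.1, x.2.1) (w.1, w.2.1),
      inner ℝ (gradP H (x.1, x.2.1)) w.2.1 +
        inner ℝ (fderiv ℝ (gradP H) (x.1, x.2.1) (w.1, w.2.1)) x.2.1) := by
  have h1 : HasFDerivAt (fun x : Eucl n × Eucl n × ℝ => gradP H (x.1, x.2.1))
      ((fderiv ℝ (gradP H) (x.1, x.2.1)).comp (phaseCLM n)) x :=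
    HasFDerivAt.comp (g := gradP H) (f := phaseCLM n) x (hH.hasFDerivAt_gradP (x.1, x.2.1)) (phaseCLM n).hasFDerivAt
  have h2 : HasFDerivAt (fun x : Eucl n × Eucl n × ℝ => gradQ H (x.1, x.2.1))
      ((fderiv ℝ (gradQ H) (x.1, x.2.1)).comp (phaseCLM n)) x :=
    HasFDerivAt.comp (g := gradQ H) (f := phaseCLM n) x
      (hH.contDiff_gradQ.differentiable one_ne_zero _).hasFDerivAt (phaseCLM n).hasFDerivAt
  have h3 : HasFDerivAt (fun x : Eucl n × Eucl n × ℝ => x.2.1)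
      ((ContinuousLinearMap.fst ℝ _ _).comp (ContinuousLinearMap.snd ℝ _ _)) x :=
    ((ContinuousLinearMap.fst ℝ (Eucl n) ℝ).comp
      (ContinuousLinearMap.snd ℝ (Eucl n) (Eucl n × ℝ))).hasFDerivAt
  have h4 := h1.prodMk (h2.neg.prodMk (h1.inner ℝ h3))
  rw [HasFDerivAt.fderiv (f := actionField H) h4]
  rfl

theorem IsClassicalHamiltonian.exists_brakeFlow {r : ℝ} (hr : 0 < r) :
    ∃ T : ℝ, 0 < T ∧ ∃ q p z, IsBrakeFlow H r T q p z := by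
  obtain ⟨T, hT, Φ, hΦ⟩ := exists_isLocalFlow hH.contDiff_actionField r hr
  have hB : ∀ Q ∈ Metric.ball (0 : Eucl n) r, restCLM n Q ∈ Metric.ball (0 : Eucl n × Eucl n × ℝ) r := by
    intro Q hQ
    rw [mem_ball_zero_iff] at hQ ⊢
    simpa [Prod.norm_def] using hQ
  obtain ⟨Ψ, hΨc, hΨ0, hΨd, hΨt, hΨv⟩ := hΦ.exists_comp_linear Metric.isOpen_ball (restCLM n) hB
  simp only [restCLM_apply] at hΨ0
  have h0T : (0 : ℝ) ∈ Ioo (-T) T := ⟨by linarith, hT⟩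
  have hqt : ∀ t ∈ Ioo (-T) T, ∀ Q ∈ Metric.ball (0 : Eucl n) r,
      HasDerivAt (fun s => (Ψ (s, Q)).1) (gradP H ((Ψ (t, Q)).1, (Ψ (t, Q)).2.1)) t :=
    fun t ht Q hQ => (ContinuousLinearMap.fst ℝ (Eucl n) (Eucl n × ℝ)).hasFDerivAt.comp_hasDerivAt t
      (hΨt t ht Q hQ)
  have hpt : ∀ t ∈ Ioo (-T) T, ∀ Q ∈ Metric.ball (0 : Eucl n) r,
      HasDerivAt (fun s => (Ψ (s, Q)).2.1) (-gradQ H ((Ψ (t, Q)).1, (Ψ (t, Q)).2.1)) t :=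
    fun t ht Q hQ => ((ContinuousLinearMap.fst ℝ (Eucl n) ℝ).comp
      (ContinuousLinearMap.snd ℝ (Eucl n) (Eucl n × ℝ))).hasFDerivAt.comp_hasDerivAt t
      (hΨt t ht Q hQ)
  have hzt : ∀ t ∈ Ioo (-T) T, ∀ Q ∈ Metric.ball (0 : Eucl n) r,
      HasDerivAt (fun s => (Ψ (s, Q)).2.2)
        (inner ℝ (gradP H ((Ψ (t, Q)).1, (Ψ (t, Q)).2.1)) (Ψ (t, Q)).2.1) t :=
    fun t ht Q hQ => ((ContinuousLinearMap.snd ℝ (Eucl n) ℝ).comp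
      (ContinuousLinearMap.snd ℝ (Eucl n) (Eucl n × ℝ))).hasFDerivAt.comp_hasDerivAt t
      (hΨt t ht Q hQ)
  have hen : ∀ t ∈ Ioo (-T) T, ∀ Q ∈ Metric.ball (0 : Eucl n) r,
      ham H ((Ψ (t, Q)).1, (Ψ (t, Q)).2.1) = H Q 0 := by
    intro t ht Q hQ
    have h1 : ∀ s ∈ Ioo (-T) T,
        HasDerivAt (fun s => ham H ((Ψ (s, Q)).1, (Ψ (s, Q)).2.1)) 0 s := by
      intro s hs
      have h2 := (hH.hasFDerivAt_ham ((Ψ (s, Q)).1, (Ψ (s, Q)).2.1)).comp_hasDerivAt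
        (f := fun s => ((Ψ (s, Q)).1, (Ψ (s, Q)).2.1)) s ((hqt s hs Q hQ).prodMk (hpt s hs Q hQ))
      refine h2.congr_deriv ?_
      rw [fderiv_ham_apply, inner_neg_right, real_inner_comm (gradQ H _)]
      ring
    have h3 := isOpen_Ioo.is_const_of_deriv_eq_zero isPreconnected_Ioo
      (fun s hs => (h1 s hs).differentiableAt.differentiableWithinAt)
      (fun s hs => (h1 s hs).deriv) ht h0T
    rw [h3, hΨ0 Q hQ]
    rfl
  have hΨd' : ∀ t ∈ Ioo (-T) T, ∀ Q ∈ Metric.ball (0 : Eucl n) r,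
      HasFDerivAt Ψ (fderiv ℝ Ψ (t, Q)) (t, Q) :=
    fun t ht Q hQ => (hΨd t ht Q hQ).hasFDerivAt
  refine ⟨T, hT, fun w => (Ψ w).1, fun w => (Ψ w).2.1, fun w => (Ψ w).2.2, hΨc.fst, hΨc.snd.fst,
    hΨc.snd.snd, fun Q hQ => by simp only [hΨ0 Q hQ], fun Q hQ => by simp only [hΨ0 Q hQ],
    fun Q hQ => by simp only [hΨ0 Q hQ], hqt, hpt, hzt, hen, ?_⟩
  intro t ht Q hQ
  have hfq : fderiv ℝ (fun w => (Ψ w).1) (t, Q) =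
      (ContinuousLinearMap.fst ℝ _ _).comp (fderiv ℝ Ψ (t, Q)) :=
    (HasFDerivAt.fst (hΨd' t ht Q hQ)).fderiv
  have hfz : fderiv ℝ (fun w => (Ψ w).2.2) (t, Q) =
      (ContinuousLinearMap.snd ℝ _ _).comp ((ContinuousLinearMap.snd ℝ _ _).comp (fderiv ℝ Ψ (t, Q))) :=
    (HasFDerivAt.snd (HasFDerivAt.snd (hΨd' t ht Q hQ))).fderiv
  rintro ⟨a, b⟩
  rw [hfq, hfz]
  simp only [ContinuousLinearMap.comp_apply, ContinuousLinearMap.coe_fst',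
    ContinuousLinearMap.coe_snd']
  have hsplit : fderiv ℝ Ψ (t, Q) (a, b) =
      a • actionField H (Ψ (t, Q)) + fderiv ℝ Ψ (t, Q) (0, b) := by
    have h1 : HasDerivAt (fun s => Ψ (s, Q)) (fderiv ℝ Ψ (t, Q) (1, 0)) t := by
      have h2 : HasDerivAt (fun s : ℝ => (s, Q)) ((1 : ℝ), (0 : Eucl n)) t :=
        (hasDerivAt_id t).prodMk (hasDerivAt_const t Q)
      exact (hΨd' t ht Q hQ).comp_hasDerivAt (f := fun s : ℝ => (s, Q)) t h2
    rw [(hΨt t ht Q hQ).unique h1, ← map_smul, ← map_add]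
    simp
  have hvar : (fderiv ℝ Ψ (t, Q) (0, b)).2.2 =
      inner ℝ (Ψ (t, Q)).2.1 (fderiv ℝ Ψ (t, Q) (0, b)).1 + t * inner ℝ (gradQ H (Q, 0)) b := by
    set w : ℝ → Eucl n × Eucl n × ℝ := fun s => fderiv ℝ Ψ (s, Q) (0, b) with hw
    have hwd : ∀ s ∈ Ioo (-T) T, HasDerivAt w (fderiv ℝ (actionField H) (Ψ (s, Q)) (w s)) s := fun s hs => hΨv s hs Q hQ b
    have henw : ∀ s ∈ Ioo (-T) T, inner ℝ (gradQ H ((Ψ (s, Q)).1, (Ψ (s, Q)).2.1)) (w s).1 +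
        inner ℝ (gradP H ((Ψ (s, Q)).1, (Ψ (s, Q)).2.1)) (w s).2.1 =
          (inner ℝ (gradQ H (Q, 0)) b : ℝ) := by
      intro s hs
      have h1 : HasFDerivAt (fun R => Ψ (s, R)) ((fderiv ℝ Ψ (s, Q)).comp
          (ContinuousLinearMap.inr ℝ ℝ (Eucl n))) Q :=
        HasFDerivAt.comp (g := Ψ) (f := fun R => (s, R)) Q (hΨd' s hs Q hQ)
          (hasFDerivAt_prodMk_right s Q)
      have h2 : HasFDerivAt (fun R => ham H ((Ψ (s, R)).1, (Ψ (s, R)).2.1))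
          ((fderiv ℝ (ham H) ((Ψ (s, Q)).1, (Ψ (s, Q)).2.1)).comp ((phaseCLM n).comp
            ((fderiv ℝ Ψ (s, Q)).comp (ContinuousLinearMap.inr ℝ ℝ (Eucl n))))) Q :=
        HasFDerivAt.comp (g := ham H) (f := fun R => phaseCLM n (Ψ (s, R))) Q
          (hH.hasFDerivAt_ham _) ((phaseCLM n).hasFDerivAt.comp Q h1)
      have h3 := (hH.hasFDerivAt_potentialEnergy Q).congr_of_eventuallyEq
        (f₁ := fun R => ham H ((Ψ (s, R)).1, (Ψ (s, R)).2.1)) (by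
          filter_upwards [Metric.isOpen_ball.mem_nhds hQ] with R hR using hen s hs R hR)
      have h4 := congrArg (fun L => L b) (h2.unique h3)
      simpa [fderiv_ham_apply] using h4
    have hconst : ∀ s ∈ Ioo (-T) T, HasDerivAt (fun s => (w s).2.2 -
        inner ℝ (Ψ (s, Q)).2.1 (w s).1 - s * inner ℝ (gradQ H (Q, 0)) b) 0 s := by
      intro s hs
      have h1 := hwd s hs
      rw [hH.fderiv_actionField] at h1
      have hz : HasDerivAt (fun s => (w s).2.2) _ s :=
        ((ContinuousLinearMap.snd ℝ (Eucl n) ℝ).comp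
          (ContinuousLinearMap.snd ℝ (Eucl n) (Eucl n × ℝ))).hasFDerivAt.comp_hasDerivAt s h1
      have hq : HasDerivAt (fun s => (w s).1) _ s :=
        (ContinuousLinearMap.fst ℝ (Eucl n) (Eucl n × ℝ)).hasFDerivAt.comp_hasDerivAt s h1
      have h2 := (hz.sub ((hpt s hs Q hQ).inner ℝ hq)).sub
        ((hasDerivAt_id s).mul_const (inner ℝ (gradQ H (Q, 0)) b : ℝ))
      refine h2.congr_deriv ?_
      simp only [ContinuousLinearMap.comp_apply, ContinuousLinearMap.coe_fst',
        ContinuousLinearMap.coe_snd', inner_neg_left]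
      rw [← henw s hs, real_inner_comm (Ψ (s, Q)).2.1]
      ring
    have h3 := isOpen_Ioo.is_const_of_deriv_eq_zero isPreconnected_Ioo
      (fun s hs => (hconst s hs).differentiableAt.differentiableWithinAt)
      (fun s hs => (hconst s hs).deriv) ht h0T
    have h4 : (w 0).2.2 = 0 := by
      have h5 : HasFDerivAt (fun R => (Ψ (0, R)).2.2) ((ContinuousLinearMap.snd ℝ _ _).comp
          ((ContinuousLinearMap.snd ℝ _ _).comp ((fderiv ℝ Ψ (0, Q)).comp
          (ContinuousLinearMap.inr ℝ ℝ (Eucl n))))) Q :=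
        (HasFDerivAt.comp (g := Ψ) (f := fun R => ((0 : ℝ), R)) Q (hΨd' 0 h0T Q hQ)
          (hasFDerivAt_prodMk_right (0 : ℝ) Q)).snd.snd
      have h6 : HasFDerivAt (fun R => (Ψ (0, R)).2.2) (0 : Eucl n →L[ℝ] ℝ) Q :=
        (hasFDerivAt_const (0 : ℝ) Q).congr_of_eventuallyEq (by
          filter_upwards [Metric.isOpen_ball.mem_nhds hQ] with R hR
          rw [hΨ0 R hR])
      exact congrArg (fun L => L b) (h5.unique h6)
    simp only [h4, hΨ0 Q hQ, inner_zero_left, zero_mul, sub_zero] at h3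
    linarith
  rw [hsplit]
  simp only [Prod.fst_add, Prod.snd_add, Prod.smul_fst, Prod.smul_snd, inner_add_right, hvar,
    inner_smul_right, smul_eq_mul]
  simp only [actionField]
  rw [real_inner_comm (Ψ (t, Q)).2.1]
  ring

end Characteristics

section OddSquare

variable {V : Type*} [NormedAddCommGroup V] [NormedSpace ℝ V]

/-- The substitution `τ = t²` in a map `q(t, Q)` with `q(0, Q) = Q`, extended to negative `τ` by
reflection in `Q`. -/
def oddSquare (q : ℝ × V → V) (w : ℝ × V) : V :=
  if 0 ≤ w.1 then q (√w.1, w.2) else (2 : ℝ) • w.2 - q (√(-w.1), w.2)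

theorem oddSquare_of_nonneg (q : ℝ × V → V) {τ : ℝ} (hτ : 0 ≤ τ) (Q : V) :
    oddSquare q (τ, Q) = q (√τ, Q) := if_pos hτ

theorem oddSquare_of_nonpos {q : ℝ × V → V} {τ : ℝ} (hτ : τ ≤ 0) {Q : V} (hQ : q (0, Q) = Q) :
    oddSquare q (τ, Q) = (2 : ℝ) • Q - q (√(-τ), Q) := by
  rcases hτ.lt_or_eq with h | rfl
  · exact if_neg (not_le.2 h)
  · simp [oddSquare, hQ, two_smul]

theorem norm_sub_sub_smul_le_of_deriv {f : ℝ → V} {f' : ℝ → V} {a : V} {s t ε : ℝ}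
    (hst : s ≤ t) (hf : ∀ r ∈ Icc s t, HasDerivAt f (f' r) r)
    (hb : ∀ r ∈ Icc s t, ‖f' r - (2 * r) • a‖ ≤ 2 * ε * r) :
    ‖f t - f s - (t ^ 2 - s ^ 2) • a‖ ≤ ε * (t ^ 2 - s ^ 2) := by
  have hsq : ∀ r : ℝ, HasDerivAt (fun r : ℝ => r ^ 2 - s ^ 2) (2 * r) r := fun r => by
    simpa using (hasDerivAt_pow 2 r).sub_const (s ^ 2)
  have hd : ∀ r ∈ Icc s t, HasDerivAt (fun r => f r - f s - (r ^ 2 - s ^ 2) • a)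
      (f' r - (2 * r) • a) r := fun r hr => ((hf r hr).sub_const (f s)).sub ((hsq r).smul_const a)
  have hB : ∀ r : ℝ, HasDerivAt (fun r => ε * (r ^ 2 - s ^ 2)) (2 * ε * r) r := fun r => by
    refine ((hsq r).const_mul ε).congr_deriv ?_
    ring
  refine image_norm_le_of_norm_deriv_right_le_deriv_boundary
    (f := fun r => f r - f s - (r ^ 2 - s ^ 2) • a) (B := fun r => ε * (r ^ 2 - s ^ 2))
    (fun r hr => (hd r hr).continuousAt.continuousWithinAt)
    (fun r hr => (hd r (Ico_subset_Icc_self hr)).hasDerivWithinAt) (by simp)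
    (fun r => hB r)
    (fun r hr => hb r (Ico_subset_Icc_self hr)) (right_mem_Icc.2 hst)

theorem norm_oddSquare_sub_le {q : ℝ × V → V} {q' : ℝ → V} {a Q : V} {δ ε : ℝ} (hQ : q (0, Q) = Q)
    (hf : ∀ r ∈ Ico 0 δ, HasDerivAt (fun r => q (r, Q)) (q' r) r)
    (hb : ∀ r ∈ Ico 0 δ, ‖q' r - (2 * r) • a‖ ≤ 2 * ε * r) {σ τ : ℝ} (hστ : σ ≤ τ)
    (hσ : √(-σ) < δ) (hτ : √τ < δ) :
    ‖oddSquare q (τ, Q) - oddSquare q (σ, Q) - (τ - σ) • a‖ ≤ ε * (τ - σ) := by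
  have key : ∀ s t, 0 ≤ s → s ≤ t → √t < δ → ‖q (√t, Q) - q (√s, Q) - (t - s) • a‖ ≤ ε * (t - s) := by
    intro s t hs hst ht
    have h := norm_sub_sub_smul_le_of_deriv (f := fun r => q (r, Q)) (f' := q') (a := a) (ε := ε)
      (Real.sqrt_le_sqrt hst)
      (fun r hr => hf r ⟨(Real.sqrt_nonneg s).trans hr.1, hr.2.trans_lt ht⟩)
      (fun r hr => hb r ⟨(Real.sqrt_nonneg s).trans hr.1, hr.2.trans_lt ht⟩)
    rwa [Real.sq_sqrt hs, Real.sq_sqrt (hs.trans hst)] at h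
  rcases le_total 0 σ with h0 | h0
  · rw [oddSquare_of_nonneg q h0, oddSquare_of_nonneg q (h0.trans hστ)]
    exact key σ τ h0 hστ hτ
  · rcases le_total 0 τ with h1 | h1
    · rw [oddSquare_of_nonneg q h1, oddSquare_of_nonpos h0 hQ]
      have k1 := key 0 τ le_rfl h1 hτ
      have k2 := key 0 (-σ) le_rfl (by linarith) hσ
      rw [Real.sqrt_zero, hQ, sub_zero] at k1 k2
      calc _ = ‖(q (√τ, Q) - Q - τ • a) + (q (√(-σ), Q) - Q - (-σ) • a)‖ := by
            congr 1; rw [two_smul, sub_smul, neg_smul]; abel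
        _ ≤ _ := norm_add_le _ _
        _ ≤ ε * τ + ε * (-σ) := add_le_add k1 k2
        _ = _ := by ring
    · rw [oddSquare_of_nonpos h1 hQ, oddSquare_of_nonpos h0 hQ]
      have k := key (-τ) (-σ) (by linarith) (by linarith) hσ
      calc _ = ‖q (√(-σ), Q) - q (√(-τ), Q) - (-σ - -τ) • a‖ := by
            congr 1; rw [sub_smul, sub_smul, neg_smul, neg_smul]; abel
        _ ≤ _ := k
        _ = _ := by ring

theorem hasStrictFDerivAt_oddSquare {q : ℝ × V → V} {q' : ℝ × V → V} {Q₀ a : V}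
    (h0 : ∀ᶠ Q in 𝓝 Q₀, q (0, Q) = Q)
    (hd : ∀ᶠ w in 𝓝 ((0 : ℝ), Q₀), HasDerivAt (fun s => q (s, w.2)) (q' w) w.1)
    (hb : ∀ ε > 0, ∀ᶠ w in 𝓝 ((0 : ℝ), Q₀), ‖q' w - (2 * w.1) • a‖ ≤ ε * |w.1|)
    (hq : HasStrictFDerivAt q (ContinuousLinearMap.snd ℝ ℝ V) (0, Q₀)) :
    HasStrictFDerivAt (oddSquare q) (ContinuousLinearMap.snd ℝ ℝ V +
      (ContinuousLinearMap.fst ℝ ℝ V).smulRight a) (0, Q₀) := by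
  refine HasStrictFDerivAt.of_isLittleO (Asymptotics.isLittleO_iff.2 fun c hc => ?_)
  have hq2 := Asymptotics.isLittleO_iff.1 hq.isLittleO (half_pos hc)
  rw [nhds_prod_eq] at hq2
  obtain ⟨δ₁, hδ₁, H1⟩ := Metric.eventually_nhds_iff_ball.1 (hd.and (hb c hc))
  obtain ⟨δ₂, hδ₂, H2⟩ := Metric.eventually_nhds_iff_ball.1 h0
  rw [← nhds_prod_eq] at hq2
  obtain ⟨δ₃, hδ₃, H3⟩ := Metric.eventually_nhds_iff_ball.1 hq2
  set δ := min δ₁ (min δ₂ δ₃) with hδ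
  have hδ0 : 0 < δ := lt_min hδ₁ (lt_min hδ₂ hδ₃)
  have hd1 : δ ≤ δ₁ := min_le_left _ _
  have hd2 : δ ≤ δ₂ := (min_le_right _ _).trans (min_le_left _ _)
  have hd3 : δ ≤ δ₃ := (min_le_right _ _).trans (min_le_right _ _)
  have hev : ∀ᶠ w in 𝓝 ((0 : ℝ), Q₀), √w.1 < δ ∧ √(-w.1) < δ ∧ dist w.2 Q₀ < δ := by
    have e1 : Continuous fun w : ℝ × V => √w.1 := by fun_prop
    have e2 : Continuous fun w : ℝ × V => √(-w.1) := by fun_prop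
    have e3 : Continuous fun w : ℝ × V => dist w.2 Q₀ := by fun_prop
    exact (e1.continuousAt.eventually (gt_mem_nhds (by simpa))).and
      ((e2.continuousAt.eventually (gt_mem_nhds (by simpa))).and
        (e3.continuousAt.eventually (gt_mem_nhds (by simpa))))
  rw [nhds_prod_eq]
  filter_upwards [hev.prod_mk hev]
  rintro ⟨⟨σ, Q⟩, ⟨τ, R⟩⟩ ⟨⟨hσ1, hσ2, hQ⟩, ⟨hτ1, hτ2, hR⟩⟩
  simp only at hσ1 hσ2 hQ hτ1 hτ2 hR
  have hz : ∀ S, dist S Q₀ < δ → q (0, S) = S := fun S hS =>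
    H2 S (Metric.mem_ball.2 (hS.trans_le hd2))
  have hmem : ∀ S, dist S Q₀ < δ → ∀ r ∈ Ico 0 δ, (r, S) ∈ Metric.ball ((0 : ℝ), Q₀) δ := by
    intro S hS r hr
    rw [Metric.mem_ball, Prod.dist_eq, max_lt_iff]
    exact ⟨by simpa [abs_of_nonneg hr.1] using hr.2, hS⟩
  have hS : ∀ S, dist S Q₀ < δ → ∀ σ τ, √(-σ) < δ → √τ < δ → √(-τ) < δ → √σ < δ →
      ‖oddSquare q (τ, S) - oddSquare q (σ, S) - (τ - σ) • a‖ ≤ c / 2 * |τ - σ| := by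
    intro S hS
    have hord : ∀ σ τ, σ ≤ τ → √(-σ) < δ → √τ < δ →
      ‖oddSquare q (τ, S) - oddSquare q (σ, S) - (τ - σ) • a‖ ≤ c / 2 * (τ - σ) := by
      intro σ τ hle h1 h2
      refine norm_oddSquare_sub_le (q' := fun r => q' (r, S)) (hz S hS)
        (fun r hr => (H1 _ (Metric.ball_subset_ball hd1 (hmem S hS r hr))).1)
        (fun r hr => ?_) hle h1 h2
      have := (H1 _ (Metric.ball_subset_ball hd1 (hmem S hS r hr))).2
      simp only [abs_of_nonneg hr.1] at this
      linarith
    intro σ τ h1 h2 h3 h4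
    rcases le_total σ τ with h | h
    · rw [abs_of_nonneg (sub_nonneg.2 h)]
      exact hord σ τ h h1 h2
    · rw [abs_of_nonpos (sub_nonpos.2 h), neg_sub, ← norm_neg]
      have := hord τ σ h h3 h4
      rwa [show -(oddSquare q (τ, S) - oddSquare q (σ, S) - (τ - σ) • a) =
        oddSquare q (σ, S) - oddSquare q (τ, S) - (σ - τ) • a by rw [sub_smul, sub_smul]; abel]
  have hdiff : ‖oddSquare q (σ, Q) - oddSquare q (σ, R) - (Q - R)‖ ≤ c / 2 * ‖Q - R‖ := by
    have hpair : ∀ r ∈ Ico 0 δ, ‖q (r, Q) - q (r, R) - (Q - R)‖ ≤ c / 2 * ‖Q - R‖ := by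
      intro r hr
      have h1 := H3 ((r, Q), (r, R)) (by
        rw [Metric.mem_ball, Prod.dist_eq, max_lt_iff]
        exact ⟨(Metric.mem_ball.1 (hmem Q hQ r hr)).trans_le hd3,
          (Metric.mem_ball.1 (hmem R hR r hr)).trans_le hd3⟩)
      simpa [Prod.norm_def] using h1
    rcases le_total 0 σ with h | h
    · rw [oddSquare_of_nonneg q h, oddSquare_of_nonneg q h]
      exact hpair _ ⟨Real.sqrt_nonneg _, hσ1⟩
    · rw [oddSquare_of_nonpos h (hz Q hQ), oddSquare_of_nonpos h (hz R hR), ← norm_neg]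
      have := hpair _ ⟨Real.sqrt_nonneg (-σ), hσ2⟩
      rwa [show -((2 : ℝ) • Q - q (√(-σ), Q) - ((2 : ℝ) • R - q (√(-σ), R)) - (Q - R)) =
        q (√(-σ), Q) - q (√(-σ), R) - (Q - R) by rw [two_smul, two_smul]; abel]
  have htime := hS R hR τ σ hτ2 hσ1 hσ2 hτ1
  have hn1 : ‖Q - R‖ ≤ ‖((σ, Q) : ℝ × V) - (τ, R)‖ := by
    exact norm_snd_le (((σ, Q) : ℝ × V) - (τ, R))
  have hn2 : |σ - τ| ≤ ‖((σ, Q) : ℝ × V) - (τ, R)‖ := by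
    exact norm_fst_le (((σ, Q) : ℝ × V) - (τ, R))
  calc _ = ‖(oddSquare q (σ, Q) - oddSquare q (σ, R) - (Q - R)) +
        (oddSquare q (σ, R) - oddSquare q (τ, R) - (σ - τ) • a)‖ := by
          congr 1
          simp only [_root_.add_apply, ContinuousLinearMap.coe_snd', Prod.mk_sub_mk,
            ContinuousLinearMap.smulRight_apply, ContinuousLinearMap.coe_fst']
          abel
    _ ≤ _ := norm_add_le _ _
    _ ≤ c / 2 * ‖Q - R‖ + c / 2 * |σ - τ| := add_le_add hdiff htime
    _ ≤ c / 2 * ‖((σ, Q) : ℝ × V) - (τ, R)‖ + c / 2 * ‖((σ, Q) : ℝ × V) - (τ, R)‖ := by gcongr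
    _ = _ := by ring

end OddSquare

section Asymptotics

variable {n : ℕ} {H : Eucl n → Eucl n → ℝ} {r T : ℝ} {q p : ℝ × Eucl n → Eucl n}
  {z : ℝ × Eucl n → ℝ} {Q₀ : Eucl n}

theorem fderiv_eq_smul_add {V : Type*} [NormedAddCommGroup V] [NormedSpace ℝ V] {f : ℝ × Eucl n → V}
    {t : ℝ} {Q : Eucl n} {f' : V} (hf : DifferentiableAt ℝ f (t, Q))
    (ht : HasDerivAt (fun s => f (s, Q)) f' t) (v : ℝ × Eucl n) :
    fderiv ℝ f (t, Q) v = v.1 • f' + fderiv ℝ f (t, Q) (0, v.2) := by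
  have h1 : HasDerivAt (fun s => f (s, Q)) (fderiv ℝ f (t, Q) (1, 0)) t :=
    hf.hasFDerivAt.comp_hasDerivAt (f := fun s : ℝ => (s, Q)) t
      ((hasDerivAt_id t).prodMk (hasDerivAt_const t Q))
  rw [ht.unique h1, ← map_smul, ← map_add]
  simp

theorem fderiv_zero_right {V : Type*} [NormedAddCommGroup V] [NormedSpace ℝ V] {f : ℝ × Eucl n → V}
    {t : ℝ} {Q : Eucl n} {L : Eucl n →L[ℝ] V} (hf : DifferentiableAt ℝ f (t, Q))
    (h : HasFDerivAt (fun R => f (t, R)) L Q) (b : Eucl n) : fderiv ℝ f (t, Q) (0, b) = L b := by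
  have h1 := HasFDerivAt.comp (g := f) (f := fun R => (t, R)) Q hf.hasFDerivAt
    (hasFDerivAt_prodMk_right t Q)
  exact congrArg (fun L => L b) (h1.unique h)

/-- The second derivative of the kinetic energy at rest. -/
def massCLM (H : Eucl n → Eucl n → ℝ) (Q : Eucl n) : Eucl n →L[ℝ] Eucl n :=
  (fderiv ℝ (gradP H) (Q, 0)).comp (ContinuousLinearMap.inr ℝ (Eucl n) (Eucl n))

set_option maxHeartbeats 1000000 in
theorem transversal_estimate {V : Type*} [NormedAddCommGroup V] [InnerProductSpace ℝ V]
    {P G Gq g k gQ b B C : V} {t a e M ε : ℝ} (ht : 0 < t) (h7 : t ≤ 1) (he0 : 0 < e) (he1 : e ≤ 1)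
    (hc0 : 0 < inner ℝ k g) (hM1 : 1 ≤ M) (hgM : ‖g‖ ≤ M) (hkM : ‖k‖ ≤ M)
    (hn : ‖g‖ + 1 ≤ M) (hn' : ‖k‖ + 1 ≤ M)
    (he2 : e * (2 * M + 1) ≤ inner ℝ k g / 2)
    (he3 : e * (M * (2 * (M + 2) / inner ℝ k g) + 1 + 2 * (M + 2) / inner ℝ k g) ≤ ε)
    (h1 : ‖P + t • g‖ ≤ e * t) (h2 : ‖G + t • k‖ ≤ e * t) (h3 : ‖gQ - g‖ ≤ e) (h4 : ‖Gq‖ ≤ M)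
    (hv : inner ℝ gQ b = 0) (h5 : ‖B - b‖ ≤ e * ‖b‖) (h6 : ‖C‖ ≤ e * ‖b‖)
    (hpv : inner ℝ P (a • G + B) = 0) :
    |a| * t ≤ ε * ‖b‖ ∧ ‖a • G + B - b‖ ≤ ε * ‖b‖ ∧ t * ‖a • -Gq + C‖ ≤ ε * ‖b‖ := by
  obtain ⟨c, hc⟩ : ∃ c, c = inner ℝ k g := ⟨_, rfl⟩
  rw [← hc] at hc0 he2 he3
  obtain ⟨K, hK⟩ : ∃ K, K = 2 * (M + 2) / c := ⟨_, rfl⟩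
  rw [← hK] at he3
  have hK0 : 0 < K := by rw [hK]; positivity
  obtain ⟨x, hx⟩ : ∃ x, x = P + t • g := ⟨_, rfl⟩
  obtain ⟨y, hy⟩ : ∃ y, y = G + t • k := ⟨_, rfl⟩
  rw [← hx] at h1
  rw [← hy] at h2
  have hpx : P = x - t • g := by simp [hx]
  have hgy : G = y - t • k := by simp [hy]
  have hxM : ‖P‖ ≤ M * t := by
    rw [hpx]
    refine (norm_sub_le _ _).trans ?_
    rw [norm_smul, Real.norm_eq_abs, abs_of_pos ht]
    nlinarith [norm_nonneg k]
  have hyM : ‖G‖ ≤ M * t := by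
    rw [hgy]
    refine (norm_sub_le _ _).trans ?_
    rw [norm_smul, Real.norm_eq_abs, abs_of_pos ht]
    nlinarith [norm_nonneg g]
  have hlow : t ^ 2 * (c / 2) ≤ inner ℝ P G := by
    have e1 : inner ℝ P (G) =
        inner ℝ x y - t * inner ℝ x k - t * inner ℝ g y + t ^ 2 * c := by
      rw [hpx, hgy, hc]
      simp only [inner_sub_left, inner_sub_right, inner_smul_left, inner_smul_right, conj_trivial]
      rw [real_inner_comm k g]
      ring
    have i1 : |inner ℝ x y| ≤ (e * t) * (e * t) := (abs_real_inner_le_norm x y).trans (by gcongr)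
    have i2 : |inner ℝ x k| ≤ (e * t) * M := (abs_real_inner_le_norm _ _).trans (by gcongr)
    have i3 : |inner ℝ g y| ≤ M * (e * t) := (abs_real_inner_le_norm _ _).trans (by gcongr)
    have j1 := (abs_le.1 i1).1
    have j2 := mul_le_mul_of_nonneg_left (abs_le.1 i2).2 ht.le
    have j3 := mul_le_mul_of_nonneg_left (abs_le.1 i3).2 ht.le
    have j4 : (e * t) * (e * t) ≤ e * t ^ 2 := by nlinarith [mul_pos he0 (pow_pos ht 2)]
    rw [e1]
    nlinarith [pow_pos ht 2]
  have hup : |inner ℝ P B| ≤ t * (e * (M + 2)) * ‖b‖ := by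
    have e1 : inner ℝ P B = inner ℝ P (B - b) + inner ℝ x b +
        t * inner ℝ (gQ - g) b := by
      rw [inner_sub_left, hv, inner_sub_right, hpx]
      simp only [inner_sub_left, inner_smul_left, conj_trivial]
      ring
    have i1 : |inner ℝ P (B - b)| ≤ (M * t) * (e * ‖b‖) :=
      (abs_real_inner_le_norm _ _).trans (by gcongr)
    have i2 : |inner ℝ x b| ≤ (e * t) * ‖b‖ := (abs_real_inner_le_norm _ _).trans (by gcongr)
    have i3 : |t * inner ℝ (gQ - g) b| ≤ t * (e * ‖b‖) := by
      rw [abs_mul, abs_of_pos ht]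
      gcongr
      exact (abs_real_inner_le_norm _ _).trans (by gcongr)
    rw [e1]
    refine (abs_add_three _ _ _).trans ((add_le_add (add_le_add i1 i2) i3).trans_eq ?_)
    ring
  have hat : |a| * t ≤ e * K * ‖b‖ := by
    rw [inner_add_right, inner_smul_right] at hpv
    have e1 : |a| * (t ^ 2 * (c / 2)) ≤ t * (e * (M + 2)) * ‖b‖ := by
      calc |a| * (t ^ 2 * (c / 2)) ≤ |a| * inner ℝ P G := by
            gcongr
        _ = |a * inner ℝ P G| := by
            rw [abs_mul, abs_of_nonneg ((by positivity : 0 ≤ t ^ 2 * (c / 2)).trans hlow)]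
        _ = |inner ℝ P B| := by
            rw [← abs_neg, eq_neg_of_add_eq_zero_left hpv, neg_neg]
        _ ≤ _ := hup
    have e2 : t * (|a| * t) ≤ t * (e * K * ‖b‖) := by
      have : e * K * ‖b‖ = (e * (M + 2)) * ‖b‖ / (c / 2) := by rw [hK]; field_simp
      rw [this, ← mul_div_assoc, le_div_iff₀ (by positivity)]
      nlinarith
    exact le_of_mul_le_mul_left e2 ht
  have hb0 := norm_nonneg b
  have heb : 0 ≤ e * ‖b‖ := by positivity
  have hfin : e * ‖b‖ * (M * K + 1 + K) ≤ ε * ‖b‖ := by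
    calc _ = e * (M * K + 1 + K) * ‖b‖ := by ring
      _ ≤ _ := by gcongr
  have hMK : 0 ≤ e * ‖b‖ * (M * K) := by positivity
  have heK : 0 ≤ e * ‖b‖ * K := by positivity
  have hsum : e * ‖b‖ * (M * K) + e * ‖b‖ + e * ‖b‖ * K ≤ ε * ‖b‖ := by linarith
  refine ⟨by linarith, ?_, ?_⟩
  · rw [add_sub_assoc]
    refine (norm_add_le _ _).trans ?_
    rw [norm_smul, Real.norm_eq_abs]
    have i1 : |a| * ‖G‖ ≤ M * (e * K * ‖b‖) := by
      calc _ ≤ |a| * (M * t) := by gcongr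
        _ = M * (|a| * t) := by ring
        _ ≤ _ := by gcongr
    have i2 : M * (e * K * ‖b‖) = e * ‖b‖ * (M * K) := by ring
    linarith
  · have i0 : ‖a • -Gq + C‖ ≤ |a| * M + e * ‖b‖ := by
      refine (norm_add_le _ _).trans ?_
      rw [norm_smul, norm_neg, Real.norm_eq_abs]
      gcongr
    calc _ ≤ t * (|a| * M + e * ‖b‖) := by gcongr
      _ = M * (|a| * t) + t * (e * ‖b‖) := by ring
      _ ≤ M * (e * K * ‖b‖) + 1 * (e * ‖b‖) := by gcongr
      _ ≤ _ := by linarith [show M * (e * K * ‖b‖) = e * ‖b‖ * (M * K) by ring]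

variable (hH : IsClassicalHamiltonian H) (hF : IsBrakeFlow H r T q p z) (hT : 0 < T)
  (hQ₀ : Q₀ ∈ Metric.ball 0 r)

include hH in
theorem IsClassicalHamiltonian.inner_massCLM_pos (hg : gradQ H (Q₀, 0) ≠ 0) :
    0 < inner ℝ (massCLM H Q₀ (gradQ H (Q₀, 0))) (gradQ H (Q₀, 0)) :=
  lt_of_lt_of_le (mul_pos (hH.modulus_pos Q₀) (pow_pos (norm_pos_iff.2 hg) 2))
    (hH.modulus_le Q₀ 0 (gradQ H (Q₀, 0)))

include hF hT hQ₀

namespace IsBrakeFlow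

omit hT hQ₀ hF in
theorem mem_nhds {w : ℝ × Eucl n} (hw : w.1 ∈ Ioo (-T) T) (hw2 : w.2 ∈ Metric.ball 0 r) :
    Ioo (-T) T ×ˢ Metric.ball (0 : Eucl n) r ∈ 𝓝 w :=
  (isOpen_Ioo.prod Metric.isOpen_ball).mem_nhds ⟨hw, hw2⟩

omit hF in
theorem eventually_mem : ∀ᶠ w in 𝓝 ((0 : ℝ), Q₀), w.1 ∈ Ioo (-T) T ∧ w.2 ∈ Metric.ball 0 r :=
  (isOpen_Ioo.prod Metric.isOpen_ball).mem_nhds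
    (show ((0 : ℝ), Q₀) ∈ Ioo (-T) T ×ˢ Metric.ball (0 : Eucl n) r from ⟨⟨by linarith, hT⟩, hQ₀⟩)

omit hT hQ₀ in
theorem contDiffAt_q {w : ℝ × Eucl n} (hw : w.1 ∈ Ioo (-T) T) (hw2 : w.2 ∈ Metric.ball 0 r) :
    ContDiffAt ℝ 1 q w := hF.contDiffOn_q.contDiffAt (mem_nhds hw hw2)

omit hT hQ₀ in
theorem contDiffAt_p {w : ℝ × Eucl n} (hw : w.1 ∈ Ioo (-T) T) (hw2 : w.2 ∈ Metric.ball 0 r) :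
    ContDiffAt ℝ 1 p w := hF.contDiffOn_p.contDiffAt (mem_nhds hw hw2)

omit hT hQ₀ in
theorem contDiffAt_z {w : ℝ × Eucl n} (hw : w.1 ∈ Ioo (-T) T) (hw2 : w.2 ∈ Metric.ball 0 r) :
    ContDiffAt ℝ 1 z w := hF.contDiffOn_z.contDiffAt (mem_nhds hw hw2)

include hH in
theorem fderiv_q_zero : fderiv ℝ q (0, Q₀) = ContinuousLinearMap.snd ℝ ℝ (Eucl n) := by
  have h0 : (0 : ℝ) ∈ Ioo (-T) T := ⟨by linarith, hT⟩
  have hd := (hF.contDiffAt_q (w := (0, Q₀)) h0 hQ₀).differentiableAt one_ne_zero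
  refine ContinuousLinearMap.ext fun v => ?_
  rw [fderiv_eq_smul_add hd (hF.deriv_q 0 h0 Q₀ hQ₀), hF.q_zero _ hQ₀, hF.p_zero _ hQ₀, hH.gradP_zero,
    smul_zero, zero_add, fderiv_zero_right hd (L := ContinuousLinearMap.id ℝ (Eucl n))]
  · rfl
  · refine (hasFDerivAt_id Q₀).congr_of_eventuallyEq ?_
    filter_upwards [Metric.isOpen_ball.mem_nhds hQ₀] with R hR using hF.q_zero R hR

theorem fderiv_p_zero : fderiv ℝ p (0, Q₀) =
    -(ContinuousLinearMap.fst ℝ ℝ (Eucl n)).smulRight (gradQ H (Q₀, 0)) := by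
  have h0 : (0 : ℝ) ∈ Ioo (-T) T := ⟨by linarith, hT⟩
  have hd := (hF.contDiffAt_p (w := (0, Q₀)) h0 hQ₀).differentiableAt one_ne_zero
  refine ContinuousLinearMap.ext fun v => ?_
  rw [fderiv_eq_smul_add hd (hF.deriv_p 0 h0 Q₀ hQ₀), hF.q_zero _ hQ₀, hF.p_zero _ hQ₀,
    fderiv_zero_right hd (L := (0 : Eucl n →L[ℝ] Eucl n))]
  · simp
  · refine (hasFDerivAt_const (0 : Eucl n) Q₀).congr_of_eventuallyEq ?_
    filter_upwards [Metric.isOpen_ball.mem_nhds hQ₀] with R hR using hF.p_zero R hR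

include hH in
theorem hasStrictFDerivAt_q : HasStrictFDerivAt q (ContinuousLinearMap.snd ℝ ℝ (Eucl n)) (0, Q₀) := by
  rw [← hF.fderiv_q_zero hH hT hQ₀]
  exact (hF.contDiffAt_q (w := (0, Q₀)) ⟨by linarith, hT⟩ hQ₀).hasStrictFDerivAt one_ne_zero

theorem hasStrictFDerivAt_p : HasStrictFDerivAt p
    (-(ContinuousLinearMap.fst ℝ ℝ (Eucl n)).smulRight (gradQ H (Q₀, 0))) (0, Q₀) := by
  rw [← hF.fderiv_p_zero hT hQ₀]
  exact (hF.contDiffAt_p (w := (0, Q₀)) ⟨by linarith, hT⟩ hQ₀).hasStrictFDerivAt one_ne_zero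

include hH in
theorem eventually_fderiv_q {ε : ℝ} (hε : 0 < ε) : ∀ᶠ w in 𝓝 ((0 : ℝ), Q₀), ∀ b : Eucl n,
    ‖fderiv ℝ q w (0, b) - b‖ ≤ ε * ‖b‖ := by
  have h1 := ((hF.contDiffAt_q (w := (0, Q₀)) ⟨by linarith, hT⟩ hQ₀).fderiv_right (m := 0)
    (by norm_num)).continuousAt
  filter_upwards [Metric.tendsto_nhds.1 h1 ε hε] with w hw b
  rw [dist_eq_norm, hF.fderiv_q_zero hH hT hQ₀] at hw
  have h2 := (fderiv ℝ q w - ContinuousLinearMap.snd ℝ ℝ (Eucl n)).le_of_opNorm_le hw.le (0, b)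
  simpa [Prod.norm_def] using h2

theorem eventually_fderiv_p {ε : ℝ} (hε : 0 < ε) : ∀ᶠ w in 𝓝 ((0 : ℝ), Q₀), ∀ b : Eucl n,
    ‖fderiv ℝ p w (0, b)‖ ≤ ε * ‖b‖ := by
  have h1 := ((hF.contDiffAt_p (w := (0, Q₀)) ⟨by linarith, hT⟩ hQ₀).fderiv_right (m := 0)
    (by norm_num)).continuousAt
  filter_upwards [Metric.tendsto_nhds.1 h1 ε hε] with w hw b
  rw [dist_eq_norm, hF.fderiv_p_zero hT hQ₀] at hw
  have h2 := (fderiv ℝ p w - -(ContinuousLinearMap.fst ℝ ℝ (Eucl n)).smulRight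
    (gradQ H (Q₀, 0))).le_of_opNorm_le hw.le (0, b)
  simpa [Prod.norm_def] using h2

theorem eventually_momentum {ε : ℝ} (hε : 0 < ε) : ∀ᶠ w in 𝓝 ((0 : ℝ), Q₀),
    ‖p w + w.1 • gradQ H (Q₀, 0)‖ ≤ ε * |w.1| := by
  have h1 := Asymptotics.isLittleO_iff.1 (hF.hasStrictFDerivAt_p hT hQ₀).isLittleO hε
  have h2 : Continuous (fun w : ℝ × Eucl n => (w, ((0 : ℝ), w.2))) := by fun_prop
  filter_upwards [(h2.tendsto ((0 : ℝ), Q₀)).eventually h1, eventually_mem hT hQ₀] with w hw hw2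
  simpa [hF.p_zero _ hw2.2, Prod.norm_def] using hw

omit hF hT hQ₀ in
include hH in
theorem eventually_gradP {ε : ℝ} (hε : 0 < ε) : ∀ᶠ x in 𝓝 (Q₀, (0 : Eucl n)),
    ‖gradP H x - massCLM H Q₀ x.2‖ ≤ ε * ‖x.2‖ := by
  have h0 := (hH.contDiff_gradP.contDiffAt (x := (Q₀, (0 : Eucl n)))).hasStrictFDerivAt one_ne_zero
  have h1 := Asymptotics.isLittleO_iff.1 h0.isLittleO hε
  have h2 : Continuous (fun x : Eucl n × Eucl n => (x, (x.1, (0 : Eucl n)))) := by fun_prop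
  filter_upwards [(h2.tendsto (Q₀, (0 : Eucl n))).eventually h1] with x hx
  have h3 : x - (x.1, (0 : Eucl n)) = (0, x.2) := by ext <;> simp
  simp only [h3, hH.gradP_zero, sub_zero] at hx
  simpa [Prod.norm_def, massCLM] using hx

include hH in
theorem tendsto_phase : Tendsto (fun w => (q w, p w)) (𝓝 ((0 : ℝ), Q₀)) (𝓝 (Q₀, 0)) := by
  have h0 : (0 : ℝ) ∈ Ioo (-T) T := ⟨by linarith, hT⟩
  have h1 : Tendsto q (𝓝 ((0 : ℝ), Q₀)) (𝓝 (q (0, Q₀))) :=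
    (hF.hasStrictFDerivAt_q hH hT hQ₀).hasFDerivAt.continuousAt
  have h2 : Tendsto p (𝓝 ((0 : ℝ), Q₀)) (𝓝 (p (0, Q₀))) :=
    (hF.hasStrictFDerivAt_p hT hQ₀).hasFDerivAt.continuousAt
  rw [hF.q_zero _ hQ₀] at h1
  rw [hF.p_zero _ hQ₀] at h2
  exact h1.prodMk_nhds h2

include hH in
theorem eventually_velocity {ε : ℝ} (hε : 0 < ε) : ∀ᶠ w in 𝓝 ((0 : ℝ), Q₀),
    ‖gradP H (q w, p w) + w.1 • massCLM H Q₀ (gradQ H (Q₀, 0))‖ ≤ ε * |w.1| := by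
  set A := massCLM H Q₀
  set g := gradQ H (Q₀, 0)
  have hε1 : 0 < ε / (2 * (‖g‖ + 1)) := by positivity
  have hε2 : 0 < min 1 (ε / (2 * (‖A‖ + 1))) := lt_min one_pos (by positivity)
  filter_upwards [(hF.tendsto_phase hH hT hQ₀).eventually (eventually_gradP hH hε1),
    hF.eventually_momentum hT hQ₀ hε2] with w h1 h2
  have h3 : ‖p w‖ ≤ (‖g‖ + 1) * |w.1| := by
    calc ‖p w‖ = ‖(p w + w.1 • g) - w.1 • g‖ := by simp
      _ ≤ ‖p w + w.1 • g‖ + ‖w.1 • g‖ := norm_sub_le _ _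
      _ ≤ 1 * |w.1| + |w.1| * ‖g‖ := by
          rw [norm_smul, Real.norm_eq_abs]
          gcongr
          exact h2.trans (by gcongr; exact min_le_left _ _)
      _ = _ := by ring
  calc _ = ‖(gradP H (q w, p w) - A (p w)) + A (p w + w.1 • g)‖ := by
        rw [map_add, map_smul]; congr 1; abel
    _ ≤ ‖gradP H (q w, p w) - A (p w)‖ + ‖A (p w + w.1 • g)‖ := norm_add_le _ _
    _ ≤ ε / (2 * (‖g‖ + 1)) * ((‖g‖ + 1) * |w.1|) +
        (‖A‖ + 1) * (ε / (2 * (‖A‖ + 1)) * |w.1|) := by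
        gcongr
        · exact h1.trans (by gcongr)
        · refine (A.le_opNorm _).trans ?_
          gcongr
          · linarith
          · exact h2.trans (by gcongr; exact min_le_right _ _)
    _ = ε * |w.1| := by field_simp; ring

include hH in
/-- Vectors tangent to the fronts are asymptotically tangent to the boundary. -/
theorem eventually_transversal (hg : gradQ H (Q₀, 0) ≠ 0) {ε : ℝ} (hε : 0 < ε) :
    ∀ᶠ w in 𝓝 ((0 : ℝ), Q₀), 0 < w.1 → ∀ v : ℝ × Eucl n, inner ℝ (gradQ H (w.2, 0)) v.2 = 0 →
      inner ℝ (p w) (fderiv ℝ q w v) = 0 → |v.1| * w.1 ≤ ε * ‖v.2‖ ∧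
        ‖fderiv ℝ q w v - v.2‖ ≤ ε * ‖v.2‖ ∧ w.1 * ‖fderiv ℝ p w v‖ ≤ ε * ‖v.2‖ := by
  set A := massCLM H Q₀
  set g := gradQ H (Q₀, 0) with hgdef
  set c := inner ℝ (A g) g with hc
  have hc0 : 0 < c := hH.inner_massCLM_pos hg
  set M := ‖g‖ + ‖A g‖ + 1 with hM
  have hM1 : 1 ≤ M := by rw [hM]; linarith [norm_nonneg g, norm_nonneg (A g)]
  have hgM : ‖g‖ ≤ M := by rw [hM]; linarith [norm_nonneg (A g)]
  have hAgM : ‖A g‖ ≤ M := by rw [hM]; linarith [norm_nonneg g]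
  set K := 2 * (M + 2) / c with hK
  have hK0 : 0 < K := by positivity
  set e := min 1 (min (c / (2 * (2 * M + 1))) (ε / (M * K + 1 + K))) with he
  have he0 : 0 < e := lt_min one_pos (lt_min (by positivity) (by positivity))
  have he1 : e ≤ 1 := min_le_left _ _
  have he2 : e * (2 * M + 1) ≤ c / 2 := by
    have h1 : e ≤ c / (2 * (2 * M + 1)) := (min_le_right _ _).trans (min_le_left _ _)
    have := mul_le_mul_of_nonneg_right h1 (by positivity : 0 ≤ 2 * M + 1)
    refine this.trans_eq ?_
    field_simp
  have he3 : e * (M * K + 1 + K) ≤ ε := by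
    have h1 : e ≤ ε / (M * K + 1 + K) := (min_le_right _ _).trans (min_le_right _ _)
    exact (le_div_iff₀ (by positivity)).1 h1
  have hgQ : ∀ᶠ w in 𝓝 ((0 : ℝ), Q₀), ‖gradQ H (w.2, 0) - g‖ ≤ e := by
    have h1 : Continuous fun w : ℝ × Eucl n => gradQ H (w.2, 0) :=
      hH.contDiff_gradQ.continuous.comp (by fun_prop)
    filter_upwards [Metric.tendsto_nhds.1 (h1.tendsto ((0 : ℝ), Q₀)) e he0] with w hw
    rw [dist_eq_norm] at hw
    exact hw.le
  have hgq : ∀ᶠ w in 𝓝 ((0 : ℝ), Q₀), ‖gradQ H (q w, p w)‖ < M := by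
    have h1 := (hH.contDiff_gradQ.continuous.norm.tendsto (Q₀, (0 : Eucl n))).comp
      (hF.tendsto_phase hH hT hQ₀)
    exact h1.eventually (gt_mem_nhds (by rw [← hgdef, hM]; linarith [norm_nonneg (A g)]))
  have hsmall : ∀ᶠ w in 𝓝 ((0 : ℝ), Q₀), w.1 < 1 :=
    continuous_fst.continuousAt.eventually (gt_mem_nhds one_pos)
  filter_upwards [hF.eventually_momentum hT hQ₀ he0, hF.eventually_velocity hH hT hQ₀ he0, hgQ, hgq,
    hF.eventually_fderiv_q hH hT hQ₀ he0, hF.eventually_fderiv_p hT hQ₀ he0, hsmall,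
    eventually_mem hT hQ₀] with w h1 h2 h3 h4 h5 h6 h7 h8 ht v hv hpv
  obtain ⟨t, Q⟩ := w
  obtain ⟨a, b⟩ := v
  simp only at h1 h2 h3 h4 h5 h6 h7 h8 ht hv ⊢
  rw [abs_of_pos ht] at h1 h2
  have hq1 := fderiv_eq_smul_add ((hF.contDiffAt_q (w := (t, Q)) h8.1 h8.2).differentiableAt one_ne_zero)
    (hF.deriv_q t h8.1 Q h8.2) (a, b)
  have hp1 := fderiv_eq_smul_add ((hF.contDiffAt_p (w := (t, Q)) h8.1 h8.2).differentiableAt one_ne_zero)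
    (hF.deriv_p t h8.1 Q h8.2) (a, b)
  simp only at hq1 hp1
  rw [hq1] at hpv ⊢
  rw [hp1]
  exact transversal_estimate ht h7.le he0 he1 hc0 hM1 hgM hAgM
    (by linarith [norm_nonneg (A g)]) (by linarith [norm_nonneg g]) he2 he3 h1 h2 h3 h4.le hv (h5 b) (h6 b)
    hpv

end IsBrakeFlow

end Asymptotics

section Positivity

variable {n : ℕ} {H : Eucl n → Eucl n → ℝ} {r T : ℝ} {q p : ℝ × Eucl n → Eucl n}
  {z : ℝ × Eucl n → ℝ} {Q₀ : Eucl n}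
  (hH : IsClassicalHamiltonian H) (hF : IsBrakeFlow H r T q p z) (hT : 0 < T)
  (hQ₀ : Q₀ ∈ Metric.ball 0 r)

namespace IsBrakeFlow

include hF hT hQ₀

include hH

theorem tendsto_q : Tendsto q (𝓝 ((0 : ℝ), Q₀)) (𝓝 Q₀) := by
  have h2 : Tendsto q (𝓝 ((0 : ℝ), Q₀)) (𝓝 (q (0, Q₀))) :=
    (hF.hasStrictFDerivAt_q hH hT hQ₀).hasFDerivAt.continuousAt
  rwa [hF.q_zero _ hQ₀] at h2

/-- Momenta on the energy level of the flow are of the order of time. -/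
theorem eventually_energy_shell : ∃ K : ℝ, 0 < K ∧ ∀ δ : ℝ, 0 < δ → ∀ᶠ w in 𝓝 ((0 : ℝ), Q₀), 0 < w.1 →
    ∀ π, H (q w) π = H (q w) (p w) → ‖π‖ ≤ δ ∧ ‖gradP H (q w, π)‖ ≤ K * w.1 := by
  set g := gradQ H (Q₀, 0)
  set A := massCLM H Q₀
  set m := hH.modulus Q₀
  have hm : 0 < m := hH.modulus_pos Q₀
  set M := ‖g‖ + ‖A g‖ + 1
  have hM : 0 < M := by positivity
  set K := √(4 * M ^ 2 / m)
  have hK : 0 < K := Real.sqrt_pos.2 (by positivity)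
  refine ⟨(1 + ‖A‖) * K, by positivity, fun δ hδ => ?_⟩
  obtain ⟨η, hη, hball⟩ := Metric.eventually_nhds_iff.1 (eventually_gradP hH (Q₀ := Q₀) one_pos)
  have hmod : ∀ᶠ w in 𝓝 ((0 : ℝ), Q₀), m / 2 < hH.modulus (q w) :=
    ((hH.continuous_modulus.tendsto Q₀).comp (hF.tendsto_q hH hT hQ₀)).eventually
      (lt_mem_nhds (half_lt_self hm))
  have hsmall : ∀ᶠ w in 𝓝 ((0 : ℝ), Q₀), w.1 < min δ (η / 2) / K :=
    continuous_fst.continuousAt.eventually (gt_mem_nhds (by positivity))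
  filter_upwards [hF.eventually_momentum hT hQ₀ one_pos, hF.eventually_velocity hH hT hQ₀ one_pos,
    hmod, hsmall, Metric.tendsto_nhds.1 (hF.tendsto_q hH hT hQ₀) η hη] with w h1 h2 h3 h4 h5 ht π hπ
  rw [abs_of_pos ht, one_mul] at h1 h2
  have aux : ∀ x k : Eucl n, ‖x + w.1 • k‖ ≤ w.1 → ‖x‖ ≤ (‖k‖ + 1) * w.1 := fun x k hx => by
    calc ‖x‖ = ‖(x + w.1 • k) - w.1 • k‖ := by simp
      _ ≤ ‖x + w.1 • k‖ + ‖w.1 • k‖ := norm_sub_le _ _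
      _ ≤ w.1 + w.1 * ‖k‖ := by
          rw [norm_smul, Real.norm_eq_abs, abs_of_pos ht]; gcongr
      _ = _ := by ring
  have h1' : ‖p w‖ ≤ M * w.1 := (aux _ _ h1).trans (by
    gcongr; linarith [norm_nonneg (A g)])
  have h2' : ‖gradP H (q w, p w)‖ ≤ M * w.1 := (aux _ _ h2).trans (by
    gcongr; linarith [norm_nonneg g])
  have h6 : m / 4 * ‖π‖ ^ 2 ≤ (M * w.1) * (M * w.1) := by
    calc m / 4 * ‖π‖ ^ 2 ≤ hH.modulus (q w) / 2 * ‖π‖ ^ 2 :=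
        mul_le_mul_of_nonneg_right (by linarith) (sq_nonneg _)
      _ ≤ H (q w) π - H (q w) 0 := hH.kinetic_ge _ _
      _ = H (q w) (p w) - H (q w) 0 := by rw [hπ]
      _ ≤ inner ℝ (gradP H (q w, p w)) (p w) := hH.kinetic_le _ _
      _ ≤ ‖gradP H (q w, p w)‖ * ‖p w‖ := real_inner_le_norm _ _
      _ ≤ _ := by gcongr
  have h7 : ‖π‖ ≤ K * w.1 := by
    refine abs_le_of_sq_le_sq' ?_ (by positivity) |>.2
    rw [mul_pow, Real.sq_sqrt (by positivity), div_mul_eq_mul_div, le_div_iff₀ hm]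
    linarith
  have h8 : K * w.1 < min δ (η / 2) := by
    rw [lt_div_iff₀ hK] at h4
    linarith
  have h9 : ‖π‖ < η := by linarith [min_le_right δ (η / 2)]
  refine ⟨by linarith [min_le_left δ (η / 2)], ?_⟩
  have h10 := hball (y := (q w, π)) (by
    rw [Prod.dist_eq]
    exact max_lt h5 (by simpa using h9))
  simp only [one_mul] at h10
  calc ‖gradP H (q w, π)‖ = ‖(gradP H (q w, π) - A π) + A π‖ := by simp
    _ ≤ ‖gradP H (q w, π) - A π‖ + ‖A π‖ := norm_add_le _ _
    _ ≤ ‖π‖ + ‖A‖ * ‖π‖ := add_le_add h10 (A.le_opNorm _)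
    _ = (1 + ‖A‖) * ‖π‖ := by ring
    _ ≤ (1 + ‖A‖) * (K * w.1) := by gcongr
    _ = _ := by ring

theorem eventually_injective (hg : gradQ H (Q₀, 0) ≠ 0) : ∀ᶠ w in 𝓝 ((0 : ℝ), Q₀), 0 < w.1 →
    ∀ v : ℝ × Eucl n, inner ℝ (gradQ H (w.2, 0)) v.2 = 0 → fderiv ℝ q w v = 0 → v = 0 := by
  filter_upwards [hF.eventually_transversal hH hT hQ₀ hg one_half_pos] with w hw ht v hv hv0
  obtain ⟨h1, h2, -⟩ := hw ht v hv (by simp [hv0])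
  rw [hv0, zero_sub, norm_neg] at h2
  have h3 : ‖v.2‖ = 0 := by linarith [norm_nonneg v.2]
  rw [h3, mul_zero] at h1
  have h4 : |v.1| = 0 := by
    by_contra h
    have := mul_pos ((abs_nonneg _).lt_of_ne' h) ht
    linarith
  exact Prod.ext (abs_eq_zero.1 h4) (norm_eq_zero.1 h3)

theorem eventually_hessian_pos (hg : gradQ H (Q₀, 0) ≠ 0) : ∀ᶠ w in 𝓝 ((0 : ℝ), Q₀), 0 < w.1 →
    ∀ v : ℝ × Eucl n, inner ℝ (gradQ H (w.2, 0)) v.2 = 0 → ∀ π, H (q w) π = H (q w) (p w) →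
      fderiv ℝ q w v = gradP H (q w, π) → inner ℝ (p w) (fderiv ℝ q w v) = 0 →
      0 < inner ℝ (fderiv ℝ p w v) (fderiv ℝ q w v) +
        inner ℝ (p w) (fderiv ℝ (gradP H) (q w, π) (fderiv ℝ q w v, -gradQ H (q w, π))) := by
  obtain ⟨K, hK, hshell⟩ := hF.eventually_energy_shell hH hT hQ₀
  set g := gradQ H (Q₀, 0) with hgdef
  set k := massCLM H Q₀ g with hkdef
  obtain ⟨c, hc⟩ : ∃ c, c = inner ℝ k g := ⟨_, rfl⟩
  have hc0 : 0 < c := hc ▸ hH.inner_massCLM_pos hg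
  have hk0 := norm_nonneg k
  have hg0 := norm_nonneg g
  obtain ⟨e, he⟩ : ∃ e, e = c / (8 * (‖k‖ + 1)) := ⟨_, rfl⟩
  have he0 : 0 < e := by rw [he]; positivity
  have he' : e * (‖k‖ + 1) = c / 8 := by rw [he]; field_simp
  obtain ⟨ε, hε⟩ : ∃ ε, ε = min 1 (c / (8 * (‖g‖ + 1))) := ⟨_, rfl⟩
  have hε0 : 0 < ε := by rw [hε]; exact lt_min one_pos (by positivity)
  have hε1 : ε ≤ 1 := hε ▸ min_le_left _ _
  have hε' : ε * ‖g‖ ≤ c / 8 := by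
    have h1 : ε ≤ c / (8 * (‖g‖ + 1)) := hε ▸ min_le_right _ _
    rw [le_div_iff₀ (by positivity)] at h1
    nlinarith
  obtain ⟨ρ, hρ⟩ : ∃ ρ, ρ = min (1 / 2) (c / (8 * K ^ 2)) := ⟨_, rfl⟩
  have hρ0 : 0 < ρ := by rw [hρ]; exact lt_min one_half_pos (by positivity)
  have hρ1 : ρ ≤ 1 / 2 := hρ ▸ min_le_left _ _
  have hρ' : ρ * K ^ 2 ≤ c / 8 := by
    have h1 : ρ ≤ c / (8 * K ^ 2) := hρ ▸ min_le_right _ _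
    rw [le_div_iff₀ (by positivity)] at h1
    linarith
  have hcont : Continuous fun y : (Eucl n × Eucl n) × Eucl n =>
      fderiv ℝ (gradP H) y.1 (y.2, -gradQ H y.1) :=
    ((hH.contDiff_gradP.continuous_fderiv one_ne_zero).comp continuous_fst).clm_apply
      (continuous_snd.prodMk (hH.contDiff_gradQ.continuous.comp continuous_fst).neg)
  have hlim := Metric.tendsto_nhds.1 (hcont.tendsto ((Q₀, 0), 0)) ε hε0
  have hval : fderiv ℝ (gradP H) (Q₀, (0 : Eucl n)) (0, -gradQ H (Q₀, 0)) = -k := by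
    rw [hkdef, massCLM, ContinuousLinearMap.comp_apply, ← map_neg]
    simp [hgdef]
  simp only [hval] at hlim
  obtain ⟨δ, hδ, hball⟩ := Metric.eventually_nhds_iff.1 hlim
  have hsmall : ∀ᶠ w in 𝓝 ((0 : ℝ), Q₀), w.1 < δ / K :=
    continuous_fst.continuousAt.eventually (gt_mem_nhds (by positivity))
  filter_upwards [hF.eventually_momentum hT hQ₀ he0, hF.eventually_transversal hH hT hQ₀ hg hρ0,
    hshell (δ / 2) (half_pos hδ), hsmall, Metric.tendsto_nhds.1 (hF.tendsto_q hH hT hQ₀) δ hδ]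
    with w h1 h2 h3 h4 h5 ht v hv π hπ hu hpu
  obtain ⟨h6, h7⟩ := h3 ht π hπ
  rw [← hu] at h7
  obtain ⟨-, h8, h9⟩ := h2 ht v hv hpu
  rw [abs_of_pos ht] at h1
  have h10 := hball (y := ((q w, π), fderiv ℝ q w v)) (by
    rw [Prod.dist_eq, Prod.dist_eq, dist_zero_right, dist_zero_right]
    rw [lt_div_iff₀ hK] at h4
    exact max_lt (max_lt h5 (by dsimp only; linarith)) (by dsimp only; linarith))
  simp only [dist_eq_norm, sub_neg_eq_add] at h10
  generalize fderiv ℝ (gradP H) (q w, π) (fderiv ℝ q w v, -gradQ H (q w, π)) = F at h10 ⊢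
  generalize fderiv ℝ q w v = u at h7 h8 h10 ⊢
  generalize fderiv ℝ p w v = b at h9 ⊢
  generalize p w = P at h1 ⊢
  have i1 : ‖v.2‖ ≤ 2 * ‖u‖ := by
    have : ‖v.2‖ ≤ ‖u‖ + ‖u - v.2‖ := by
      calc ‖v.2‖ = ‖u - (u - v.2)‖ := by simp
        _ ≤ _ := norm_sub_le _ _
    have : ρ * ‖v.2‖ ≤ 1 / 2 * ‖v.2‖ := by gcongr
    linarith
  have i2 : |inner ℝ b u| ≤ w.1 * (c / 4) := by
    refine le_of_mul_le_mul_left ?_ ht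
    calc w.1 * |inner ℝ b u| ≤ w.1 * (‖b‖ * ‖u‖) := by gcongr; exact abs_real_inner_le_norm _ _
      _ = (w.1 * ‖b‖) * ‖u‖ := by ring
      _ ≤ (ρ * (2 * ‖u‖)) * ‖u‖ :=
        mul_le_mul_of_nonneg_right (h9.trans (by gcongr)) (norm_nonneg _)
      _ = 2 * ρ * ‖u‖ ^ 2 := by ring
      _ ≤ 2 * ρ * (K * w.1) ^ 2 := by gcongr
      _ = 2 * (ρ * K ^ 2) * w.1 ^ 2 := by ring
      _ ≤ 2 * (c / 8) * w.1 ^ 2 := by gcongr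
      _ = _ := by ring
  have e1 : inner ℝ P F = inner ℝ (P + w.1 • g) F - w.1 * inner ℝ g (F + k) + w.1 * c := by
    rw [hc, real_inner_comm g k]
    simp only [inner_add_left, inner_add_right, inner_smul_left, conj_trivial]
    ring
  have i3 : ‖F‖ ≤ ‖k‖ + 1 := by
    calc ‖F‖ = ‖(F + k) - k‖ := by simp
      _ ≤ ‖F + k‖ + ‖k‖ := norm_sub_le _ _
      _ ≤ _ := by linarith
  have i4 : |inner ℝ (P + w.1 • g) F| ≤ w.1 * (c / 8) := by
    calc _ ≤ ‖P + w.1 • g‖ * ‖F‖ := abs_real_inner_le_norm _ _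
      _ ≤ (e * w.1) * (‖k‖ + 1) := by gcongr
      _ = w.1 * (e * (‖k‖ + 1)) := by ring
      _ = _ := by rw [he']
  have i5 : inner ℝ g (F + k) ≤ c / 8 := by
    calc _ ≤ ‖g‖ * ‖F + k‖ := real_inner_le_norm _ _
      _ ≤ ‖g‖ * ε := by gcongr
      _ ≤ _ := by linarith
  have i6 := mul_le_mul_of_nonneg_left i5 ht.le
  have i7 := (abs_le.1 i2).1
  have i8 := (abs_le.1 i4).1
  have i9 := mul_pos ht hc0
  rw [e1]
  linarith

end IsBrakeFlow

end Positivity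

section Collar

variable {n : ℕ} {H : Eucl n → Eucl n → ℝ} {r T : ℝ} {q p : ℝ × Eucl n → Eucl n}
  {z : ℝ × Eucl n → ℝ} {Q₀ : Eucl n}
  (hH : IsClassicalHamiltonian H) (hF : IsBrakeFlow H r T q p z) (hT : 0 < T)
  (hQ₀ : Q₀ ∈ Metric.ball 0 r)

namespace IsBrakeFlow

include hH hF hT hQ₀

theorem hasStrictFDerivAt_oddSquare : HasStrictFDerivAt (oddSquare q)
    (ContinuousLinearMap.snd ℝ ℝ (Eucl n) + (ContinuousLinearMap.fst ℝ ℝ (Eucl n)).smulRight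
      (-(1 / 2 : ℝ) • massCLM H Q₀ (gradQ H (Q₀, 0)))) (0, Q₀) := by
  refine _root_.hasStrictFDerivAt_oddSquare (q' := fun w => gradP H (q w, p w)) ?_ ?_ ?_
    (hF.hasStrictFDerivAt_q hH hT hQ₀)
  · filter_upwards [Metric.isOpen_ball.mem_nhds hQ₀] with Q hQ using hF.q_zero Q hQ
  · filter_upwards [eventually_mem hT hQ₀] with w hw using hF.deriv_q w.1 hw.1 w.2 hw.2
  · intro ε hε
    filter_upwards [hF.eventually_velocity hH hT hQ₀ hε] with w hw
    rwa [smul_smul, show 2 * w.1 * -(1 / 2 : ℝ) = -w.1 by ring, neg_smul, sub_neg_eq_add]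

theorem hasStrictFDerivAt_front (hg : gradQ H (Q₀, 0) ≠ 0) : ∃ e : (ℝ × Eucl n) ≃L[ℝ] (ℝ × Eucl n),
    HasStrictFDerivAt (fun w => (potentialEnergy H w.2, oddSquare q w))
      (e : (ℝ × Eucl n) →L[ℝ] (ℝ × Eucl n)) (0, Q₀) := by
  have h1 : HasStrictFDerivAt (potentialEnergy H) (innerSL ℝ (gradQ H (Q₀, 0))) Q₀ :=
    (hH.contDiff_potentialEnergy.contDiffAt).hasStrictFDerivAt' (hH.hasFDerivAt_potentialEnergy Q₀)
      two_ne_zero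
  have h2 := (HasStrictFDerivAt.comp (f := fun w : ℝ × Eucl n => w.2) ((0 : ℝ), Q₀) h1
    hasStrictFDerivAt_snd).prodMk (hF.hasStrictFDerivAt_oddSquare hH hT hQ₀)
  suffices hinj : ∀ v : ℝ × Eucl n, ((innerSL ℝ (gradQ H (Q₀, 0))).comp
      (ContinuousLinearMap.snd ℝ ℝ (Eucl n))).prod (ContinuousLinearMap.snd ℝ ℝ (Eucl n) +
        (ContinuousLinearMap.fst ℝ ℝ (Eucl n)).smulRight
          (-(1 / 2 : ℝ) • massCLM H Q₀ (gradQ H (Q₀, 0)))) v = 0 → v = 0 by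
    obtain ⟨e, he⟩ := exists_continuousLinearEquiv_of_injective _ hinj
    refine ⟨e, ?_⟩
    rw [he]
    exact h2
  intro v hv
  · obtain ⟨hv1, hv2⟩ := Prod.ext_iff.1 hv
    simp only [ContinuousLinearMap.prod_apply, ContinuousLinearMap.comp_apply,
      ContinuousLinearMap.coe_snd', innerSL_apply_apply, Prod.fst_zero, Prod.snd_zero,
      _root_.add_apply, ContinuousLinearMap.smulRight_apply, ContinuousLinearMap.coe_fst'] at hv1 hv2
    have h3 := congrArg (inner ℝ (gradQ H (Q₀, 0))) hv2
    rw [inner_add_right, hv1, inner_smul_right, inner_smul_right, inner_zero_right, zero_add,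
      real_inner_comm] at h3
    have h4 := (hH.inner_massCLM_pos hg).ne'
    have h5 : v.1 = 0 := by
      rcases mul_eq_zero.1 h3 with h | h
      · exact h
      · exact absurd h (mul_ne_zero (by norm_num) h4)
    rw [h5, zero_smul, add_zero] at hv2
    exact Prod.ext h5 hv2

theorem exists_injOn_front (hg : gradQ H (Q₀, 0) ≠ 0) : ∃ U ∈ 𝓝 ((0 : ℝ), Q₀),
    InjOn (fun w => (potentialEnergy H w.2, oddSquare q w)) U := by
  obtain ⟨e, he⟩ := hF.hasStrictFDerivAt_front hH hT hQ₀ hg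
  exact ⟨_, (he.toOpenPartialHomeomorph _).open_source.mem_nhds he.mem_toOpenPartialHomeomorph_source,
    (he.toOpenPartialHomeomorph _).injOn⟩

/-- On the negative side of the fold the potential energy is not lower than on the front. -/
theorem eventually_potentialEnergy_le (hg : gradQ H (Q₀, 0) ≠ 0) : ∀ᶠ w in 𝓝 ((0 : ℝ), Q₀), w.1 ≤ 0 →
    potentialEnergy H w.2 ≤ potentialEnergy H (oddSquare q w) := by
  have h0 : oddSquare q (0, Q₀) = Q₀ := by
    rw [oddSquare_of_nonneg q le_rfl, Real.sqrt_zero, hF.q_zero _ hQ₀]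
  have h1 : HasStrictFDerivAt (potentialEnergy H) (innerSL ℝ (gradQ H (Q₀, 0)))
      (oddSquare q (0, Q₀)) := by
    rw [h0]
    exact (hH.contDiff_potentialEnergy.contDiffAt).hasStrictFDerivAt'
      (hH.hasFDerivAt_potentialEnergy Q₀) two_ne_zero
  have h2 := HasStrictFDerivAt.comp ((0 : ℝ), Q₀) h1 (hF.hasStrictFDerivAt_oddSquare hH hT hQ₀)
  have hc := hH.inner_massCLM_pos hg
  have h3 := Asymptotics.isLittleO_iff.1 h2.isLittleO (half_pos hc)
  have h4 : Continuous (fun w : ℝ × Eucl n => (w, ((0 : ℝ), w.2))) := by fun_prop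
  filter_upwards [(h4.tendsto ((0 : ℝ), Q₀)).eventually h3, eventually_mem hT hQ₀] with w hw hw2 hw0
  have h5 : oddSquare q (0, w.2) = w.2 := by
    rw [oddSquare_of_nonneg q le_rfl, Real.sqrt_zero, hF.q_zero _ hw2.2]
  have h6 : w - ((0 : ℝ), w.2) = (w.1, 0) := by ext <;> simp
  simp only [h5, h6, ContinuousLinearMap.comp_apply, _root_.add_apply,
    ContinuousLinearMap.smulRight_apply, ContinuousLinearMap.coe_fst', ContinuousLinearMap.coe_snd',
    innerSL_apply_apply, zero_add, inner_smul_right] at hw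
  rw [real_inner_comm] at hw
  have h7 : ‖((w.1, 0) : ℝ × Eucl n)‖ = -w.1 := by
    rw [Prod.norm_def, norm_zero, Real.norm_eq_abs, abs_of_nonpos hw0, max_eq_left (by linarith)]
  rw [h7, Real.norm_eq_abs] at hw
  have := (abs_le.1 hw).1
  nlinarith

theorem eventually_exists_trajectory (hg : gradQ H (Q₀, 0) ≠ 0) {N : Set (ℝ × Eucl n)}
    (hN : N ∈ 𝓝 ((0 : ℝ), Q₀)) : ∀ᶠ y in 𝓝 Q₀, potentialEnergy H y < potentialEnergy H Q₀ →
      ∃ w ∈ N, 0 < w.1 ∧ potentialEnergy H w.2 = potentialEnergy H Q₀ ∧ q w = y := by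
  obtain ⟨e, he⟩ := hF.hasStrictFDerivAt_front hH hT hQ₀ hg
  have h0 : oddSquare q (0, Q₀) = Q₀ := by
    rw [oddSquare_of_nonneg q le_rfl, Real.sqrt_zero, hF.q_zero _ hQ₀]
  have hs : Tendsto (fun w : ℝ × Eucl n => (√w.1, w.2)) (𝓝 (0, Q₀)) (𝓝 (0, Q₀)) := by
    have : Continuous (fun w : ℝ × Eucl n => (√w.1, w.2)) := by fun_prop
    simpa using this.tendsto ((0 : ℝ), Q₀)
  have h1 : (fun w : ℝ × Eucl n => (√w.1, w.2)) ⁻¹' N ∩ {w | w.1 ≤ 0 →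
      potentialEnergy H w.2 ≤ potentialEnergy H (oddSquare q w)} ∈ 𝓝 ((0 : ℝ), Q₀) :=
    inter_mem (hs hN) (hF.eventually_potentialEnergy_le hH hT hQ₀ hg)
  have h2 := image_mem_map (m := fun w => (potentialEnergy H w.2, oddSquare q w)) h1
  rw [he.map_nhds_eq_of_equiv] at h2
  simp only [h0] at h2
  have h3 : Continuous fun y : Eucl n => (potentialEnergy H Q₀, y) := by fun_prop
  filter_upwards [(h3.tendsto Q₀) h2] with y hy hyE
  obtain ⟨w, ⟨hwN, hw⟩, hwy⟩ := hy
  obtain ⟨e1, e2⟩ := Prod.ext_iff.1 hwy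
  simp only at e1 e2
  have hw0 : 0 < w.1 := by
    by_contra hle
    have := hw (not_lt.1 hle)
    rw [e1, e2] at this
    linarith
  refine ⟨(√w.1, w.2), hwN, Real.sqrt_pos.2 hw0, e1, ?_⟩
  rw [← oddSquare_of_nonneg q hw0.le]
  exact e2

omit hH in
theorem eventually_momentum_ne_zero (hg : gradQ H (Q₀, 0) ≠ 0) :
    ∀ᶠ w in 𝓝 ((0 : ℝ), Q₀), 0 < w.1 → p w ≠ 0 := by
  have h0 := norm_pos_iff.2 hg
  filter_upwards [hF.eventually_momentum hT hQ₀ (half_pos h0)] with w hw ht h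
  rw [h, zero_add, norm_smul, Real.norm_eq_abs, abs_of_pos ht] at hw
  nlinarith

end IsBrakeFlow

/-- The inverse function theorem for the flow along the zero velocity level. -/
theorem IsBrakeFlow.exists_local_inverse (hH : IsClassicalHamiltonian H)
    (hF : IsBrakeFlow H r T q p z) {w : ℝ × Eucl n}
    (hw : w.1 ∈ Ioo (-T) T) (hw2 : w.2 ∈ Metric.ball 0 r)
    (hinj : ∀ v : ℝ × Eucl n, inner ℝ (gradQ H (w.2, 0)) v.2 = 0 → fderiv ℝ q w v = 0 → v = 0) :
    ∃ g : Eucl n → ℝ × Eucl n, g (q w) = w ∧ ContDiffAt ℝ 1 g (q w) ∧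
      ∀ᶠ y in 𝓝 (q w), potentialEnergy H (g y).2 = potentialEnergy H w.2 ∧ q (g y) = y := by
  have hc : ContDiffAt ℝ 1 (fun x : ℝ × Eucl n => (potentialEnergy H x.2, q x)) w :=
    ((hH.contDiff_potentialEnergy.of_le one_le_two).contDiffAt.comp w contDiffAt_snd).prodMk
      (hF.contDiffAt_q hw hw2)
  have hd : HasFDerivAt (fun x : ℝ × Eucl n => (potentialEnergy H x.2, q x))
      (((innerSL ℝ (gradQ H (w.2, 0))).comp (ContinuousLinearMap.snd ℝ ℝ (Eucl n))).prod
        (fderiv ℝ q w)) w :=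
    (HasFDerivAt.comp (g := potentialEnergy H) (f := fun x : ℝ × Eucl n => x.2) w
      (hH.hasFDerivAt_potentialEnergy w.2) hasFDerivAt_snd).prodMk
      ((hF.contDiffAt_q hw hw2).differentiableAt one_ne_zero).hasFDerivAt
  have hinj' : ∀ v : ℝ × Eucl n, ((innerSL ℝ (gradQ H (w.2, 0))).comp
      (ContinuousLinearMap.snd ℝ ℝ (Eucl n))).prod (fderiv ℝ q w) v = 0 → v = 0 := fun v hv =>
    hinj v (congrArg Prod.fst hv) (congrArg Prod.snd hv)
  obtain ⟨e, he⟩ := exists_continuousLinearEquiv_of_injective _ hinj'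
  · rw [← he] at hd
    have hs := hc.hasStrictFDerivAt' hd one_ne_zero
    have hinv := hc.to_localInverse hd one_ne_zero
    have hl := hc.localInverse_apply_image hd one_ne_zero
    have hr := hs.eventually_right_inverse
    have hj : ContDiff ℝ 1 fun y : Eucl n => (potentialEnergy H w.2, y) := by fun_prop
    refine ⟨fun y => hc.localInverse hd one_ne_zero (potentialEnergy H w.2, y), hl,
      ContDiffAt.comp (g := hc.localInverse hd one_ne_zero)
        (f := fun y : Eucl n => (potentialEnergy H w.2, y)) (q w) hinv hj.contDiffAt, ?_⟩
    filter_upwards [(hj.continuous.tendsto (q w)).eventually hr] with y hy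
    exact ⟨congrArg Prod.fst hy, congrArg Prod.snd hy⟩
end Collar

section Collar

/-- The trajectories of the brake flow that start on `∂D` fill a collar of `∂D` in `D`. -/
structure IsBrakeCollar {n : ℕ} (H : Eucl n → Eucl n → ℝ) (E : ℝ) (D : Set (Eucl n)) (r T s : ℝ)
    (q p : ℝ × Eucl n → Eucl n) (z : ℝ × Eucl n → ℝ) : Prop where
  flow : IsBrakeFlow H r T q p z
  pos : 0 < s
  lt : s < T
  frontier_subset : frontier D ⊆ Metric.ball 0 r
  injOn : InjOn q (Ioc 0 s ×ˢ frontier D)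
  mem : ∀ w ∈ Ioc 0 s ×ˢ frontier D, q w ∈ D
  momentum_ne_zero : ∀ w ∈ Ioc 0 s ×ˢ frontier D, p w ≠ 0
  injective : ∀ w ∈ Ioc 0 s ×ˢ frontier D, ∀ v : ℝ × Eucl n, inner ℝ (gradQ H (w.2, 0)) v.2 = 0 →
    fderiv ℝ q w v = 0 → v = 0
  hessian_pos : ∀ w ∈ Ioc 0 s ×ˢ frontier D, ∀ v : ℝ × Eucl n, inner ℝ (gradQ H (w.2, 0)) v.2 = 0 →
    ∀ π, H (q w) π = H (q w) (p w) → fderiv ℝ q w v = gradP H (q w, π) →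
      inner ℝ (p w) (fderiv ℝ q w v) = 0 →
      0 < inner ℝ (fderiv ℝ p w v) (fderiv ℝ q w v) +
        inner ℝ (p w) (fderiv ℝ (gradP H) (q w, π) (fderiv ℝ q w v, -gradQ H (q w, π)))
  exists_trajectory : ∀ Q ∈ frontier D, ∀ N ∈ 𝓝 ((0 : ℝ), Q), ∀ᶠ y in 𝓝 Q, y ∈ D →
    ∃ w ∈ N, 0 < w.1 ∧ w.2 ∈ frontier D ∧ q w = y

variable {n : ℕ} {H : Eucl n → Eucl n → ℝ} {E : ℝ} {D : Set (Eucl n)}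

theorem IsClassicalHamiltonian.exists_brakeCollar (hH : IsClassicalHamiltonian H)
    (hD : IsPotentialWell H E D) (hcpt : IsCompact (closure D)) :
    ∃ (r T s : ℝ) (q p : ℝ × Eucl n → Eucl n) (z : ℝ × Eucl n → ℝ), IsBrakeCollar H E D r T s q p z := by
  have hΓ : IsCompact (frontier D) := hcpt.of_isClosed_subset isClosed_frontier frontier_subset_closure
  obtain ⟨r, hr, hΓr⟩ : ∃ r : ℝ, 0 < r ∧ frontier D ⊆ Metric.ball 0 r := by
    obtain ⟨r, hr⟩ := hΓ.isBounded.subset_ball 0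
    exact ⟨max r 1, by positivity, hr.trans (Metric.ball_subset_ball (le_max_left _ _))⟩
  obtain ⟨T, hT, q, p, z, hF⟩ := hH.exists_brakeFlow hr
  obtain ⟨W, hWo, hΓW, hW⟩ := hD.exists_nhds_boundary hH
  have hg : ∀ Q ∈ frontier D, gradQ H (Q, 0) ≠ 0 := fun Q hQ => hD.gradQ_ne_zero hH hQ
  have hE : ∀ Q ∈ frontier D, potentialEnergy H Q = E := hD.eq_on
  have hU : ∃ U ∈ 𝓝ˢ ({(0 : ℝ)} ×ˢ frontier D),
      InjOn (fun w => (potentialEnergy H w.2, oddSquare q w)) U := by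
    refine Set.InjOn.exists_mem_nhdsSet ?_ (isCompact_singleton.prod hΓ) ?_ ?_
    · rintro ⟨t, Q⟩ ⟨rfl, hQ⟩ ⟨t', R⟩ ⟨rfl, hR⟩ h
      have h1 := congrArg Prod.snd h
      simp only [oddSquare_of_nonneg q le_rfl, Real.sqrt_zero] at h1
      rw [hF.q_zero _ (hΓr hQ), hF.q_zero _ (hΓr hR)] at h1
      exact Prod.ext rfl h1
    · rintro ⟨t, Q⟩ ⟨rfl, hQ⟩
      obtain ⟨e, he⟩ := hF.hasStrictFDerivAt_front hH hT (hΓr hQ) (hg Q hQ)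
      exact he.continuousAt
    · rintro ⟨t, Q⟩ ⟨rfl, hQ⟩
      exact hF.exists_injOn_front hH hT (hΓr hQ) (hg Q hQ)
  obtain ⟨U, hU, hinj⟩ := hU
  have h1 : ∀ᶠ τ in 𝓝 (0 : ℝ), ∀ Q ∈ frontier D, (τ, Q) ∈ U :=
    hΓ.eventually_forall_of_forall_eventually (P := fun τ Q => (τ, Q) ∈ U) fun Q hQ =>
      mem_nhdsSet_iff_forall.1 hU (0, Q) ⟨rfl, hQ⟩
  have h2 : ∀ᶠ t in 𝓝 (0 : ℝ), ∀ Q ∈ frontier D, 0 < t → q (t, Q) ∈ W ∧ p (t, Q) ≠ 0 ∧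
      (∀ v : ℝ × Eucl n, inner ℝ (gradQ H (Q, 0)) v.2 = 0 → fderiv ℝ q (t, Q) v = 0 → v = 0) ∧
      ∀ v : ℝ × Eucl n, inner ℝ (gradQ H (Q, 0)) v.2 = 0 →
        ∀ π, H (q (t, Q)) π = H (q (t, Q)) (p (t, Q)) → fderiv ℝ q (t, Q) v = gradP H (q (t, Q), π) →
        inner ℝ (p (t, Q)) (fderiv ℝ q (t, Q) v) = 0 →
        0 < inner ℝ (fderiv ℝ p (t, Q) v) (fderiv ℝ q (t, Q) v) +
          inner ℝ (p (t, Q)) (fderiv ℝ (gradP H) (q (t, Q), π)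
            (fderiv ℝ q (t, Q) v, -gradQ H (q (t, Q), π))) := by
    refine hΓ.eventually_forall_of_forall_eventually fun Q hQ => ?_
    filter_upwards [(hF.tendsto_q hH hT (hΓr hQ)).eventually (hWo.mem_nhds (hΓW hQ)),
      hF.eventually_momentum_ne_zero hT (hΓr hQ) (hg Q hQ),
      hF.eventually_injective hH hT (hΓr hQ) (hg Q hQ),
      hF.eventually_hessian_pos hH hT (hΓr hQ) (hg Q hQ)] with w e1 e2 e3 e4 ht
    exact ⟨e1, e2 ht, e3 ht, e4 ht⟩
  have h3 : Tendsto (fun t : ℝ => t ^ 2) (𝓝 0) (𝓝 0) := by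
    have : Continuous fun t : ℝ => t ^ 2 := by fun_prop
    simpa using this.tendsto 0
  obtain ⟨ε, hε, hball⟩ := Metric.eventually_nhds_iff.1 (h2.and (h3.eventually h1))
  have hs : 0 < min ε T / 2 := by positivity
  have hsε : ∀ t ∈ Ioc 0 (min ε T / 2), dist t 0 < ε := fun t ht => by
    rw [Real.dist_0_eq_abs, abs_of_pos ht.1]
    linarith [ht.2, min_le_left ε T]
  have hsT : min ε T / 2 < T := by linarith [min_le_right ε T]
  refine ⟨r, T, min ε T / 2, q, p, z, hF, hs, hsT, hΓr, ?_, ?_, ?_, ?_, ?_, ?_⟩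
  · rintro ⟨t, Q⟩ ⟨ht, hQ⟩ ⟨t', R⟩ ⟨ht', hR⟩ h
    have e1 : ((t ^ 2, Q) : ℝ × Eucl n) = (t' ^ 2, R) := by
      refine hinj ((hball (hsε t ht)).2 Q hQ) ((hball (hsε t' ht')).2 R hR) ?_
      simp only [oddSquare_of_nonneg q (sq_nonneg _), Real.sqrt_sq ht.1.le, Real.sqrt_sq ht'.1.le, h,
        hE Q hQ, hE R hR]
    obtain ⟨e2, e3⟩ := Prod.ext_iff.1 e1
    exact Prod.ext ((pow_left_inj₀ ht.1.le ht'.1.le two_ne_zero).1 e2) e3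
  · rintro ⟨t, Q⟩ ⟨ht, hQ⟩
    obtain ⟨e1, e2, -⟩ := (hball (hsε t ht)).1 Q hQ ht.1
    refine (hW _ e1).1.1 ?_
    have e3 := hF.energy t ⟨by linarith [ht.1], by linarith [ht.2]⟩ Q (hΓr hQ)
    have e4 := hH.kinetic_ge (q (t, Q)) (p (t, Q))
    have e5 : 0 < hH.modulus (q (t, Q)) / 2 * ‖p (t, Q)‖ ^ 2 :=
      mul_pos (half_pos (hH.modulus_pos _)) (pow_pos (norm_pos_iff.2 e2) 2)
    have e6 := hE Q hQ
    rw [potentialEnergy] at e6 ⊢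
    linarith
  · rintro ⟨t, Q⟩ ⟨ht, hQ⟩
    exact ((hball (hsε t ht)).1 Q hQ ht.1).2.1
  · rintro ⟨t, Q⟩ ⟨ht, hQ⟩
    exact ((hball (hsε t ht)).1 Q hQ ht.1).2.2.1
  · rintro ⟨t, Q⟩ ⟨ht, hQ⟩
    exact ((hball (hsε t ht)).1 Q hQ ht.1).2.2.2
  · intro Q hQ N hN
    have hWn : Prod.snd ⁻¹' W ∈ 𝓝 ((0 : ℝ), Q) :=
      continuous_snd.continuousAt.preimage_mem_nhds (hWo.mem_nhds (hΓW hQ))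
    filter_upwards [hF.eventually_exists_trajectory hH hT (hΓr hQ) (hg Q hQ) (inter_mem hN hWn)]
      with y hy hyD
    rw [hE Q hQ] at hy
    obtain ⟨w, ⟨hwN, hwW⟩, hw0, hwE, hwy⟩ := hy (hD.lt_on y hyD)
    exact ⟨w, hwN, hw0, (hW _ hwW).2 hwE, hwy⟩

end Collar

section Calibration

/-- A collar `K` of `∂D` in `D` with a solution `S` of the Hamilton-Jacobi equation `H(y, dS) = E`
that vanishes on `∂D` and whose fronts are strongly concave; `P` is the gradient of `S`. -/
structure IsCalibratedCollar {n : ℕ} (H : Eucl n → Eucl n → ℝ) (E : ℝ) (D : Set (Eucl n)) (σ : ℝ)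
    (K : Set (Eucl n)) (S : Eucl n → ℝ) (P : Eucl n → Eucl n) : Prop where
  pos : 0 < σ
  isOpen : IsOpen K
  subset : K ⊆ D
  contDiffAt : ∀ y ∈ K, ContDiffAt ℝ 1 P y
  hasFDerivAt : ∀ y ∈ K, HasFDerivAt S (innerSL ℝ (P y)) y
  energy : ∀ y ∈ K, H y (P y) = E
  pos_of_mem : ∀ y ∈ K, 0 < S y
  lt_of_mem : ∀ y ∈ K, S y < σ
  eventually_mem : ∀ Q ∈ frontier D, ∀ ε > 0, ∀ᶠ y in 𝓝 Q, y ∈ D → y ∈ K ∧ S y < ε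
  mem_of_mem_closure : ∀ s < σ, ∀ y ∈ D, y ∈ closure {x ∈ K | S x ≤ s} → y ∈ K
  hessian_pos : ∀ y ∈ K, ∀ π, H y π = E → inner ℝ (P y) (gradP H (y, π)) = 0 →
    0 < inner ℝ (fderiv ℝ P y (gradP H (y, π))) (gradP H (y, π)) +
      inner ℝ (P y) (fderiv ℝ (gradP H) (y, π) (gradP H (y, π), -gradQ H (y, π)))

variable {n : ℕ} {H : Eucl n → Eucl n → ℝ} {E : ℝ} {D : Set (Eucl n)} {r T s : ℝ}
  {q p : ℝ × Eucl n → Eucl n} {z : ℝ × Eucl n → ℝ}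

namespace IsBrakeCollar

variable (hH : IsClassicalHamiltonian H) (hD : IsPotentialWell H E D)
  (hC : IsBrakeCollar H E D r T s q p z)

include hC

theorem mem_Ioo {t : ℝ} (ht : t ∈ Icc 0 s) : t ∈ Ioo (-T) T :=
  ⟨by linarith [ht.1, hC.pos, hC.lt], lt_of_le_of_lt ht.2 hC.lt⟩

theorem subset_domain : Icc 0 s ×ˢ frontier D ⊆ Ioo (-T) T ×ˢ Metric.ball 0 r :=
  prod_mono (fun _ ht => hC.mem_Ioo ht) hC.frontier_subset

include hH in
theorem strictMonoOn_action {Q : Eucl n} (hQ : Q ∈ frontier D) :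
    StrictMonoOn (fun t => z (t, Q)) (Icc 0 s) := by
  have hd : ∀ t ∈ Icc 0 s, HasDerivAt (fun t => z (t, Q))
      (inner ℝ (gradP H (q (t, Q), p (t, Q))) (p (t, Q))) t := fun t ht =>
    hC.flow.deriv_z t (hC.mem_Ioo ht) Q (hC.frontier_subset hQ)
  refine strictMonoOn_of_deriv_pos (convex_Icc 0 s)
    (fun t ht => (hd t ht).continuousAt.continuousWithinAt) fun t ht => ?_
  rw [interior_Icc] at ht
  rw [(hd t (Ioo_subset_Icc_self ht)).deriv]
  exact hH.inner_gradP_self_pos _ (hC.momentum_ne_zero (t, Q) ⟨Ioo_subset_Ioc_self ht, hQ⟩)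

include hH hD in
/-- The collar coordinates are of class `C¹`. -/
theorem exists_inverse : ∃ g : Eucl n → ℝ × Eucl n, (∀ w ∈ Ioc 0 s ×ˢ frontier D, g (q w) = w) ∧
    ∀ w ∈ Ioo 0 s ×ˢ frontier D, ContDiffAt ℝ 1 g (q w) ∧
      ∀ᶠ y in 𝓝 (q w), g y ∈ Ioo 0 s ×ˢ frontier D ∧ q (g y) = y := by
  have hleft : ∀ w ∈ Ioc 0 s ×ˢ frontier D, Function.invFunOn q (Ioc 0 s ×ˢ frontier D) (q w) = w :=
    fun w hw => hC.injOn.leftInvOn_invFunOn hw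
  refine ⟨Function.invFunOn q (Ioc 0 s ×ˢ frontier D), hleft, fun w hw => ?_⟩
  obtain ⟨W, hWo, hΓW, hW⟩ := hD.exists_nhds_boundary hH
  have hw' : w ∈ Ioc 0 s ×ˢ frontier D := ⟨Ioo_subset_Ioc_self hw.1, hw.2⟩
  obtain ⟨g, hg0, hg1, hg⟩ := hC.flow.exists_local_inverse hH (hC.mem_Ioo (Ioo_subset_Icc_self hw.1))
    (hC.frontier_subset hw.2) (hC.injective w hw')
  have hmem : ∀ᶠ y in 𝓝 (q w), g y ∈ Ioo 0 s ×ˢ W := by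
    refine hg1.continuousAt.eventually ((isOpen_Ioo.prod hWo).mem_nhds ?_)
    rw [hg0]
    exact ⟨hw.1, hΓW hw.2⟩
  have hgood : ∀ᶠ y in 𝓝 (q w), g y ∈ Ioo 0 s ×ˢ frontier D ∧ q (g y) = y := by
    filter_upwards [hg, hmem] with y h1 h2
    exact ⟨⟨h2.1, (hW _ h2.2).2 (h1.1.trans (hD.eq_on _ hw.2))⟩, h1.2⟩
  have heq : Function.invFunOn q (Ioc 0 s ×ˢ frontier D) =ᶠ[𝓝 (q w)] g := by
    filter_upwards [hgood] with y hy
    conv_lhs => rw [← hy.2]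
    exact hleft _ ⟨Ioo_subset_Ioc_self hy.1.1, hy.1.2⟩
  refine ⟨hg1.congr_of_eventuallyEq heq, ?_⟩
  filter_upwards [hgood, heq] with y h1 h2
  rwa [h2]

include hH hD in
theorem fderiv_inverse {g : Eucl n → ℝ × Eucl n} {w : ℝ × Eucl n} (hw : w ∈ Ioo 0 s ×ˢ frontier D)
    (hgw : g (q w) = w) (hg1 : ContDiffAt ℝ 1 g (q w))
    (hg2 : ∀ᶠ y in 𝓝 (q w), g y ∈ Ioo 0 s ×ˢ frontier D ∧ q (g y) = y) (η : Eucl n) :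
    fderiv ℝ q w (fderiv ℝ g (q w) η) = η ∧
      inner ℝ (gradQ H (w.2, 0)) (fderiv ℝ g (q w) η).2 = 0 := by
  have hgd := (hg1.differentiableAt one_ne_zero).hasFDerivAt
  have hqd : HasFDerivAt q (fderiv ℝ q w) (g (q w)) := by
    rw [hgw]
    exact ((hC.flow.contDiffAt_q (hC.mem_Ioo (Ioo_subset_Icc_self hw.1))
      (hC.frontier_subset hw.2)).differentiableAt one_ne_zero).hasFDerivAt
  have h1 : (fderiv ℝ q w).comp (fderiv ℝ g (q w)) = ContinuousLinearMap.id ℝ (Eucl n) := by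
    refine (HasFDerivAt.comp (g := q) (f := g) (q w) hqd hgd).unique
      ((hasFDerivAt_id (q w)).congr_of_eventuallyEq ?_)
    filter_upwards [hg2] with y hy using hy.2
  have h2 := (HasFDerivAt.comp (g := potentialEnergy H) (f := fun y => (g y).2) (q w)
    (hH.hasFDerivAt_potentialEnergy (g (q w)).2) hgd.snd).unique
      ((hasFDerivAt_const E (q w)).congr_of_eventuallyEq (by
        filter_upwards [hg2] with y hy using hD.eq_on _ hy.1.2))
  rw [hgw] at h2
  exact ⟨congrArg (fun L => L η) h1, congrArg (fun L => L η) h2⟩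

include hH hD in
theorem exists_calibratedCollar (hcpt : IsCompact (closure D)) (hne : (frontier D).Nonempty) :
    ∃ (σ : ℝ) (K : Set (Eucl n)) (S : Eucl n → ℝ) (P : Eucl n → Eucl n),
      IsCalibratedCollar H E D σ K S P ∧
      ∀ y ∈ K, ∃ w ∈ Ioo 0 s ×ˢ frontier D, q w = y ∧ z w = S y := by
  have hΓ : IsCompact (frontier D) := hcpt.of_isClosed_subset isClosed_frontier frontier_subset_closure
  obtain ⟨g, hgl, hg⟩ := hC.exists_inverse hH hD
  have hzc : ContinuousOn z (Icc 0 s ×ˢ frontier D) :=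
    hC.flow.contDiffOn_z.continuousOn.mono hC.subset_domain
  have hqc : ContinuousOn q (Icc 0 s ×ˢ frontier D) :=
    hC.flow.contDiffOn_q.continuousOn.mono hC.subset_domain
  have hs0 : (0 : ℝ) ∈ Icc 0 s := ⟨le_rfl, hC.pos.le⟩
  have hss : s ∈ Icc 0 s := ⟨hC.pos.le, le_rfl⟩
  obtain ⟨R, hR, hRmin⟩ := hΓ.exists_isMinOn hne (f := fun Q => z (s, Q))
    (hzc.comp (by fun_prop) fun Q hQ => ⟨hss, hQ⟩)
  have hzpos : ∀ t ∈ Ioc 0 s, ∀ Q ∈ frontier D, 0 < z (t, Q) := fun t ht Q hQ => by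
    rw [← hC.flow.z_zero Q (hC.frontier_subset hQ)]
    exact hC.strictMonoOn_action hH hQ hs0 (Ioc_subset_Icc_self ht) ht.1
  have htop : ∀ w ∈ Ioc 0 s ×ˢ frontier D, z w < z (s, R) → w ∈ Ioo 0 s ×ˢ frontier D := by
    rintro ⟨t, Q⟩ ⟨ht, hQ⟩ hlt
    refine ⟨⟨ht.1, ht.2.lt_of_ne ?_⟩, hQ⟩
    intro (h : t = s)
    rw [h] at hlt
    exact absurd (hRmin hQ) (not_le.2 hlt)
  set K := q '' {w | w ∈ Ioo 0 s ×ˢ frontier D ∧ z w < z (s, R)} with hK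
  have hIoc : ∀ {w}, w ∈ Ioo 0 s ×ˢ frontier D → w ∈ Ioc 0 s ×ˢ frontier D := fun hw =>
    ⟨Ioo_subset_Ioc_self hw.1, hw.2⟩
  have hdom : ∀ {w}, w ∈ Ioo 0 s ×ˢ frontier D → w.1 ∈ Ioo (-T) T ∧ w.2 ∈ Metric.ball 0 r := fun hw =>
    ⟨hC.mem_Ioo (Ioo_subset_Icc_self hw.1), hC.frontier_subset hw.2⟩
  refine ⟨z (s, R), K, z ∘ g, p ∘ g, ⟨hzpos s ⟨hC.pos, le_rfl⟩ R hR, ?_, ?_, ?_, ?_, ?_, ?_, ?_, ?_, ?_,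
    ?_⟩, ?_⟩
  · refine isOpen_iff_mem_nhds.2 ?_
    rintro _ ⟨w, ⟨hw, hzw⟩, rfl⟩
    obtain ⟨h1, h2⟩ := hg w hw
    have h3 : ∀ᶠ y in 𝓝 (q w), z (g y) < z (s, R) := by
      have h4 : ContinuousAt z (g (q w)) := by
        rw [hgl w (hIoc hw)]
        exact (hC.flow.contDiffAt_z (hdom hw).1 (hdom hw).2).continuousAt
      refine (ContinuousAt.comp (g := z) h4 h1.continuousAt).eventually (gt_mem_nhds ?_)
      rwa [Function.comp_apply, hgl w (hIoc hw)]
    filter_upwards [h2, h3] with y h5 h6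
    exact ⟨g y, ⟨h5.1, h6⟩, h5.2⟩
  · rintro _ ⟨w, ⟨hw, -⟩, rfl⟩
    exact hC.mem w (hIoc hw)
  · rintro _ ⟨w, ⟨hw, -⟩, rfl⟩
    refine ContDiffAt.comp (g := p) (f := g) (q w) ?_ (hg w hw).1
    rw [hgl w (hIoc hw)]
    exact hC.flow.contDiffAt_p (hdom hw).1 (hdom hw).2
  · rintro _ ⟨w, ⟨hw, -⟩, rfl⟩
    obtain ⟨h1, h2⟩ := hg w hw
    have hgd := (h1.differentiableAt one_ne_zero).hasFDerivAt
    have hzd : HasFDerivAt z (fderiv ℝ z w) (g (q w)) := by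
      rw [hgl w (hIoc hw)]
      exact ((hC.flow.contDiffAt_z (hdom hw).1 (hdom hw).2).differentiableAt one_ne_zero).hasFDerivAt
    refine HasFDerivAt.congr_fderiv (f := z ∘ g) (HasFDerivAt.comp (g := z) (f := g) (q w) hzd hgd) ?_
    refine ContinuousLinearMap.ext fun η => ?_
    obtain ⟨h5, h4⟩ := hC.fderiv_inverse hH hD hw (hgl w (hIoc hw)) h1 h2 η
    have h6 := hC.flow.action w.1 (hdom hw).1 w.2 (hdom hw).2 (fderiv ℝ g (q w) η)
    rw [ContinuousLinearMap.comp_apply, innerSL_apply_apply, Function.comp_apply, hgl w (hIoc hw)]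
    rw [h6, h4, mul_zero, add_zero]
    rw [Prod.mk.eta, h5]
  · rintro _ ⟨w, ⟨hw, -⟩, rfl⟩
    rw [Function.comp_apply, hgl w (hIoc hw)]
    exact (hC.flow.energy w.1 (hdom hw).1 w.2 (hdom hw).2).trans (hD.eq_on _ hw.2)
  · rintro _ ⟨w, ⟨hw, -⟩, rfl⟩
    rw [Function.comp_apply, hgl w (hIoc hw)]
    exact hzpos w.1 (Ioo_subset_Ioc_self hw.1) w.2 hw.2
  · rintro _ ⟨w, ⟨hw, hlt⟩, rfl⟩
    rwa [Function.comp_apply, hgl w (hIoc hw)]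
  · intro Q hQ ε hε
    have hQ0 := hC.frontier_subset hQ
    have hz0 : ∀ᶠ w in 𝓝 ((0 : ℝ), Q), z w < min ε (z (s, R)) := by
      have h1 := (hC.flow.contDiffAt_z (w := (0, Q)) (hC.mem_Ioo hs0) hQ0).continuousAt
      refine h1.eventually (gt_mem_nhds ?_)
      rw [hC.flow.z_zero Q hQ0]
      exact lt_min hε (hzpos s ⟨hC.pos, le_rfl⟩ R hR)
    have ht0 : ∀ᶠ w in 𝓝 ((0 : ℝ), Q), w.1 < s :=
      continuous_fst.continuousAt.eventually (gt_mem_nhds hC.pos)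
    filter_upwards [hC.exists_trajectory Q hQ _ (hz0.and ht0)] with y hy hyD
    obtain ⟨w, ⟨hw1, hw2⟩, hw3, hw4, rfl⟩ := hy hyD
    have hw : w ∈ Ioo 0 s ×ˢ frontier D := ⟨⟨hw3, hw2⟩, hw4⟩
    refine ⟨⟨w, ⟨hw, hw1.trans_le (min_le_right _ _)⟩, rfl⟩, ?_⟩
    rw [Function.comp_apply, hgl w (hIoc hw)]
    exact hw1.trans_le (min_le_left _ _)
  · intro σ hσ y hy hcl
    set C := Icc 0 s ×ˢ frontier D ∩ z ⁻¹' Iic σ with hCdef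
    have hCc : IsCompact C := by
      have h1 : IsCompact (Icc 0 s ×ˢ frontier D) := isCompact_Icc.prod hΓ
      exact h1.of_isClosed_subset (hzc.preimage_isClosed_of_isClosed h1.isClosed isClosed_Iic)
        inter_subset_left
    have h2 : IsClosed (q '' C) := (hCc.image_of_continuousOn (hqc.mono inter_subset_left)).isClosed
    have h3 : {x ∈ K | (z ∘ g) x ≤ σ} ⊆ q '' C := by
      rintro _ ⟨⟨w, ⟨hw, -⟩, rfl⟩, hle⟩
      rw [Function.comp_apply, hgl w (hIoc hw)] at hle
      exact ⟨w, ⟨⟨Ioo_subset_Icc_self hw.1, hw.2⟩, hle⟩, rfl⟩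
    obtain ⟨⟨t, Q⟩, ⟨⟨ht, hQ⟩, hle⟩, rfl⟩ := closure_minimal h3 h2 hcl
    have ht0 : t ≠ 0 := by
      rintro rfl
      rw [hC.flow.q_zero Q (hC.frontier_subset hQ)] at hy
      exact (hD.isOpen.frontier_eq ▸ hQ).2 hy
    have hlt : z (t, Q) < z (s, R) := lt_of_le_of_lt hle hσ
    exact ⟨(t, Q), ⟨htop (t, Q) ⟨⟨ht.1.lt_of_ne' ht0, ht.2⟩, hQ⟩ hlt, hlt⟩, rfl⟩
  · rintro _ ⟨w, ⟨hw, -⟩, rfl⟩ π hπ hpu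
    obtain ⟨h1, h2⟩ := hg w hw
    have hgd := (h1.differentiableAt one_ne_zero).hasFDerivAt
    have hpd : HasFDerivAt p (fderiv ℝ p w) (g (q w)) := by
      rw [hgl w (hIoc hw)]
      exact ((hC.flow.contDiffAt_p (hdom hw).1 (hdom hw).2).differentiableAt one_ne_zero).hasFDerivAt
    rw [(HasFDerivAt.comp (g := p) (f := g) (q w) hpd hgd).fderiv]
    set u := gradP H (q w, π) with hu
    obtain ⟨h5, h4⟩ := hC.fderiv_inverse hH hD hw (hgl w (hIoc hw)) h1 h2 u
    have hen : H (q w) (p w) = E :=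
      (hC.flow.energy w.1 (hdom hw).1 w.2 (hdom hw).2).trans (hD.eq_on _ hw.2)
    rw [Function.comp_apply, hgl w (hIoc hw)] at hpu ⊢
    have h6 := hC.hessian_pos w (hIoc hw) (fderiv ℝ g (q w) u) h4 π (hπ.trans hen.symm) h5
      (by rwa [h5])
    rw [h5] at h6
    exact h6
  · rintro _ ⟨w, ⟨hw, -⟩, rfl⟩
    exact ⟨w, hw, rfl, by rw [Function.comp_apply, hgl w (hIoc hw)]⟩

end IsBrakeCollar

end Calibration

section AbsolutelyContinuous

theorem AbsolutelyContinuousOnInterval.lipschitzOnWith_comp {X Y : Type*} [PseudoMetricSpace X]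
    [PseudoMetricSpace Y] {γ : ℝ → X} {f : X → Y} {a b : ℝ} {C : NNReal}
    (hγ : AbsolutelyContinuousOnInterval γ a b) (hf : LipschitzOnWith C f (γ '' uIcc a b)) :
    AbsolutelyContinuousOnInterval (f ∘ γ) a b := by
  rw [absolutelyContinuousOnInterval_iff] at hγ ⊢
  intro ε hε
  obtain ⟨δ, hδ, h⟩ := hγ (ε / (C + 1)) (by positivity)
  refine ⟨δ, hδ, fun I hI hIδ => ?_⟩
  calc ∑ i ∈ Finset.range I.1, dist ((f ∘ γ) (I.2 i).1) ((f ∘ γ) (I.2 i).2)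
      ≤ ∑ i ∈ Finset.range I.1, C * dist (γ (I.2 i).1) (γ (I.2 i).2) :=
        Finset.sum_le_sum fun i hi => hf.dist_le_mul _ (mem_image_of_mem γ (hI.1 i hi).1) _
          (mem_image_of_mem γ (hI.1 i hi).2)
    _ = C * ∑ i ∈ Finset.range I.1, dist (γ (I.2 i).1) (γ (I.2 i).2) := by rw [Finset.mul_sum]
    _ ≤ C * (ε / (C + 1)) := by gcongr; exact (h I hI hIδ).le
    _ < ε := by
        rw [← mul_div_assoc, div_lt_iff₀ (by positivity)]
        linarith

theorem AbsolutelyContinuousOnInterval.ae_differentiableAt_Ioo {V : Type*} [NormedAddCommGroup V]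
    [NormedSpace ℝ V] [FiniteDimensional ℝ V] {γ : ℝ → V} {a b : ℝ} (hab : a ≤ b)
    (hγ : AbsolutelyContinuousOnInterval γ a b) :
    ∀ᵐ t, t ∈ Ioo a b → DifferentiableAt ℝ γ t := by
  filter_upwards [hγ.boundedVariationOn.locallyBoundedVariationOn.ae_differentiableWithinAt_of_mem]
    with t ht htm
  rw [uIcc_of_le hab] at ht
  exact (ht (Ioo_subset_Icc_self htm)).differentiableAt (Icc_mem_nhds htm.1 htm.2)

/-- The fundamental theorem of calculus for a `C¹` function along an absolutely continuous curve. -/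
theorem AbsolutelyContinuousOnInterval.integral_fderiv_comp {V : Type*} [NormedAddCommGroup V]
    [NormedSpace ℝ V] [FiniteDimensional ℝ V] {γ : ℝ → V} {a b : ℝ} (hab : a ≤ b)
    (hγ : AbsolutelyContinuousOnInterval γ a b) {f : V → ℝ}
    (hf : ∀ t ∈ Icc a b, ContDiffAt ℝ 1 f (γ t)) :
    IntervalIntegrable (fun t => fderiv ℝ f (γ t) (deriv γ t)) volume a b ∧
      ∫ t in a..b, fderiv ℝ f (γ t) (deriv γ t) = f (γ b) - f (γ a) := by
  have hK : IsCompact (γ '' uIcc a b) := isCompact_uIcc.image_of_continuousOn hγ.continuousOn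
  have hL : LocallyLipschitzOn (γ '' uIcc a b) f := by
    rintro _ ⟨t, ht, rfl⟩
    rw [uIcc_of_le hab] at ht
    obtain ⟨C, U, hU, hC⟩ := (hf t ht).exists_lipschitzOnWith
    exact ⟨C, U, mem_nhdsWithin_of_mem_nhds hU, hC⟩
  obtain ⟨C, hC⟩ := hL.exists_lipschitzOnWith_of_compact hK
  have hac := hγ.lipschitzOnWith_comp hC
  have hae : ∀ᵐ t, t ∈ Ioo a b → deriv (f ∘ γ) t = fderiv ℝ f (γ t) (deriv γ t) := by
    filter_upwards [hγ.ae_differentiableAt_Ioo hab] with t ht htm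
    exact (((hf t (Ioo_subset_Icc_self htm)).differentiableAt one_ne_zero).hasFDerivAt.comp_hasDerivAt
      t (ht htm).hasDerivAt).deriv
  have hb : ∀ᵐ t : ℝ, t ≠ b := by simp [ae_iff, measure_singleton]
  have hae2 : ∀ᵐ t, t ∈ uIoc a b → deriv (f ∘ γ) t = fderiv ℝ f (γ t) (deriv γ t) := by
    filter_upwards [hae, hb] with t h1 h2 h3
    rw [uIoc_of_le hab] at h3
    exact h1 ⟨h3.1, h3.2.lt_of_ne h2⟩
  refine ⟨hac.intervalIntegrable_deriv.congr_ae ((ae_restrict_iff' measurableSet_uIoc).2 hae2), ?_⟩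
  rw [← intervalIntegral.integral_congr_ae hae2]
  exact hac.integral_deriv_eq_sub

end AbsolutelyContinuous

section Energy

variable {n : ℕ} {H : Eucl n → Eucl n → ℝ} {E : ℝ} {D : Set (Eucl n)} {y : Eucl n} {γ : ℝ → Eucl n}
  (hH : IsClassicalHamiltonian H) (hD : IsPotentialWell H E D) (hcpt : IsCompact (closure D))

theorem IsPotentialWell.apply_zero_lt (hD : IsPotentialWell H E D) {q : Eucl n} (hq : q ∈ D) :
    H q 0 < E := hD.lt_on q hq

include hH hD hcpt

theorem IsPotentialWell.exists_jacobiG_le :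
    ∃ C : ℝ, ∀ q ∈ D, ∀ v, jacobiG H E q v ≤ C * ‖v‖ ^ 2 := by
  have hc : Continuous fun q => 2 * (E - H q 0) / hH.modulus q :=
    ((continuous_const.sub hH.contDiff_potentialEnergy.continuous).const_mul 2).div
      hH.continuous_modulus fun q => (hH.modulus_pos q).ne'
  obtain ⟨C, hC⟩ := hcpt.exists_bound_of_continuousOn hc.continuousOn
  refine ⟨√C ^ 2 / 4, fun q hq v => hH.jacobiG_le (hD.apply_zero_lt hq) (fun c hcE => ?_) v⟩
  refine Real.le_sqrt_of_sq_le ?_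
  have h1 := (le_abs_self _).trans (hC q (subset_closure hq))
  have h2 := hH.kinetic_ge q c
  have hm := hH.modulus_pos q
  refine le_trans ?_ h1
  rw [le_div_iff₀ hm]
  linarith

theorem IsPotentialWell.continuousOn_jacobiG :
    ContinuousOn (fun x : Eucl n × Eucl n => jacobiG H E x.1 x.2) (D ×ˢ univ) := by
  rintro ⟨q, v⟩ ⟨hq, -⟩
  refine ContinuousAt.continuousWithinAt ?_
  have hn : ∀ᶠ x : Eucl n × Eucl n in 𝓝 (q, v), x.1 ∈ D :=
    continuous_fst.continuousAt.eventually (hD.isOpen.mem_nhds hq)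
  rcases eq_or_ne v 0 with rfl | hv
  · obtain ⟨C, hC⟩ := hD.exists_jacobiG_le hH hcpt
    have h0 : jacobiG H E q 0 = 0 := le_antisymm (by simpa using hC q hq 0)
      (hH.jacobiG_nonneg (hD.apply_zero_lt hq) 0)
    have h1 : Tendsto (fun x : Eucl n × Eucl n => C * ‖x.2‖ ^ 2) (𝓝 (q, 0)) (𝓝 0) := by
      have : Continuous fun x : Eucl n × Eucl n => C * ‖x.2‖ ^ 2 := by fun_prop
      simpa using this.tendsto (q, 0)
    rw [ContinuousAt, h0]
    refine squeeze_zero' ?_ ?_ h1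
    · filter_upwards [hn] with x hx using hH.jacobiG_nonneg (hD.apply_zero_lt hx) _
    · filter_upwards [hn] with x hx using hC x.1 hx _
  · obtain ⟨p, μ, hm⟩ := hH.exists_isMomentum (hD.apply_zero_lt hq) hv
    refine (hH.hasFDerivAt_jacobiF_sq (hD.apply_zero_lt hq) hm).continuousAt.congr ?_
    filter_upwards [hn] with x hx using hH.jacobiF_sq (hD.apply_zero_lt hx) _

theorem IsAdmissibleCurve.integrableOn (hγ : IsAdmissibleCurve D y γ) :
    IntegrableOn (fun s => jacobiG H E (γ s) (deriv γ s)) (Icc 0 1) := by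
  obtain ⟨C, hC⟩ := hD.exists_jacobiG_le hH hcpt
  have hae : ∀ᵐ s ∂(volume.restrict (Icc (0 : ℝ) 1)), γ s ∈ D := by
    rw [ae_restrict_iff' measurableSet_Icc]
    have hb : ∀ᵐ t : ℝ, t ≠ 1 := by simp [ae_iff, measure_singleton]
    filter_upwards [hb] with s hs hs1 using hγ.inside s ⟨hs1.1, hs1.2.lt_of_ne hs⟩
  have hm : AEMeasurable (fun s => (γ s, deriv γ s)) (volume.restrict (Icc (0 : ℝ) 1)) := by
    have h1 := hγ.absCont.continuousOn
    rw [uIcc_of_le zero_le_one] at h1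
    exact (h1.aemeasurable measurableSet_Icc).prodMk (measurable_deriv γ).aemeasurable
  classical
  have hG : Measurable ((D ×ˢ (univ : Set (Eucl n))).piecewise
      (fun x : Eucl n × Eucl n => jacobiG H E x.1 x.2) fun _ => 0) :=
    (hD.continuousOn_jacobiG hH hcpt).measurable_piecewise continuousOn_const
      (hD.isOpen.measurableSet.prod MeasurableSet.univ)
  have hmG : AEStronglyMeasurable (fun s => jacobiG H E (γ s) (deriv γ s))
      (volume.restrict (Icc (0 : ℝ) 1)) := by
    refine ((hG.comp_aemeasurable hm).congr ?_).aestronglyMeasurable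
    filter_upwards [hae] with s hs
    exact piecewise_eq_of_mem _ _ _ ⟨hs, mem_univ _⟩
  refine ((hγ.deriv_memLp.integrable_norm_pow two_ne_zero).const_mul C).mono' hmG ?_
  filter_upwards [hae] with s hs
  rw [Real.norm_of_nonneg (hH.jacobiG_nonneg (hD.apply_zero_lt hs) _)]
  exact hC _ hs _

omit hcpt in
theorem IsAdmissibleCurve.jacobiG_nonneg_ae (hγ : IsAdmissibleCurve D y γ) :
    ∀ᵐ s ∂(volume.restrict (Ioc (0 : ℝ) 1)), 0 ≤ jacobiG H E (γ s) (deriv γ s) := by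
  rw [ae_restrict_iff' measurableSet_Ioc]
  have hb : ∀ᵐ t : ℝ, t ≠ 1 := by simp [ae_iff, measure_singleton]
  filter_upwards [hb] with s hs hs1
  exact hH.jacobiG_nonneg (hD.apply_zero_lt (hγ.inside s ⟨hs1.1.le, hs1.2.lt_of_ne hs⟩)) _

omit hcpt in
theorem IsAdmissibleCurve.jacobiEnergy_nonneg (hγ : IsAdmissibleCurve D y γ) :
    0 ≤ jacobiEnergy H E γ := by
  rw [jacobiEnergy, intervalIntegral.integral_of_le zero_le_one]
  exact integral_nonneg_of_ae (hγ.jacobiG_nonneg_ae hH hD)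

omit hcpt in
theorem IsPotentialWell.bddBelow_jacobiEnergy (y : Eucl n) :
    BddBelow (jacobiEnergy H E '' {γ | IsAdmissibleCurve D y γ}) :=
  ⟨0, by rintro _ ⟨γ, hγ, rfl⟩; exact hγ.jacobiEnergy_nonneg hH hD⟩

end Energy

section LowerBound

variable {n : ℕ} {H : Eucl n → Eucl n → ℝ} {E σ : ℝ} {D K : Set (Eucl n)} {S : Eucl n → ℝ}
  {P : Eucl n → Eucl n} {y : Eucl n} {γ : ℝ → Eucl n}

namespace IsCalibratedCollar

theorem contDiffAt_action (hK : IsCalibratedCollar H E D σ K S P) (hy : y ∈ K) : ContDiffAt ℝ 2 S y := by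
  rw [show (2 : WithTop ℕ∞) = ((1 : ℕ) : WithTop ℕ∞) + 1 by norm_num, contDiffAt_succ_iff_hasFDerivAt]
  exact ⟨fun x => innerSL ℝ (P x), ⟨K, hK.isOpen.mem_nhds hy, hK.hasFDerivAt⟩,
    (innerSL ℝ (E := Eucl n)).contDiff.contDiffAt.comp y (by exact_mod_cast hK.contDiffAt y hy)⟩

theorem isOpen_sublevel (hK : IsCalibratedCollar H E D σ K S P) (s : ℝ) : IsOpen {x ∈ K | S x < s} :=
  ContinuousOn.isOpen_inter_preimage
    (fun y hy => (hK.hasFDerivAt y hy).continuousAt.continuousWithinAt) hK.isOpen isOpen_Iio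

variable (hH : IsClassicalHamiltonian H) (hD : IsPotentialWell H E D) (hcpt : IsCompact (closure D))
  (hK : IsCalibratedCollar H E D σ K S P) (hγ : IsAdmissibleCurve D y γ)

include hK hγ

theorem eventually_mem_curve {ε : ℝ} (hε : 0 < ε) :
    ∃ δ > 0, ∀ t ∈ Ico 0 1, 1 - δ < t → γ t ∈ K ∧ S (γ t) < ε := by
  have hc : ContinuousWithinAt γ (Icc 0 1) 1 := by
    have := hγ.absCont.continuousOn
    rw [uIcc_of_le zero_le_one] at this
    exact this 1 ⟨zero_le_one, le_rfl⟩
  obtain ⟨δ, hδ, h⟩ := Metric.eventually_nhds_iff.1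
    (eventually_nhdsWithin_iff.1 (hc.eventually (hK.eventually_mem _ hγ.finish ε hε)))
  refine ⟨δ, hδ, fun t ht htδ => h ?_ (Ico_subset_Icc_self ht) (hγ.inside t ht)⟩
  rw [Real.dist_eq, abs_sub_lt_iff]
  constructor <;> linarith [ht.2]

/-- The last exit of an admissible curve from the set where the action is at least `s`. -/
theorem exists_lastExit {s : ℝ} (hs : 0 < s) (hsσ : s < σ) (hy : y ∈ K → s ≤ S y) :
    ∃ τ ∈ Ico (0 : ℝ) 1, s ≤ S (γ τ) ∧ ∀ t ∈ Ico τ 1, γ t ∈ K := by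
  have hcont : ContinuousOn γ (Icc 0 1) := by
    have := hγ.absCont.continuousOn
    rwa [uIcc_of_le zero_le_one] at this
  set A := {t ∈ Ico (0 : ℝ) 1 | γ t ∈ K → s ≤ S (γ t)} with hA
  have hA0 : (0 : ℝ) ∈ A := ⟨⟨le_rfl, one_pos⟩, by rwa [hγ.start]⟩
  obtain ⟨δ, hδ, hend⟩ := hK.eventually_mem_curve hγ hs
  have hAub : ∀ t ∈ A, t ≤ 1 - δ := fun t ht => by
    by_contra hlt
    obtain ⟨h1, h2⟩ := hend t ht.1 (not_le.1 hlt)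
    exact absurd (ht.2 h1) (not_le.2 h2)
  have hbdd : BddAbove A := ⟨1 - δ, hAub⟩
  have hτ0 : 0 ≤ sSup A := le_csSup hbdd hA0
  have hτ1 : sSup A < 1 := lt_of_le_of_lt (csSup_le ⟨0, hA0⟩ hAub) (by linarith)
  set τ := sSup A with hτ
  have hafter : ∀ t ∈ Ioo τ 1, γ t ∈ K ∧ S (γ t) < s := fun t ht => by
    by_contra hnot
    refine absurd (le_csSup hbdd (show t ∈ A from ⟨⟨hτ0.trans ht.1.le, ht.2⟩, fun h => ?_⟩))
      (not_le.2 ht.1)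
    exact not_lt.1 fun hlt => hnot ⟨h, hlt⟩
  have hτA : γ τ ∈ K → s ≤ S (γ τ) := by
    intro hτK
    by_contra hlt
    have h1 : ∀ᶠ t in 𝓝[A] τ, γ t ∈ {x ∈ K | S x < s} :=
      ((hcont τ ⟨hτ0, hτ1.le⟩).mono fun t ht => Ico_subset_Icc_self ht.1).eventually
        ((hK.isOpen_sublevel s).mem_nhds ⟨hτK, not_le.1 hlt⟩)
    have h2 : (𝓝[A] τ).NeBot := mem_closure_iff_nhdsWithin_neBot.1 (csSup_mem_closure ⟨0, hA0⟩ hbdd)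
    obtain ⟨t, ht1, ht2⟩ := (h1.and self_mem_nhdsWithin).exists
    exact absurd (ht2.2 ht1.1) (not_le.2 ht1.2)
  have hτK : γ τ ∈ K := by
    refine hK.mem_of_mem_closure s hsσ _ (hγ.inside τ ⟨hτ0, hτ1⟩) ?_
    have h1 : (𝓝[Ioo τ 1] τ).NeBot :=
      mem_closure_iff_nhdsWithin_neBot.1 (by rw [closure_Ioo hτ1.ne]; exact ⟨le_rfl, hτ1.le⟩)
    have h2 : Tendsto γ (𝓝[Ioo τ 1] τ) (𝓝 (γ τ)) :=
      (hcont τ ⟨hτ0, hτ1.le⟩).mono fun t ht => ⟨hτ0.trans ht.1.le, ht.2.le⟩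
    refine mem_closure_of_tendsto h2 ?_
    filter_upwards [self_mem_nhdsWithin] with t ht
    exact ⟨(hafter t ht).1, (hafter t ht).2.le⟩
  refine ⟨τ, ⟨hτ0, hτ1⟩, hτA hτK, fun t ht => ?_⟩
  rcases ht.1.eq_or_lt with h | h
  · rwa [← h]
  · exact (hafter t ⟨h, ht.2⟩).1

include hH hD hcpt

theorem sq_le_jacobiEnergy {s : ℝ} (hs : 0 < s) (hsσ : s < σ) (hy : y ∈ K → s ≤ S y) :
    s ^ 2 / 4 ≤ jacobiEnergy H E γ := by
  obtain ⟨τ, hτ, hτs, hτK⟩ := hK.exists_lastExit hγ hs hsσ hy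
  refine le_of_forall_pos_le_add fun ε hε => ?_
  obtain ⟨δ, hδ, hend⟩ := hK.eventually_mem_curve hγ (ε := 2 * ε / s) (by positivity)
  obtain ⟨τ', hτ'1, hτ'2⟩ := exists_between (max_lt hτ.2 (by linarith : 1 - δ < 1))
  have hττ' : τ < τ' := (le_max_left _ _).trans_lt hτ'1
  obtain ⟨-, hS⟩ := hend τ' ⟨hτ.1.trans hττ'.le, hτ'2⟩ ((le_max_right _ _).trans_lt hτ'1)
  have hsub : Icc τ τ' ⊆ Icc 0 1 := Icc_subset_Icc hτ.1 hτ'2.le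
  have hγK : ∀ t ∈ Icc τ τ', γ t ∈ K := fun t ht => hτK t ⟨ht.1, ht.2.trans_lt hτ'2⟩
  have hac : AbsolutelyContinuousOnInterval γ τ τ' := hγ.absCont.mono (by
    rw [uIcc_of_le hττ'.le, uIcc_of_le zero_le_one]
    exact hsub)
  obtain ⟨hint, hftc⟩ := hac.integral_fderiv_comp hττ'.le (f := S) fun t ht =>
    (hK.contDiffAt_action (hγK t ht)).of_le one_le_two
  have hGint : IntervalIntegrable (fun t => jacobiG H E (γ t) (deriv γ t)) volume 0 1 :=
    (intervalIntegrable_iff_integrableOn_Icc_of_le zero_le_one).2 (hγ.integrableOn hH hD hcpt)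
  have hGint' : IntervalIntegrable (fun t => jacobiG H E (γ t) (deriv γ t)) volume τ τ' :=
    hGint.mono_set (by rw [uIcc_of_le hττ'.le, uIcc_of_le zero_le_one]; exact hsub)
  have h1 : ∫ t in τ..τ', jacobiG H E (γ t) (deriv γ t) ≤ jacobiEnergy H E γ :=
    intervalIntegral.integral_mono_interval hτ.1 hττ'.le hτ'2.le (hγ.jacobiG_nonneg_ae hH hD) hGint
  have h2 : ∫ t in τ..τ', (-(s / 2) * fderiv ℝ S (γ t) (deriv γ t) - s ^ 2 / 4) ≤
      ∫ t in τ..τ', jacobiG H E (γ t) (deriv γ t) := by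
    refine intervalIntegral.integral_mono_on hττ'.le
      ((hint.const_mul _).sub intervalIntegrable_const) hGint' fun t ht => ?_
    have h3 := hH.sq_inner_le_jacobiG (hD.apply_zero_lt (hK.subset (hγK t ht)))
      (hK.energy _ (hγK t ht)).le (deriv γ t)
    rw [(hK.hasFDerivAt _ (hγK t ht)).fderiv, innerSL_apply_apply]
    nlinarith [sq_nonneg (inner ℝ (P (γ t)) (deriv γ t) + s)]
  rw [intervalIntegral.integral_sub (hint.const_mul _) intervalIntegrable_const,
    intervalIntegral.integral_const_mul, hftc, intervalIntegral.integral_const, smul_eq_mul] at h2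
  have h4 : S (γ τ') * s < 2 * ε := (lt_div_iff₀ hs).1 hS
  have h5 : τ' - τ ≤ 1 := by linarith [hτ.1]
  nlinarith [mul_le_mul_of_nonneg_right h5 (sq_nonneg s), mul_le_mul_of_nonneg_right hτs hs.le]

end IsCalibratedCollar

end LowerBound

section UpperBound

/-- The inverse of a primitive of a continuous function that is bounded below by `ε > 0`. -/
theorem exists_inverse_primitive {ρ : ℝ → ℝ} (hρ : Continuous ρ) {ε : ℝ} (hε : 0 < ε)
    (hle : ∀ t, ε ≤ ρ t) : ∃ θ : ℝ → ℝ, StrictMono θ ∧ (∀ t, θ (∫ x in (0 : ℝ)..t, ρ x) = t) ∧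
      (∀ x, HasDerivAt θ (ρ (θ x))⁻¹ x) ∧ ContDiff ℝ 1 θ := by
  obtain ⟨R, hR⟩ : ∃ R : ℝ → ℝ, R = fun t => ∫ x in (0 : ℝ)..t, ρ x := ⟨_, rfl⟩
  have hd : ∀ t, HasDerivAt R (ρ t) t := fun t => by
    rw [hR]
    exact intervalIntegral.integral_hasDerivAt_right (hρ.intervalIntegrable _ _)
      (hρ.stronglyMeasurableAtFilter _ _) hρ.continuousAt
  have hmono : StrictMono R := strictMono_of_deriv_pos fun t => by
    rw [(hd t).deriv]; linarith [hle t]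
  have hd2 : ∀ t, HasDerivAt (fun t => R t - ε * t) (ρ t - ε * 1) t := fun t =>
    (hd t).sub ((hasDerivAt_id t).const_mul ε)
  have hmono2 : Monotone fun t => R t - ε * t :=
    monotone_of_deriv_nonneg (fun t => (hd2 t).differentiableAt) fun t => by
      rw [(hd2 t).deriv]; linarith [hle t]
  have hR0 : R 0 = 0 := by rw [hR]; simp
  have hsurj : Function.Surjective R := fun c => by
    refine mem_range_of_exists_le_of_exists_ge
      (continuous_iff_continuousAt.2 fun t => (hd t).continuousAt) ⟨-(|c| / ε), ?_⟩ ⟨|c| / ε, ?_⟩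
    · have h1 := hmono2 (show -(|c| / ε) ≤ 0 from neg_nonpos.2 (by positivity))
      simp only [hR0, mul_zero, sub_zero, mul_neg, mul_div_cancel₀ _ hε.ne'] at h1
      linarith [neg_abs_le c]
    · have h1 := hmono2 (show 0 ≤ |c| / ε by positivity)
      simp only [hR0, mul_zero, sub_zero, mul_div_cancel₀ _ hε.ne'] at h1
      linarith [le_abs_self c]
  set e := hmono.orderIsoOfSurjective R hsurj
  have he : ∀ t, R (e.symm t) = t := fun t => e.apply_symm_apply t
  have hθ : ∀ x, HasDerivAt e.symm (ρ (e.symm x))⁻¹ x := fun x =>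
    HasDerivAt.of_local_left_inverse e.symm.continuous.continuousAt (hd _)
      (by linarith [hle (e.symm x)] : 0 < ρ (e.symm x)).ne' (Eventually.of_forall he)
  refine ⟨e.symm, e.symm.strictMono, fun t => ?_, hθ, contDiff_one_iff_deriv.2
    ⟨fun x => (hθ x).differentiableAt, ?_⟩⟩
  · have : (∫ x in (0 : ℝ)..t, ρ x) = R t := by rw [hR]
    rw [this]
    exact e.symm_apply_apply t
  · rw [funext fun x => (hθ x).deriv]
    exact (hρ.comp e.symm.continuous).inv₀ fun x =>
      (by linarith [hle (e.symm x)] : 0 < ρ (e.symm x)).ne'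

variable {n : ℕ} {H : Eucl n → Eucl n → ℝ} {E : ℝ} {D : Set (Eucl n)} {y : Eucl n} {γ : ℝ → Eucl n}

theorem IsAdmissibleCurve.of_contDiffAt (hγ : ∀ x ∈ Icc (0 : ℝ) 1, ContDiffAt ℝ 1 γ x) (h0 : γ 0 = y)
    (hin : ∀ x ∈ Ico (0 : ℝ) 1, γ x ∈ D) (h1 : γ 1 ∈ frontier D) : IsAdmissibleCurve D y γ where
  absCont := by
    refine ContDiffOn.absolutelyContinuousOnInterval fun x hx => ?_
    rw [uIcc_of_le zero_le_one] at hx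
    exact (hγ x hx).contDiffWithinAt
  deriv_memLp := by
    have hc : ContinuousOn (deriv γ) (Icc 0 1) := fun x hx => by
      have h2 := ((hγ x hx).fderiv_right (m := 0) (by norm_num)).continuousAt.clm_apply
        (continuousAt_const (y := (1 : ℝ)))
      simp only [fderiv_apply_one_eq_deriv] at h2
      exact h2.continuousWithinAt
    obtain ⟨C, hC⟩ := isCompact_Icc.exists_bound_of_continuousOn hc
    exact MemLp.of_bound (measurable_deriv γ).aestronglyMeasurable C
      ((ae_restrict_iff' measurableSet_Icc).2 (Eventually.of_forall hC))
  start := h0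
  inside := hin
  finish := h1

theorem exists_isAdmissibleCurve (hD : IsOpen D) (hne : (frontier D).Nonempty) (hy : y ∈ D) :
    ∃ γ, IsAdmissibleCurve D y γ := by
  obtain ⟨Q, hQ⟩ := hne
  have hQD : Q ∉ D := (hD.frontier_eq ▸ hQ).2
  have hc : Continuous fun s : ℝ => y + s • (Q - y) := by fun_prop
  set A := Icc (0 : ℝ) 1 ∩ (fun s : ℝ => y + s • (Q - y)) ⁻¹' Dᶜ with hA
  have hAc : IsClosed A := isClosed_Icc.inter (hD.isClosed_compl.preimage hc)
  have hA1 : (1 : ℝ) ∈ A := ⟨⟨zero_le_one, le_rfl⟩, by simpa using hQD⟩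
  have hbdd : BddBelow A := ⟨0, fun s hs => hs.1.1⟩
  have hmem : sInf A ∈ A := hAc.csInf_mem ⟨1, hA1⟩ hbdd
  set τ := sInf A with hτ
  have hτ0 : 0 < τ := hmem.1.1.lt_of_ne' fun h => hmem.2 (by simpa [h] using hy)
  have hin : ∀ s ∈ Ico 0 τ, y + s • (Q - y) ∈ D := fun s hs => by
    by_contra hnot
    exact absurd (csInf_le hbdd (show s ∈ A from ⟨⟨hs.1, hs.2.le.trans hmem.1.2⟩, hnot⟩))
      (not_le.2 hs.2)
  refine ⟨fun x => y + (x * τ) • (Q - y), IsAdmissibleCurve.of_contDiffAt (fun x _ => ?_) (by simp)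
    (fun x hx => hin _ ⟨by have := hx.1; positivity, by nlinarith [hx.2]⟩) ?_⟩
  · have : ContDiff ℝ 1 fun x : ℝ => y + (x * τ) • (Q - y) := by fun_prop
    exact this.contDiffAt
  · rw [hD.frontier_eq, one_mul]
    refine ⟨?_, hmem.2⟩
    have h1 : (𝓝[Ico 0 τ] τ).NeBot :=
      mem_closure_iff_nhdsWithin_neBot.1 (by rw [closure_Ico hτ0.ne]; exact ⟨hτ0.le, le_rfl⟩)
    exact mem_closure_of_tendsto ((hc.tendsto τ).mono_left nhdsWithin_le_nhds)
      (eventually_nhdsWithin_of_forall hin)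

theorem IsClassicalHamiltonian.gradP_neg (hH : IsClassicalHamiltonian H) (q p : Eucl n) :
    gradP H (q, -p) = -gradP H (q, p) := by
  have h1 := HasFDerivAt.comp (g := H q) (f := fun c => -c) p (hH.hasFDerivAt_right q (-p))
    (hasFDerivAt_id p).neg
  have h2 : H q ∘ (fun c => -c) = H q := funext (hH.even q)
  rw [h2] at h1
  have h3 := h1.unique (hH.hasFDerivAt_right q p)
  refine ext_inner_right ℝ fun v => ?_
  have h4 := congrArg (fun L => L v) h3
  simp at h4
  rw [inner_neg_left, ← h4, neg_neg]

/-- Trajectories that start at rest on `∂D` are almost minimal after reparametrization. -/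
theorem IsBrakeCollar.exists_jacobiEnergy_le {r T s : ℝ} {q p : ℝ × Eucl n → Eucl n}
    {z : ℝ × Eucl n → ℝ} (hH : IsClassicalHamiltonian H) (hD : IsPotentialWell H E D)
    (hcpt : IsCompact (closure D)) (hC : IsBrakeCollar H E D r T s q p z) {w : ℝ × Eucl n}
    (hw : w ∈ Ioo 0 s ×ˢ frontier D) {ε : ℝ} (hε : 0 < ε) :
    ∃ γ, IsAdmissibleCurve D (q w) γ ∧ jacobiEnergy H E γ ≤ (z w + ε * w.1) ^ 2 / 4 := by
  obtain ⟨t₀, Q⟩ := w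
  obtain ⟨ht₀, hQ⟩ : t₀ ∈ Ioo 0 s ∧ Q ∈ frontier D := hw
  have hQr := hC.frontier_subset hQ
  have hs0 : (0 : ℝ) ≤ s := hC.pos.le
  have hpos : ∀ t ∈ Icc 0 s, 0 ≤ inner ℝ (gradP H (q (t, Q), p (t, Q))) (p (t, Q)) := fun t _ =>
    le_trans (mul_nonneg (hH.modulus_pos _).le (sq_nonneg _)) (hH.inner_gradP_self_ge _ _)
  obtain ⟨k, hk⟩ : ∃ k : ℝ → ℝ, k = fun t => inner ℝ (gradP H (q (t, Q), p (t, Q))) (p (t, Q)) :=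
    ⟨_, rfl⟩
  have hsub : ∀ t ∈ Icc 0 s, ((t, Q) : ℝ × Eucl n) ∈ Ioo (-T) T ×ˢ Metric.ball 0 r := fun t ht =>
    hC.subset_domain ⟨ht, hQ⟩
  have hqc : ContinuousOn (fun t => q (t, Q)) (Icc 0 s) :=
    hC.flow.contDiffOn_q.continuousOn.comp (by fun_prop) hsub
  have hpc : ContinuousOn (fun t => p (t, Q)) (Icc 0 s) :=
    hC.flow.contDiffOn_p.continuousOn.comp (by fun_prop) hsub
  have hkc : ContinuousOn k (Icc 0 s) := by
    rw [hk]
    exact (hH.contDiff_gradP.continuous.comp_continuousOn (hqc.prodMk hpc)).inner hpc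
  obtain ⟨ρ, hρ⟩ : ∃ ρ : ℝ → ℝ, ρ = fun t => IccExtend hs0 ((Icc 0 s).domRestrict k) t + ε := ⟨_, rfl⟩
  have hρc : Continuous ρ := by
    rw [hρ]
    exact (hkc.domRestrict.Icc_extend').add continuous_const
  have hρle : ∀ t, ε ≤ ρ t := fun t => by
    rw [hρ]
    have h1 : 0 ≤ IccExtend hs0 ((Icc 0 s).domRestrict k) t := by
      rw [IccExtend, Function.comp_apply, domRestrict_apply, hk]
      exact hpos _ (projIcc 0 s hs0 t).2
    linarith
  have hρk : ∀ t ∈ Icc 0 s, ρ t = k t + ε := fun t ht => by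
    rw [hρ]
    simp only [IccExtend_of_mem hs0 _ ht, domRestrict_apply]
  obtain ⟨θ, hθm, hθ, hθd, hθc⟩ := exists_inverse_primitive hρc hε hρle
  have hR : (∫ x in (0 : ℝ)..t₀, ρ x) = z (t₀, Q) + ε * t₀ := by
    rw [intervalIntegral.integral_eq_sub_of_hasDerivAt (f := fun t => z (t, Q) + ε * t)
      (fun t ht => ?_) (hρc.intervalIntegrable _ _)]
    · rw [hC.flow.z_zero Q hQr]; ring
    · rw [uIcc_of_le ht₀.1.le] at ht
      have ht' : t ∈ Icc 0 s := ⟨ht.1, ht.2.trans ht₀.2.le⟩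
      rw [hρk t ht', hk]
      have h1 := (hC.flow.deriv_z t (hC.mem_Ioo ht') Q hQr).add ((hasDerivAt_id t).const_mul ε)
      rwa [mul_one] at h1
  obtain ⟨R, hRdef⟩ : ∃ R, R = z (t₀, Q) + ε * t₀ := ⟨_, rfl⟩
  have hθR : θ R = t₀ := by rw [hRdef, ← hR, hθ]
  have hθ0 : θ 0 = 0 := by simpa using hθ 0
  have hR0 : 0 < R := by
    rw [← hθm.lt_iff_lt, hθ0, hθR]
    exact ht₀.1
  have hθmem : ∀ x ∈ Icc (0 : ℝ) 1, θ ((1 - x) * R) ∈ Icc 0 s := fun x hx => by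
    constructor
    · rw [← hθ0]
      exact hθm.monotone (mul_nonneg (by linarith [hx.2]) hR0.le)
    · refine le_trans ?_ ht₀.2.le
      rw [← hθR]
      exact hθm.monotone (by nlinarith [hx.1])
  have hθpos : ∀ x ∈ Ico (0 : ℝ) 1, θ ((1 - x) * R) ∈ Ioc 0 s := fun x hx => by
    refine ⟨?_, (hθmem x (Ico_subset_Icc_self hx)).2⟩
    conv_lhs => rw [← hθ0]
    exact hθm (mul_pos (by linarith [hx.2]) hR0)
  have hγc : ∀ x ∈ Icc (0 : ℝ) 1, ContDiffAt ℝ 1 (fun x => q (θ ((1 - x) * R), Q)) x := fun x hx => by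
    have h1 : ContDiff ℝ 1 fun x : ℝ => (θ ((1 - x) * R), Q) :=
      (hθc.comp ((contDiff_const.sub contDiff_id).mul contDiff_const)).prodMk contDiff_const
    exact ContDiffAt.comp (g := q) (f := fun x : ℝ => (θ ((1 - x) * R), Q)) x
      (hC.flow.contDiffAt_q (hC.mem_Ioo (hθmem x hx)) hQr) h1.contDiffAt
  have hadm : IsAdmissibleCurve D (q (t₀, Q)) (fun x => q (θ ((1 - x) * R), Q)) := by
    refine IsAdmissibleCurve.of_contDiffAt hγc (by simp [hθR]) (fun x hx => ?_) ?_
    · exact hC.mem (_, Q) ⟨hθpos x hx, hQ⟩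
    · simp only [sub_self, zero_mul, hθ0]
      rwa [hC.flow.q_zero Q hQr]
  refine ⟨_, hadm, ?_⟩
  rw [show z (t₀, Q) + ε * ((t₀, Q) : ℝ × Eucl n).1 = R from hRdef.symm]
  have hint := (intervalIntegrable_iff_integrableOn_Icc_of_le zero_le_one).2
    (hadm.integrableOn hH hD hcpt)
  have hle : jacobiEnergy H E (fun x => q (θ ((1 - x) * R), Q)) ≤ ∫ _ in (0 : ℝ)..1, R ^ 2 / 4 := by
    refine intervalIntegral.integral_mono_on_of_le_Ioo zero_le_one hint intervalIntegrable_const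
      fun x hx => ?_
    have hx' := hθmem x (Ioo_subset_Icc_self hx)
    obtain ⟨t, ht⟩ : ∃ t, t = θ ((1 - x) * R) := ⟨_, rfl⟩
    have hd : HasDerivAt (fun x => θ ((1 - x) * R)) ((ρ t)⁻¹ * (-1 * R)) x := by
      have h1 := (((hasDerivAt_id x).const_sub 1).mul_const R)
      have h2 := HasDerivAt.comp (h₂ := θ) (h := fun x => (1 - x) * R) x (hθd _) h1
      rwa [← ht] at h2
    have hdq : HasDerivAt (fun x => q (θ ((1 - x) * R), Q))
        (((ρ t)⁻¹ * (-1 * R)) • gradP H (q (t, Q), p (t, Q))) x := by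
      have h1 := hC.flow.deriv_q _ (hC.mem_Ioo hx') Q hQr
      have h2 := HasDerivAt.scomp (g₁ := fun s => q (s, Q)) (h := fun x => θ ((1 - x) * R)) x h1 hd
      rwa [← ht] at h2
    simp only [hdq.deriv, ← ht]
    have htp : t ∈ Ioc 0 s := ht ▸ hθpos x ⟨hx.1.le, hx.2⟩
    have hq : q (t, Q) ∈ D := hC.mem (t, Q) ⟨htp, hQ⟩
    have hρt : 0 < ρ t := hε.trans_le (hρle t)
    have hm : IsMomentum H E (q (t, Q)) (((ρ t)⁻¹ * (-1 * R)) • gradP H (q (t, Q), p (t, Q)))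
        (-p (t, Q)) ((ρ t)⁻¹ * R) := by
      refine ⟨?_, ?_, by positivity⟩
      · rw [hH.even, hC.flow.energy t (hC.mem_Ioo (Ioc_subset_Icc_self htp)) Q hQr]
        exact hD.eq_on Q hQ
      · rw [hH.gradP_neg, smul_neg, ← neg_smul]
        congr 1
        ring
    rw [hH.jacobiG_of_isMomentum (hD.apply_zero_lt hq) hm, inner_neg_right, inner_smul_left]
    have hkt := hρk t (Ioc_subset_Icc_self htp)
    have hk0 := hpos t (Ioc_subset_Icc_self htp)
    have hkt' : k t = inner ℝ (gradP H (q (t, Q), p (t, Q))) (p (t, Q)) := by rw [hk]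
    rw [← hkt'] at hk0 ⊢
    have h5 : (ρ t)⁻¹ * k t ≤ 1 := by
      rw [inv_mul_le_iff₀ hρt]
      linarith
    have h6 : 0 ≤ (ρ t)⁻¹ * k t := by positivity
    have h7 : -((starRingEnd ℝ) ((ρ t)⁻¹ * (-1 * R)) * k t) = R * ((ρ t)⁻¹ * k t) := by
      rw [conj_trivial]
      ring
    rw [h7, mul_pow]
    have h8 : ((ρ t)⁻¹ * k t) ^ 2 ≤ 1 := pow_le_one₀ h6 h5
    have h9 : R ^ 2 * ((ρ t)⁻¹ * k t) ^ 2 ≤ R ^ 2 * 1 := by gcongr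
    linarith
  rw [intervalIntegral.integral_const, sub_zero, one_smul] at hle
  exact hle

end UpperBound

section Psi

variable {n : ℕ} {H : Eucl n → Eucl n → ℝ} {E σ : ℝ} {D K : Set (Eucl n)} {S : Eucl n → ℝ}
  {P : Eucl n → Eucl n} {y : Eucl n}

namespace IsCalibratedCollar

section Formula

variable (hH : IsClassicalHamiltonian H) (hD : IsPotentialWell H E D) (hcpt : IsCompact (closure D))
  (hne : (frontier D).Nonempty) (hK : IsCalibratedCollar H E D σ K S P)

include hH hD hcpt hne hK

theorem sq_le_psi {s : ℝ} (hs : 0 < s) (hsσ : s < σ) (hyD : y ∈ D) (hy : y ∈ K → s ≤ S y) :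
    s ^ 2 / 4 ≤ psi H E D y := by
  obtain ⟨γ, hγ⟩ := exists_isAdmissibleCurve hD.isOpen hne hyD
  refine le_csInf ⟨_, γ, hγ, rfl⟩ ?_
  rintro _ ⟨γ', hγ', rfl⟩
  exact hK.sq_le_jacobiEnergy hH hD hcpt hγ' hs hsσ hy

theorem psi_eq {r T s : ℝ} {q p : ℝ × Eucl n → Eucl n} {z : ℝ × Eucl n → ℝ}
    (hC : IsBrakeCollar H E D r T s q p z) (hy : y ∈ K) {w : ℝ × Eucl n}
    (hw : w ∈ Ioo 0 s ×ˢ frontier D) (hqw : q w = y) (hzw : z w = S y) :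
    psi H E D y = S y ^ 2 / 4 := by
  refine le_antisymm ?_ (hK.sq_le_psi hH hD hcpt hne (hK.pos_of_mem y hy) (hK.lt_of_mem y hy)
    (hK.subset hy) fun _ => le_rfl)
  have h1 : ∀ᶠ ε in 𝓝[>] (0 : ℝ), psi H E D y ≤ (z w + ε * w.1) ^ 2 / 4 := by
    filter_upwards [self_mem_nhdsWithin] with ε hε
    obtain ⟨γ, hγ, hle⟩ := hC.exists_jacobiEnergy_le hH hD hcpt hw hε
    rw [hqw] at hγ
    exact (csInf_le (hD.bddBelow_jacobiEnergy hH y) ⟨γ, hγ, rfl⟩).trans hle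
  have h2 : Tendsto (fun ε : ℝ => (z w + ε * w.1) ^ 2 / 4) (𝓝[>] 0) (𝓝 ((z w + 0 * w.1) ^ 2 / 4)) := by
    have : Continuous fun ε : ℝ => (z w + ε * w.1) ^ 2 / 4 := by fun_prop
    exact (this.tendsto 0).mono_left nhdsWithin_le_nhds
  have h3 := ge_of_tendsto h2 h1
  rwa [zero_mul, add_zero, hzw] at h3

end Formula

/-- A function of the form `S² / 4 + const` near `y` is strongly convex along the geodesics that are
tangent to its level set. -/
theorem regular_and_hasFinslerHessian (hH : IsClassicalHamiltonian H) (hD : IsPotentialWell H E D)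
    (hK : IsCalibratedCollar H E D σ K S P) (hy : y ∈ K) {f : Eucl n → ℝ} {c : ℝ}
    (hf : f =ᶠ[𝓝 y] fun x => S x ^ 2 / 4 - c) :
    ContDiffAt ℝ 2 f y ∧ fderiv ℝ f y ≠ 0 ∧ ∀ ξ, ξ ≠ 0 → fderiv ℝ f y ξ = 0 →
      ∃ h, HasFinslerHessian (jacobiF H E) D f y ξ h ∧ 0 < h := by
  have hfc : ContDiffAt ℝ 2 f y :=
    ((((hK.contDiffAt_action hy).pow 2).div_const 4).sub contDiffAt_const).congr_of_eventuallyEq hf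
  have hfd : ∀ x ∈ K, HasFDerivAt (fun x => S x ^ 2 / 4 - c) ((S x / 2) • innerSL ℝ (P x)) x := fun x hx => by
    have h1 := (((hK.hasFDerivAt x hx).pow 2).mul_const (1 / 4 : ℝ)).sub_const c
    have h2 : (fun x => S x ^ 2 * (1 / 4 : ℝ) - c) = fun x => S x ^ 2 / 4 - c := by
      funext x; ring
    rw [h2] at h1
    refine h1.congr_fderiv ?_
    ext v
    simp
    ring
  have hnK : ∀ᶠ x in 𝓝 y, x ∈ K := hK.isOpen.mem_nhds hy
  have hfd' : fderiv ℝ f =ᶠ[𝓝 y] fun x => (S x / 2) • innerSL ℝ (P x) := by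
    filter_upwards [hf.eventuallyEq_nhds, hnK] with x h1 h2
    rw [h1.fderiv_eq, (hfd x h2).fderiv]
  have hS0 := hK.pos_of_mem y hy
  have hyD := hK.subset hy
  have hP0 : P y ≠ 0 := IsClassicalHamiltonian.ne_zero_of_energy (hD.apply_zero_lt hyD) (hK.energy y hy)
  refine ⟨hfc, ?_, fun ξ hξ hξ0 => ?_⟩
  · rw [hfd'.eq_of_nhds]
    refine smul_ne_zero (half_pos hS0).ne' fun h => hP0 ?_
    have := congrArg (fun L => L (P y)) h
    simpa using this
  · obtain ⟨π, μ, hm⟩ := hH.exists_isMomentum (hD.apply_zero_lt hyD) hξ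
    refine ⟨_, hH.hasFinslerHessian (fun q hq => hD.apply_zero_lt hq) hD.isOpen hyD hm hfc hξ0, ?_⟩
    obtain ⟨u, hu⟩ : ∃ u, u = gradP H (y, π) := ⟨_, rfl⟩
    have hξu : ξ = μ • u := hu ▸ hm.velocity
    rw [hfd'.eq_of_nhds, _root_.smul_apply, innerSL_apply_apply, smul_eq_mul] at hξ0
    have hPξ : inner ℝ (P y) ξ = 0 := (mul_eq_zero.1 hξ0).resolve_left (half_pos hS0).ne'
    have hPu : inner ℝ (P y) u = 0 := by
      rw [hξu, inner_smul_right] at hPξ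
      exact (mul_eq_zero.1 hPξ).resolve_left hm.pos.ne'
    have hpos := hK.hessian_pos y hy π hm.energy (hu ▸ hPu)
    rw [← hu] at hpos
    have hPd : HasFDerivAt P (fderiv ℝ P y) y :=
      ((hK.contDiffAt y hy).differentiableAt one_ne_zero).hasFDerivAt
    have hdd : fderiv ℝ (fderiv ℝ f) y ξ ξ = S y / 2 * inner ℝ (fderiv ℝ P y ξ) ξ := by
      rw [hfd'.fderiv_eq]
      have h1 := (((hK.hasFDerivAt y hy).mul_const (1 / 2 : ℝ)).smul
        (HasFDerivAt.comp (g := innerSL ℝ) (f := P) y (innerSL ℝ (E := Eucl n)).hasFDerivAt hPd))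
      have h2 : (fun x => (S x * (1 / 2 : ℝ)) • innerSL ℝ (P x)) =
          fun x => (S x / 2) • innerSL ℝ (P x) := by
        funext x; rw [mul_one_div]
      have h3 : HasFDerivAt (fun x => (S x * (1 / 2 : ℝ)) • innerSL ℝ (P x)) _ y := h1
      rw [← h2, h3.fderiv]
      simp [hPξ]
      ring_nf
      rfl
    rw [hdd, hfd'.eq_of_nhds, _root_.smul_apply, innerSL_apply_apply, smul_eq_mul]
    have h4 : fderiv ℝ (gradP H) (y, π) (ξ, -(μ • gradQ H (y, π))) =
        μ • fderiv ℝ (gradP H) (y, π) (u, -gradQ H (y, π)) := by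
      rw [← map_smul, Prod.smul_mk, smul_neg, hξu]
    rw [h4, hξu, map_smul, inner_smul_left, inner_smul_right, inner_smul_right, conj_trivial]
    have h5 : 0 < S y / 2 * μ ^ 2 := mul_pos (half_pos hS0) (pow_pos hm.pos 2)
    have h6 := mul_pos h5 hpos
    linarith

end IsCalibratedCollar

end Psi

end

theorem mainTheorem2 {n : ℕ} (H : Eucl n → Eucl n → ℝ) (hH : IsClassicalHamiltonian H)
    (E : ℝ) (D : Set (Eucl n)) (hD : IsPotentialWell H E D) (hcpt : IsCompact (closure D)) :
    (∀ δbar : ℝ, 0 < δbar → ∃ δhat : ℝ, 0 < δhat ∧ δhat ≤ δbar ∧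
      ∀ y ∈ D, 0 < Metric.infDist y (frontier D) → Metric.infDist y (frontier D) ≤ δhat →
        ContDiffAt ℝ 2 (psi H E D) y ∧
        ∀ ξ : Eucl n, ξ ≠ 0 → fderiv ℝ (psi H E D) y ξ = 0 →
          ∃ h : ℝ, HasFinslerHessian (jacobiF H E) D (psi H E D) y ξ h ∧ 0 < h) ∧
    (∃ c₀ : ℝ, 0 < c₀ ∧ ∀ c : ℝ, 0 < c → c ≤ c₀ →
      IsStronglyConcave (jacobiF H E) D {y ∈ D | c < psi H E D y}) := by
  rcases (frontier D).eq_empty_or_nonempty with hempty | hne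
  · refine ⟨fun δ hδ => ⟨δ, hδ, le_rfl, fun y _ h => ?_⟩, 1, one_pos, fun c hc _ => ?_⟩
    · rw [hempty, Metric.infDist_empty] at h
      exact absurd h (lt_irrefl _)
    · have hpsi : ∀ y, psi H E D y = 0 := fun y => by
        have h1 : {γ | IsAdmissibleCurve D y γ} = ∅ :=
          eq_empty_of_forall_notMem fun γ hγ => by
            have := hγ.finish
            rw [hempty] at this
            exact this
        rw [psi, h1, image_empty, Real.sInf_empty]
      have h2 : {y ∈ D | c < psi H E D y} = ∅ :=
        eq_empty_of_forall_notMem fun y hy => by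
          have := hy.2
          rw [hpsi] at this
          exact absurd this (not_lt.2 hc.le)
      rw [h2]
      exact ⟨isOpen_empty, by simp, fun _ => 0, by simp, by simp⟩
  obtain ⟨r, T, s, q, p, z, hC⟩ := hH.exists_brakeCollar hD hcpt
  obtain ⟨σ, K, S, P, hK, hKw⟩ := hC.exists_calibratedCollar hH hD hcpt hne
  have hpsi : ∀ y ∈ K, psi H E D y = S y ^ 2 / 4 := fun y hy => by
    obtain ⟨w, hw, hqw, hzw⟩ := hKw y hy
    exact hK.psi_eq hH hD hcpt hne hC hy hw hqw hzw
  have hpsi' : ∀ y ∈ K, ∀ c : ℝ, (fun x => psi H E D x - c) =ᶠ[𝓝 y] fun x => S x ^ 2 / 4 - c := fun y hy c => by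
    filter_upwards [hK.isOpen.mem_nhds hy] with x hx
    rw [hpsi x hx]
  refine ⟨fun δbar hδbar => ?_, σ ^ 2 / 16, by have := hK.pos; positivity, fun c hc hcσ => ?_⟩
  · have hΓ : IsCompact (frontier D) :=
      hcpt.of_isClosed_subset isClosed_frontier frontier_subset_closure
    have hnhds : {y | y ∈ D → y ∈ K} ∈ 𝓝ˢ (frontier D) :=
      mem_nhdsSet_iff_forall.2 fun Q hQ => by
        filter_upwards [hK.eventually_mem Q hQ 1 one_pos] with y hy hyD using (hy hyD).1
    obtain ⟨U, hU, hΓU, hUK⟩ := mem_nhdsSet_iff_exists.1 hnhds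
    obtain ⟨δ, hδ, hδU⟩ := hΓ.exists_cthickening_subset_open hU hΓU
    refine ⟨min δ δbar, lt_min hδ hδbar, min_le_right _ _, fun y hyD _ hy => ?_⟩
    have hyK : y ∈ K := hUK (hδU (by
      rw [Metric.mem_cthickening_iff, ← ENNReal.ofReal_toReal (Metric.infEDist_ne_top hne)]
      exact ENNReal.ofReal_le_ofReal (hy.trans (min_le_left _ _)))) hyD
    have h0 := hpsi' y hyK 0
    simp only [sub_zero] at h0
    obtain ⟨h1, -, h2⟩ := hK.regular_and_hasFinslerHessian hH hD hyK (f := psi H E D) (c := 0)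
      (by simpa only [sub_zero] using h0)
    exact ⟨h1, h2⟩
  · obtain ⟨τ, hτ⟩ : ∃ τ, τ = 2 * √c := ⟨_, rfl⟩
    have hτ0 : 0 < τ := by rw [hτ]; have := Real.sqrt_pos.2 hc; positivity
    have hτc : τ ^ 2 / 4 = c := by
      rw [hτ, mul_pow, Real.sq_sqrt hc.le]
      ring
    have hτσ : τ < σ := by
      have h1 : τ ^ 2 < σ ^ 2 := by nlinarith [pow_pos hK.pos 2]
      exact lt_of_pow_lt_pow_left₀ 2 hK.pos.le h1
    have hmem : ∀ y ∈ D, (c < psi H E D y ↔ y ∉ {x ∈ K | S x ≤ τ}) := fun y hyD => by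
      constructor
      · rintro h ⟨hyK, hle⟩
        rw [hpsi y hyK, ← hτc] at h
        have := pow_le_pow_left₀ (hK.pos_of_mem y hyK).le hle 2
        linarith
      · intro h
        obtain ⟨τ', hτ'1, hτ'2⟩ : ∃ τ', τ < τ' ∧ τ' < σ ∧ (y ∈ K → τ' ≤ S y) := by
          by_cases hyK : y ∈ K
          · exact ⟨S y, not_le.1 fun hle => h ⟨hyK, hle⟩, hK.lt_of_mem y hyK, fun _ => le_rfl⟩
          · obtain ⟨τ', h1, h2⟩ := exists_between hτσ
            exact ⟨τ', h1, h2, fun h => absurd h hyK⟩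
        have h1 := hK.sq_le_psi hH hD hcpt hne (hτ0.trans hτ'1) hτ'2.1 hyD hτ'2.2
        have h2 := pow_lt_pow_left₀ hτ'1 hτ0.le two_ne_zero
        linarith
    have hopen : IsOpen {y ∈ D | c < psi H E D y} := by
      have h1 : {y ∈ D | c < psi H E D y} = D ∩ (closure {x ∈ K | S x ≤ τ})ᶜ := by
        ext y
        refine ⟨fun hy => ⟨hy.1, fun hcl => ?_⟩, fun hy => ⟨hy.1, (hmem y hy.1).2 fun h =>
          hy.2 (subset_closure h)⟩⟩
        have hyK := hK.mem_of_mem_closure τ hτσ y hy.1 hcl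
        refine (hmem y hy.1).1 hy.2 ⟨hyK, ?_⟩
        have h2 : (𝓝[{x ∈ K | S x ≤ τ}] y).NeBot := mem_closure_iff_nhdsWithin_neBot.1 hcl
        have h3 : ∀ᶠ x in 𝓝[{x ∈ K | S x ≤ τ}] y, S x ≤ τ := by
          filter_upwards [self_mem_nhdsWithin] with x hx using hx.2
        exact le_of_tendsto ((hK.hasFDerivAt y hyK).continuousAt.tendsto.mono_left
          nhdsWithin_le_nhds) h3
      rw [h1]
      exact hD.isOpen.inter isClosed_closure.isOpen_compl
    have hclosure : closure {y ∈ D | c < psi H E D y} ⊆ D := by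
      intro y hy
      by_contra hyD
      have hyf : y ∈ frontier D := by
        rw [hD.isOpen.frontier_eq]
        exact ⟨closure_mono (sep_subset _ _) hy, hyD⟩
      have h1 : (𝓝[{y ∈ D | c < psi H E D y}] y).NeBot := mem_closure_iff_nhdsWithin_neBot.1 hy
      obtain ⟨x, hx1, hx2⟩ := ((eventually_nhdsWithin_of_eventually_nhds
        (s := {y ∈ D | c < psi H E D y}) (hK.eventually_mem y hyf τ hτ0)).and
          self_mem_nhdsWithin).exists
      obtain ⟨h2, h3⟩ := hx1 hx2.1
      exact (hmem x hx2.1).1 hx2.2 ⟨h2, h3.le⟩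
    refine ⟨hopen, hclosure, fun y => psi H E D y - c, fun y hy => sub_pos.2 hy.2, fun y hy => ?_⟩
    rw [hopen.frontier_eq] at hy
    have hyD := hclosure hy.1
    obtain ⟨hyK, hSle⟩ : y ∈ {x ∈ K | S x ≤ τ} := by
      by_contra h
      exact hy.2 ⟨hyD, (hmem y hyD).2 h⟩
    obtain ⟨h1, h2, h3⟩ := hK.regular_and_hasFinslerHessian hH hD hyK (hpsi' y hyK c)
    refine ⟨h1, ?_, h2, h3⟩
    have h4 : (𝓝[{y ∈ D | c < psi H E D y}] y).NeBot := mem_closure_iff_nhdsWithin_neBot.1 hy.1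
    have h8 : ∀ᶠ x in 𝓝[{y ∈ D | c < psi H E D y}] y, 0 ≤ psi H E D x - c := by
      filter_upwards [self_mem_nhdsWithin] with x hx using (sub_pos.2 hx.2).le
    have h5 : 0 ≤ psi H E D y - c :=
      ge_of_tendsto (h1.continuousAt.tendsto.mono_left nhdsWithin_le_nhds) h8
    have h6 := pow_le_pow_left₀ (hK.pos_of_mem y hyK).le hSle 2
    have h7 := hpsi y hyK
    linarith
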